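/- **Problem.** Fix $M\ge 1$ and dimensions $d_0,\dots,d_M$. For $K\ge 1$ agents let $f^k:\mathbb R^{d_0}\times\mathbb R^{d_M}\to\mathbb R$ and $g_m^k:\mathbb R^{d_{m-1}}\times\mathbb R^{d_m}\to\mathbb R$ ($1\le m\le M$), $f=\frac1K\sum_k f^k$, $g_m=\frac1K\sum_k g_m^k$, $y_0^\star(x)=x$, $y_m^\star(x)=\arg\min_{y}g_m(y_{m-1}^\star(x),y)$ and $F(x)=f(x,y_M^\star(x))$. Write $\nabla_1,\nabla_2$ for partial gradients, $\nabla^2_{12}g_m^k\in\mathbb R^{d_{m-1}\times d_m}$ and $\nabla^2_{22}g_m^k\in\mathbb R^{d_m\times d_m}$ for the second derivatives, $\|\cdot\|$ for the Euclidean or spectral norm and $\|\cdot\|_F$ for the Frobenius norm. **Assumptions.** Let $C_f,L_f,C_{g,m},L_{g,m},\widetilde L_{g,m},\mu_{g,m}>0$ and $0<\kappa_{g,m}<1$ with $\kappa_{g,m}\le\mu_{g,m}/L_{g,m}\le1$. 1. *Oracle.* Agent $k$ can draw samples $\zeta^k$ and $\xi_m^k$ giving unbiased estimates $\nabla_1f^k(x,y;\zeta^k)$,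 $\nabla_2f^k(x,y;\zeta^k)$, $\nabla_2g_m^k(a,y;\xi_m^k)$, $\nabla_{12}^2g_m^k(a,y;\xi_m^k)$, $\nabla_{22}^2g_m^k(a,y;\xi_m^k)$. The samples drawn below are mutually independent over iterations, agents, levels and sample numbers. 2. *Gossip.* $W\in\mathbb R^{K\times K}$ is symmetric and doubly stochastic with nonnegative entries, and $\|W-\frac1K\mathbf 1\mathbf 1^\top\|^2=\rho<1$. 3. *Outer level.* $F$ has a minimizer. Each $f^k$ is differentiable and, for $i=1,2$, $\|\nabla_if^k(x,y)-\nabla_if^k(x',y')\|\le L_f(\|x-x'\|+\|y-y'\|)$ and $\mathbb E\|\nabla_if^k(x,y;\zeta^k)\|^2\le C_f^2$ for all arguments. 4. *Inner levels.* For every $m$: $g_m(a,\cdot)$ is $\mu_{g,m}$-strongly convex for every $a$; each $g_m^k$ is twice continuously differentiable; $\nabla_2g_m^k$ is Lipschitz with constant $L_{g,m}$, and $\nabla^2_{12}g_m^k$, $\nabla^2_{22}g_m^k$ are Lipschitz in $\|\cdot\|_F$ with constant $\widetilde L_{g,m}$, all with respect to $\|a-a'\|+\|y-y'\|$; and for all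 $(a,y)$ $$\mathbb E\|\nabla_2g_m^k(a,y;\xi_m^k)-\nabla_2g_m(a,y)\|^2\le C_{g,m}^2,\qquad \mathbb E\|\nabla_{22}^2g_m^k(a,y;\xi_m^k)\|^2\le L_{g,m}^2,$$ $$\mathbb E\|\nabla_{12}^2g_m^k(a,y;\xi_m^k)\|^2\le L_{g,m}^2,\qquad \mathbb E\|\mathbf I-\tfrac1{L_{g,m}}\nabla_{22}^2g_m^k(a,y;\xi_m^k)\|^2\le(1-\kappa_{g,m})^2.$$ Let further $F(0)-\min F\le\Delta$ and $\|y_m^\star(0)\|\le D$ for all $m$. **Algorithm.** Put $\alpha=C_0\sqrt{K/T}$, $\beta=\gamma=\sqrt{K/T}$, $b_m=3\lceil\log_{1/(1-\kappa_{g,m})}T\rceil$. Start from $x_0^k=0$, $y_{m,0}^k=0$, $s_0^k=0$, $h_0^k=0$, $u_{m,0}^k=0$, $q_{m,0}^k=0$, $v_{m,0,i}^k=\mu_{g,m}\mathbf I$. For $t=0,1,\dots,T-1$ every agent $k$ computes, with $y_{0,t}^k=x_t^k$, $$x_{t+1}^k=\sum_jw_{k,j}x_t^j-\alpha\big(s_t^k+(-1)^Mu_{1,t}^kq_{1,t}^k\cdots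 u_{M,t}^kq_{M,t}^kh_t^k\big),$$ $$s_{t+1}^k=(1-\beta)\sum_jw_{k,j}s_t^j+\beta\nabla_1f^k(x_t^k,y_{M,t}^k;\zeta_t^k),\qquad h_{t+1}^k=(1-\beta)\sum_jw_{k,j}h_t^j+\beta\nabla_2f^k(x_t^k,y_{M,t}^k;\zeta_t^k),$$ and for $m=1,\dots,M$ and $i=1,\dots,b_m$ $$y_{m,t+1}^k=\sum_jw_{k,j}y_{m,t}^j-\gamma\nabla_2g_m^k(y_{m-1,t}^k,y_{m,t}^k;\xi_{m,t}^k),$$ $$u_{m,t+1}^k=(1-\beta)\sum_jw_{k,j}u_{m,t}^j+\beta\nabla^2_{12}g_m^k(y_{m-1,t}^k,y_{m,t}^k;\xi_{m,t}^k),$$ $$v_{m,t+1,i}^k=(1-\beta)\sum_jw_{k,j}v_{m,t,i}^j+\beta\nabla^2_{22}g_m^k(y_{m-1,t}^k,y_{m,t}^k;\xi_{m,t,i}^k),$$ $$Q_{m,t+1,0}^k=\mathbf I,\quad Q_{m,t+1,i}^k=\mathbf I+\big(\mathbf I-\tfrac1{L_{g,m}}v_{m,t+1,i}^k\big)Q_{m,t+1,i-1}^k,\quad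 q_{m,t+1}^k=\tfrac1{L_{g,m}}Q_{m,t+1,b_m}^k.$$ Let $\bar x_t=\frac1K\sum_kx_t^k$. **Theorem.** There is $\bar C_0>0$, depending only on $M$, the dimensions and the constants $C_f,L_f,C_{g,m},L_{g,m},\widetilde L_{g,m},\mu_{g,m},\kappa_{g,m},\Delta,D$, such that for every $0<C_0\le\bar C_0$ there is $C>0$, depending only on the same quantities and $C_0$, with the following property. For all $K$, $W$, $\rho$, and all problems and oracles as above, $F$ is differentiable, and for every $T\ge K$ the random variables $\|\nabla F(\bar x_t)\|^2$ are integrable and $$\frac1T\sum_{t=0}^{T-1}\mathbb E\|\nabla F(\bar x_t)\|^2\le\frac{C}{\sqrt{KT}}+\frac{CK}{T(1-\rho)^2}.$$ Consequently $O(1/(K\varepsilon^2))$ iterations suffice for an $\varepsilon$-stationary point when $\varepsilon$ is small, a linear speed-up in $K$: if $0<\varepsilon\le(1-\rho)^2/K^2$ and $T\ge K$, $T\ge C/(K\varepsilon^2)$, then $\frac1T\sum_{t=0}^{T-1}\mathbb E\|\nabla F(\bar x_t)\|^2\le\varepsilon$. -/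

import Mathlib

open MeasureTheory ProbabilityTheory

noncomputable section

namespace DSMO

/-- Euclidean space of dimension `n`. -/
abbrev Vec (n : ℕ) : Type := EuclideanSpace ℝ (Fin n)

/-- A minimizer of `φ` (an arbitrary point if there is none). -/
def argmin {E : Type*} [Nonempty E] (φ : E → ℝ) : E :=
  Classical.epsilon fun y => ∀ z, φ y ≤ φ z

/-- The Frobenius norm of a linear map between Euclidean spaces. -/
def frob {n p : ℕ} (A : Vec n →L[ℝ] Vec p) : ℝ :=
  Real.sqrt (∑ i : Fin n, ‖A (EuclideanSpace.single i (1 : ℝ))‖ ^ 2)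

/-- The partial gradient in the first argument. -/
def grad₁ {n p : ℕ} (φ : Vec n → Vec p → ℝ) (x : Vec n) (y : Vec p) : Vec n :=
  gradient (fun x' => φ x' y) x

/-- The partial gradient in the second argument. -/
def grad₂ {n p : ℕ} (φ : Vec n → Vec p → ℝ) (x : Vec n) (y : Vec p) : Vec p :=
  gradient (fun y' => φ x y') y

/-- The `n × p` matrix of mixed second derivatives `∂²φ / ∂x_a ∂y_b`, as a linear map from the
`y`-space to the `x`-space: the transposed Jacobian in `x` of the partial gradient in `y`. -/
def hess₁₂ {n p : ℕ} (φ : Vec n → Vec p → ℝ) (x : Vec n) (y : Vec p) : Vec p →L[ℝ] Vec n :=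
  ContinuousLinearMap.adjoint (fderiv ℝ (fun x' => grad₂ φ x' y) x)

/-- The `p × p` Hessian in the second argument. -/
def hess₂₂ {n p : ℕ} (φ : Vec n → Vec p → ℝ) (x : Vec n) (y : Vec p) : Vec p →L[ℝ] Vec p :=
  fderiv ℝ (fun y' => grad₂ φ x y') y

/-! ### The multi-level problem -/

/-- The data of a decentralized problem with `K` agents and `M` inner levels. The decision variable
`x = y_0` lives in dimension `d 0`, and `y_m` in dimension `d m` for `m = 1, …, M`. The index
`m : Fin M` stands for the inner level `m + 1`, whose functions take `y_m` (dimension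
`d m.castSucc`) and `y_{m+1}` (dimension `d m.succ`). -/
structure Problem (M K : ℕ) (d : Fin (M + 1) → ℕ) where
  /-- outer objective of each agent -/
  f : Fin K → Vec (d 0) → Vec (d (Fin.last M)) → ℝ
  /-- inner objectives of each agent -/
  g : Fin K → (m : Fin M) → Vec (d m.castSucc) → Vec (d m.succ) → ℝ

namespace Problem

variable {M K : ℕ} {d : Fin (M + 1) → ℕ} (p : Problem M K d)

/-- The outer objective averaged over the agents. -/
def fAvg (x : Vec (d 0)) (y : Vec (d (Fin.last M))) : ℝ :=
  (K : ℝ)⁻¹ * ∑ k, p.f k x y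

/-- An inner objective averaged over the agents. -/
def gAvg (m : Fin M) (a : Vec (d m.castSucc)) (y : Vec (d m.succ)) : ℝ :=
  (K : ℝ)⁻¹ * ∑ k, p.g k m a y

/-- The best responses: `y_0⋆ (x) = x` and `y_{m+1}⋆ (x) = argmin_y g_{m+1} (y_m⋆ (x), y)`. -/
def best (i : Fin (M + 1)) (x : Vec (d 0)) : Vec (d i) :=
  Fin.induction (motive := fun i => Vec (d i)) x (fun m a => argmin (p.gAvg m a)) i

/-- The overall objective `F (x) = (1/K) ∑ₖ fᵏ (x, y_M⋆ (x))`. -/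
def F (x : Vec (d 0)) : ℝ := p.fAvg x (p.best (Fin.last M) x)

end Problem

/-! ### Sampling oracle and gossip matrix -/

/-- A stochastic first- and second-order oracle: laws of the samples of each agent, and sampled
derivatives as functions of the query point and of the sample. -/
structure Oracle (M K : ℕ) (d : Fin (M + 1) → ℕ) (S : Type*) [MeasurableSpace S] where
  /-- law of the outer sample `ζᵏ` -/
  lawF : Fin K → Measure S
  /-- law of the inner sample `ξᵏ_m` -/
  lawG : Fin K → Fin M → Measure S
  /-- sampled `∇₁ fᵏ (x, y; ζ)` -/
  f₁ : Fin K → Vec (d 0) → Vec (d (Fin.last M)) → S → Vec (d 0)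
  /-- sampled `∇₂ fᵏ (x, y; ζ)` -/
  f₂ : Fin K → Vec (d 0) → Vec (d (Fin.last M)) → S → Vec (d (Fin.last M))
  /-- sampled `∇₂ gᵏ_m (a, y; ξ)` -/
  g₂ : Fin K → (m : Fin M) → Vec (d m.castSucc) → Vec (d m.succ) → S → Vec (d m.succ)
  /-- sampled `∇²₁₂ gᵏ_m (a, y; ξ)` -/
  g₁₂ : Fin K → (m : Fin M) → Vec (d m.castSucc) → Vec (d m.succ) → S →
    (Vec (d m.succ) →L[ℝ] Vec (d m.castSucc))
  /-- sampled `∇²₂₂ gᵏ_m (a, y; ξ)` -/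
  g₂₂ : Fin K → (m : Fin M) → Vec (d m.castSucc) → Vec (d m.succ) → S →
    (Vec (d m.succ) →L[ℝ] Vec (d m.succ))

/-- The samples that an agent draws in one iteration: one outer sample, for every inner level one
sample for the gradient and the mixed second derivative, and a sequence of samples for the
Hessian (of which the algorithm uses the first `b m`). -/
inductive Query (M : ℕ) : Type
  | outer : Query M
  | inner (m : Fin M) : Query M
  | hess (m : Fin M) (i : ℕ) : Query M

/-- The law of each sample. -/
def Oracle.law {M K : ℕ} {d : Fin (M + 1) → ℕ} {S : Type*} [MeasurableSpace S]
    (O : Oracle M K d S) (k : Fin K) : Query M → Measure S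
  | Query.outer => O.lawF k
  | Query.inner m => O.lawG k m
  | Query.hess m _ => O.lawG k m

/-- The oracle is measurable, its samples have probability laws, and the sampled derivatives are
unbiased. -/
structure Oracle.Unbiased {M K : ℕ} {d : Fin (M + 1) → ℕ} {S : Type*} [MeasurableSpace S]
    (O : Oracle M K d S) (p : Problem M K d) : Prop where
  probF : ∀ k, IsProbabilityMeasure (O.lawF k)
  probG : ∀ k m, IsProbabilityMeasure (O.lawG k m)
  meas_f₁ : ∀ k, Measurable fun q : Vec (d 0) × Vec (d (Fin.last M)) × S =>
    O.f₁ k q.1 q.2.1 q.2.2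
  meas_f₂ : ∀ k, Measurable fun q : Vec (d 0) × Vec (d (Fin.last M)) × S =>
    O.f₂ k q.1 q.2.1 q.2.2
  meas_g₂ : ∀ k m, Measurable fun q : Vec (d m.castSucc) × Vec (d m.succ) × S =>
    O.g₂ k m q.1 q.2.1 q.2.2
  meas_g₁₂ : ∀ k m, Measurable fun q : Vec (d m.castSucc) × Vec (d m.succ) × S =>
    O.g₁₂ k m q.1 q.2.1 q.2.2
  meas_g₂₂ : ∀ k m, Measurable fun q : Vec (d m.castSucc) × Vec (d m.succ) × S =>
    O.g₂₂ k m q.1 q.2.1 q.2.2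
  int_f₁ : ∀ k x y, Integrable (O.f₁ k x y) (O.lawF k) ∧
    ∫ s, O.f₁ k x y s ∂(O.lawF k) = grad₁ (p.f k) x y
  int_f₂ : ∀ k x y, Integrable (O.f₂ k x y) (O.lawF k) ∧
    ∫ s, O.f₂ k x y s ∂(O.lawF k) = grad₂ (p.f k) x y
  int_g₂ : ∀ k m a y, Integrable (O.g₂ k m a y) (O.lawG k m) ∧
    ∫ s, O.g₂ k m a y s ∂(O.lawG k m) = grad₂ (p.g k m) a y
  int_g₁₂ : ∀ k m a y, Integrable (O.g₁₂ k m a y) (O.lawG k m) ∧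
    ∫ s, O.g₁₂ k m a y s ∂(O.lawG k m) = hess₁₂ (p.g k m) a y
  int_g₂₂ : ∀ k m a y, Integrable (O.g₂₂ k m a y) (O.lawG k m) ∧
    ∫ s, O.g₂₂ k m a y s ∂(O.lawG k m) = hess₂₂ (p.g k m) a y

/-- The random variables `ξ t k q` are the samples drawn by agent `k` in iteration `t`: they have
the laws prescribed by the oracle and are mutually independent. -/
structure IsSampling {M K : ℕ} {d : Fin (M + 1) → ℕ} {S Ω : Type*} [MeasurableSpace S]
    [MeasurableSpace Ω] (O : Oracle M K d S) (P : Measure Ω)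
    (ξ : ℕ → Fin K → Query M → Ω → S) : Prop where
  meas : ∀ t k q, Measurable (ξ t k q)
  law : ∀ t k q, P.map (ξ t k q) = O.law k q
  indep : iIndepFun (fun (i : ℕ × Fin K × Query M) => ξ i.1 i.2.1 i.2.2) P

/-- `W` is a symmetric doubly stochastic matrix with nonnegative entries such that the squared
spectral norm of `W - (1/K) 𝟏 𝟏ᵀ` is `ρ < 1`. -/
structure IsGossip {K : ℕ} (W : Matrix (Fin K) (Fin K) ℝ) (ρ : ℝ) : Prop where
  symm : W.IsSymm
  doublyStochastic : W ∈ doublyStochastic ℝ (Fin K)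
  gap : ‖Matrix.toEuclideanCLM (n := Fin K) (𝕜 := ℝ)
    (W - Matrix.of fun _ _ => (K : ℝ)⁻¹)‖ ^ 2 = ρ
  lt_one : ρ < 1

/-! ### Assumptions -/

/-- The constants of the problem class. -/
structure Constants (M : ℕ) where
  /-- second moment of the outer gradients -/
  Cf : ℝ
  /-- smoothness of the outer objectives -/
  Lf : ℝ
  /-- dispersion of the sampled inner gradients -/
  Cg : Fin M → ℝ
  /-- smoothness of the inner objectives -/
  Lg : Fin M → ℝ
  /-- Lipschitz constant of the second derivatives of the inner objectives -/
  Lg' : Fin M → ℝ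
  /-- strong convexity of the averaged inner objectives -/
  μ : Fin M → ℝ
  /-- contraction of the sampled Hessians -/
  κ : Fin M → ℝ
  /-- initial optimality gap -/
  Δ : ℝ
  /-- initial distance to the best responses -/
  D : ℝ

/-- The constants have the signs and sizes that their roles require. -/
structure Constants.Valid {M : ℕ} (c : Constants M) : Prop where
  Cf_pos : 0 < c.Cf
  Lf_pos : 0 < c.Lf
  Cg_pos : ∀ m, 0 < c.Cg m
  Lg_pos : ∀ m, 0 < c.Lg m
  Lg'_pos : ∀ m, 0 < c.Lg' m
  μ_pos : ∀ m, 0 < c.μ m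
  κ_pos : ∀ m, 0 < c.κ m
  κ_lt_one : ∀ m, c.κ m < 1
  κ_le : ∀ m, c.κ m ≤ c.μ m / c.Lg m
  μ_div_le : ∀ m, c.μ m / c.Lg m ≤ 1

/-- `𝔼 ‖X‖² ≤ r²`, including that the left-hand side is finite. -/
def SecondMomentLE {S E : Type*} [MeasurableSpace S] [NormedAddCommGroup E]
    (ν : Measure S) (X : S → E) (r : ℝ) : Prop :=
  MemLp X 2 ν ∧ ∫ s, ‖X s‖ ^ 2 ∂ν ≤ r ^ 2

/-- Smoothness and boundedness of the outer objectives, and existence of an optimal solution. -/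
structure OuterAssumptions {M K : ℕ} {d : Fin (M + 1) → ℕ} {S : Type*} [MeasurableSpace S]
    (c : Constants M) (p : Problem M K d) (O : Oracle M K d S) : Prop where
  exists_opt : ∃ x, ∀ x', p.F x ≤ p.F x'
  diff : ∀ k, Differentiable ℝ fun q : Vec (d 0) × Vec (d (Fin.last M)) => p.f k q.1 q.2
  lip₁ : ∀ k x x' y y',
    ‖grad₁ (p.f k) x y - grad₁ (p.f k) x' y'‖ ≤ c.Lf * (‖x - x'‖ + ‖y - y'‖)
  lip₂ : ∀ k x x' y y',
    ‖grad₂ (p.f k) x y - grad₂ (p.f k) x' y'‖ ≤ c.Lf * (‖x - x'‖ + ‖y - y'‖)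
  moment₁ : ∀ k x y, SecondMomentLE (O.lawF k) (O.f₁ k x y) c.Cf
  moment₂ : ∀ k x y, SecondMomentLE (O.lawF k) (O.f₂ k x y) c.Cf

/-- Strong convexity, smoothness and boundedness of the inner objectives. The sampled gradient
of an agent has a bounded second moment about the gradient of the averaged inner objective; this
bounds its variance and the heterogeneity of the agents. -/
structure InnerAssumptions {M K : ℕ} {d : Fin (M + 1) → ℕ} {S : Type*} [MeasurableSpace S]
    (c : Constants M) (p : Problem M K d) (O : Oracle M K d S) : Prop where
  strongConvex : ∀ m a, StrongConvexOn Set.univ (c.μ m) (p.gAvg m a)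
  contDiff : ∀ k m,
    ContDiff ℝ 2 fun q : Vec (d m.castSucc) × Vec (d m.succ) => p.g k m q.1 q.2
  lip₂ : ∀ k m a a' y y',
    ‖grad₂ (p.g k m) a y - grad₂ (p.g k m) a' y'‖ ≤ c.Lg m * (‖a - a'‖ + ‖y - y'‖)
  lip₁₂ : ∀ k m a a' y y',
    frob (hess₁₂ (p.g k m) a y - hess₁₂ (p.g k m) a' y') ≤ c.Lg' m * (‖a - a'‖ + ‖y - y'‖)
  lip₂₂ : ∀ k m a a' y y',
    frob (hess₂₂ (p.g k m) a y - hess₂₂ (p.g k m) a' y') ≤ c.Lg' m * (‖a - a'‖ + ‖y - y'‖)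
  moment₂ : ∀ k m a y,
    SecondMomentLE (O.lawG k m) (fun s => O.g₂ k m a y s - grad₂ (p.gAvg m) a y) (c.Cg m)
  moment₂₂ : ∀ k m a y, SecondMomentLE (O.lawG k m) (O.g₂₂ k m a y) (c.Lg m)
  moment₁₂ : ∀ k m a y, SecondMomentLE (O.lawG k m) (O.g₁₂ k m a y) (c.Lg m)
  contraction : ∀ k m a y, SecondMomentLE (O.lawG k m)
    (fun s => ContinuousLinearMap.id ℝ (Vec (d m.succ)) - (c.Lg m)⁻¹ • O.g₂₂ k m a y s)
    (1 - c.κ m)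

/-- The initial point `0` of the algorithm is at bounded optimality gap, and its best responses
are at bounded distance. -/
structure InitialBounds {M K : ℕ} {d : Fin (M + 1) → ℕ} (c : Constants M)
    (p : Problem M K d) : Prop where
  gap : ∀ x, p.F 0 - p.F x ≤ c.Δ
  dist : ∀ i, ‖p.best i 0‖ ≤ c.D

/-! ### The algorithm -/

/-- The variables of one agent: `pt 0 = x` and `pt m = y_m` for `m = 1, …, M`, the estimators
`s`, `h` of the two partial gradients of `f`, and, for every inner level, the estimator `u` of the
mixed second derivative, the estimators `v m i` of the Hessian, and the estimator `q` of its
inverse. -/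
structure AgentState (M : ℕ) (d : Fin (M + 1) → ℕ) where
  pt : (i : Fin (M + 1)) → Vec (d i)
  s : Vec (d 0)
  h : Vec (d (Fin.last M))
  u : (m : Fin M) → (Vec (d m.succ) →L[ℝ] Vec (d m.castSucc))
  v : (m : Fin M) → ℕ → (Vec (d m.succ) →L[ℝ] Vec (d m.succ))
  q : (m : Fin M) → (Vec (d m.succ) →L[ℝ] Vec (d m.succ))

/-- The parameters of the algorithm: step sizes, numbers of Hessian samples, and the smoothness and
strong convexity constants of the inner levels. -/
structure Params (M : ℕ) where
  α : ℝ
  β : ℝ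
  γ : ℝ
  b : Fin M → ℕ
  L : Fin M → ℝ
  μ : Fin M → ℝ

/-- The initial variables of an agent. -/
def initState {M : ℕ} (d : Fin (M + 1) → ℕ) (θ : Params M) : AgentState M d where
  pt := fun _ => 0
  s := 0
  h := 0
  u := fun _ => 0
  v := fun m _ => θ.μ m • ContinuousLinearMap.id ℝ (Vec (d m.succ))
  q := fun _ => 0

/-- `u₁ q₁ u₂ q₂ ⋯ u_M q_M h`. -/
def AgentState.chain {M : ℕ} {d : Fin (M + 1) → ℕ} (a : AgentState M d) : Vec (d 0) :=
  Fin.reverseInduction (motive := fun i => Vec (d i)) a.h (fun m w => a.u m (a.q m w)) 0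

/-- The recursion `Q 0 = I`, `Q (i + 1) = I + (I - (1/L) v i) Q i` (the estimators `v` are numbered
from `0`). -/
def neumann {n : ℕ} (L : ℝ) (v : ℕ → (Vec n →L[ℝ] Vec n)) : ℕ → (Vec n →L[ℝ] Vec n)
  | 0 => ContinuousLinearMap.id ℝ (Vec n)
  | i + 1 => ContinuousLinearMap.id ℝ (Vec n) +
      (ContinuousLinearMap.id ℝ (Vec n) - L⁻¹ • v i).comp (neumann L v i)

/-- One iteration of the algorithm for all agents, with the samples `σ`. -/
def step {M K : ℕ} {d : Fin (M + 1) → ℕ} {S : Type*} [MeasurableSpace S]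
    (θ : Params M) (W : Matrix (Fin K) (Fin K) ℝ) (O : Oracle M K d S)
    (σ : Fin K → Query M → S) (a : Fin K → AgentState M d) (k : Fin K) : AgentState M d :=
  let v : (m : Fin M) → ℕ → (Vec (d m.succ) →L[ℝ] Vec (d m.succ)) := fun m i =>
    (1 - θ.β) • ∑ j, W k j • (a j).v m i +
      θ.β • O.g₂₂ k m ((a k).pt m.castSucc) ((a k).pt m.succ) (σ k (Query.hess m i))
  { pt := Fin.cases
      (∑ j, W k j • (a j).pt 0 - θ.α • ((a k).s + (-1 : ℝ) ^ M • (a k).chain))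
      (fun m => ∑ j, W k j • (a j).pt m.succ -
        θ.γ • O.g₂ k m ((a k).pt m.castSucc) ((a k).pt m.succ) (σ k (Query.inner m)))
    s := (1 - θ.β) • ∑ j, W k j • (a j).s +
      θ.β • O.f₁ k ((a k).pt 0) ((a k).pt (Fin.last M)) (σ k Query.outer)
    h := (1 - θ.β) • ∑ j, W k j • (a j).h +
      θ.β • O.f₂ k ((a k).pt 0) ((a k).pt (Fin.last M)) (σ k Query.outer)
    u := fun m => (1 - θ.β) • ∑ j, W k j • (a j).u m +
      θ.β • O.g₁₂ k m ((a k).pt m.castSucc) ((a k).pt m.succ) (σ k (Query.inner m))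
    v := v
    q := fun m => (θ.L m)⁻¹ • neumann (θ.L m) (v m) (θ.b m) }

/-- The variables of all agents after `t` iterations, with the samples `σ`. -/
def run {M K : ℕ} {d : Fin (M + 1) → ℕ} {S : Type*} [MeasurableSpace S]
    (θ : Params M) (W : Matrix (Fin K) (Fin K) ℝ) (O : Oracle M K d S)
    (σ : ℕ → Fin K → Query M → S) : ℕ → Fin K → AgentState M d
  | 0 => fun _ => initState d θ
  | t + 1 => step θ W O (σ t) (run θ W O σ t)

/-- The averaged iterate `x̄_t = (1/K) ∑ₖ xᵏ_t`. -/
def xBar {M K : ℕ} {d : Fin (M + 1) → ℕ} {S : Type*} [MeasurableSpace S]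
    (θ : Params M) (W : Matrix (Fin K) (Fin K) ℝ) (O : Oracle M K d S)
    (σ : ℕ → Fin K → Query M → S) (t : ℕ) : Vec (d 0) :=
  (K : ℝ)⁻¹ • ∑ k, (run θ W O σ t k).pt 0

/-- `‖∇F (x̄_t)‖²` as a random variable, when the algorithm is run with the random samples `ξ`. -/
def sqGrad {M K : ℕ} {d : Fin (M + 1) → ℕ} {S Ω : Type*} [MeasurableSpace S]
    (θ : Params M) (W : Matrix (Fin K) (Fin K) ℝ) (p : Problem M K d) (O : Oracle M K d S)
    (ξ : ℕ → Fin K → Query M → Ω → S) (t : ℕ) (ω : Ω) : ℝ :=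
  ‖gradient p.F (xBar θ W O (fun r k q => ξ r k q ω) t)‖ ^ 2

/-- `(1/T) ∑_{t < T} 𝔼 ‖∇F (x̄_t)‖²`. -/
def avgSqGrad {M K : ℕ} {d : Fin (M + 1) → ℕ} {S Ω : Type*} [MeasurableSpace S]
    [MeasurableSpace Ω] (θ : Params M) (W : Matrix (Fin K) (Fin K) ℝ) (p : Problem M K d)
    (O : Oracle M K d S) (P : Measure Ω) (ξ : ℕ → Fin K → Query M → Ω → S) (T : ℕ) : ℝ :=
  (1 / (T : ℝ)) * ∑ t ∈ Finset.range T, ∫ ω, sqGrad θ W p O ξ t ω ∂P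

/-- The parameters `α = C₀ √(K/T)`, `β = γ = √(K/T)` and `b_m = 3 ⌈log T⌉`, the logarithm being to
the base `1 / (1 - κ_m)`. -/
def params {M : ℕ} (c : Constants M) (C₀ : ℝ) (K T : ℕ) : Params M where
  α := C₀ * Real.sqrt ((K : ℝ) / T)
  β := Real.sqrt ((K : ℝ) / T)
  γ := Real.sqrt ((K : ℝ) / T)
  b := fun m => 3 * ⌈Real.logb (1 / (1 - c.κ m)) (T : ℝ)⌉₊
  L := c.Lg
  μ := c.μ

end DSMO

end

/-! Write `z_t` for the average over the agents of their search directions `s + (-1)^M u₁q₁⋯u_Mq_M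
h`. Gossip preserves averages, so `x̄` moves by `-α z_t`. The gradient of `F` is `f₁ + (-1)^M
U₁H₁⁻¹⋯U_MH_M⁻¹ f₂`, taken along the best responses (`Problem.Regular.gradient_F`), and it is
bounded and Lipschitz (`exists_gradient_bound`). The descent inequality telescopes to `∑‖∇F‖² +
½∑‖z‖² ≤ 2Λ/α + ∑‖∇F - z‖²`, where `Λ` bounds the initial gap. The proof consists in bounding the
mean of the last sum by a constant times `errorScale`, that is `1/β + Tβ/K + T(β/(1-ρ))² + (α/β)² ∑
𝔼‖z‖²` (`exists_sum_gradient_error`). For small `C₀ = α/β` the last term is absorbed on the left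
(`exists_sum_gradient_le`); with `β = √(K/T)` the other three, divided by `T`, give the rate.

The estimators are linear in their samples, so each is a smooth part, fed with exact derivatives,
plus accumulated noise. This splits `∇F - z` into noise and bias.

Noise. The evaluation points depend on all past samples, so the noises of different estimators are
not independent. In every iteration, however, they use distinct fresh samples of mean zero;
integrating these out one after another shows that the mean of a product of squared noises is at
most the product of the individual bounds (`IsNoise.lintegral_prod_le`). For one agent the bound is
of order `β/K + β²/(1-ρ)`: the component of a weight vector along the constants benefits from
averaging over `K` agents, and the rest is contracted by gossip (`IsGossip.noise_weight`). The term
`β/K` is the source of the linear speed-up. The predicate `Dom` carries such product bounds through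
the Neumann series and along the chain, because a partial product never contains the sample that
multiplies it next. The contraction `1 - κ` compensates the operator noise, so the bounds do not
grow with the length of the series (`Dom.neumann`, `Dom.chainAt`).

Bias. The smooth parts are deterministically bounded, and the chain built from them differs from the
exact one by at most a constant times their errors plus the truncation error
(`exists_chainAt_sub_adj`). Being averages with exponential forgetting, they follow the derivatives
at the best responses up to dispersion, the errors of the points, and the drift of `x̄`
(`exists_sum_bias_le`).

Points. Gossip contracts the dispersion of the agents. The averaged point of a level makes noisy
contracting gradient steps towards a slowly moving best response, and averaging reduces the variance
of its noise to `γ²/K` (`Setup.meanLE_trackingError_succ`). The two recursions are coupled within a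
level and driven by the level below, so they are summed and solved by induction on the level
(`exists_sum_level_errors`).

All this needs `β/(1-ρ)` to be small. Otherwise `K/(T(1-ρ)²)` is bounded below, and boundedness of
`∇F` already gives the claim (`exists_avgSqGrad_le`). -/

noncomputable section

namespace DSMO

/-! ### Fresh samples -/

section Fresh

variable {Ω S 𝒳 : Type*} {𝒢 : MeasurableSpace Ω} [mΩ : MeasurableSpace Ω] [MeasurableSpace S]
  [MeasurableSpace 𝒳] {P : Measure Ω} [IsProbabilityMeasure P]

/-- Integrating out a sample that is independent of the past `𝒢`. -/
theorem lintegral_fresh (h𝒢 : 𝒢 ≤ mΩ) {ζ : Ω → S} (hζ : Measurable ζ)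
    (hind : Indep 𝒢 (MeasurableSpace.comap ζ inferInstance) P)
    {Z : Ω → ENNReal} (hZ : Measurable[𝒢] Z) {X : Ω → 𝒳} (hX : Measurable[𝒢] X)
    {φ : 𝒳 × S → ENNReal} (hφ : Measurable φ) :
    ∫⁻ ω, Z ω * φ (X ω, ζ ω) ∂P = ∫⁻ ω, Z ω * ∫⁻ s, φ (X ω, s) ∂(P.map ζ) ∂P := by
  have hZ' : Measurable Z := hZ.mono h𝒢 le_rfl
  have hX' : Measurable X := hX.mono h𝒢 le_rfl
  have hpair : Measurable[𝒢] fun ω => (Z ω, X ω) := Measurable.prodMk hZ hX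
  have hpair' : Measurable fun ω => (Z ω, X ω) := hZ'.prodMk hX'
  have hI : IndepFun (fun ω => (Z ω, X ω)) ζ P := by
    rw [IndepFun_iff_Indep]
    exact indep_of_indep_of_le_left hind hpair.comap_le
  have hmap := (indepFun_iff_map_prod_eq_prod_map_map hpair'.aemeasurable hζ.aemeasurable).1 hI
  have : IsProbabilityMeasure (P.map ζ) := Measure.isProbabilityMeasure_map hζ.aemeasurable
  have hm : Measurable fun q : (ENNReal × 𝒳) × S => q.1.1 * φ (q.1.2, q.2) := by fun_prop
  calc ∫⁻ ω, Z ω * φ (X ω, ζ ω) ∂P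
      = ∫⁻ q, q.1.1 * φ (q.1.2, q.2) ∂(P.map fun ω => ((Z ω, X ω), ζ ω)) := by
        rw [lintegral_map hm (hpair'.prodMk hζ)]
    _ = ∫⁻ a, ∫⁻ s, a.1 * φ (a.2, s) ∂(P.map ζ) ∂(P.map fun ω => (Z ω, X ω)) := by
        rw [hmap, lintegral_prod _ hm.aemeasurable]
    _ = ∫⁻ ω, ∫⁻ s, Z ω * φ (X ω, s) ∂(P.map ζ) ∂P := by
        rw [lintegral_map _ hpair']
        exact Measurable.lintegral_prod_right' hm
    _ = _ := by
        refine lintegral_congr fun ω => ?_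
        rw [lintegral_const_mul]
        fun_prop

variable {H : Type*} [NormedAddCommGroup H] [InnerProductSpace ℝ H] [CompleteSpace H]

/-- The cross term `2c⟨b, f⟩` has mean zero. -/
theorem integral_sq_add_le {ν : Measure S} [IsProbabilityMeasure ν] {f : S → H} {σ : ℝ}
    (hf : MemLp f 2 ν) (h0 : ∫ s, f s ∂ν = 0) (h2 : ∫ s, ‖f s‖ ^ 2 ∂ν ≤ σ ^ 2) (b : H) (c : ℝ) :
    Integrable (fun s => ‖b + c • f s‖ ^ 2) ν ∧
      ∫ s, ‖b + c • f s‖ ^ 2 ∂ν ≤ ‖b‖ ^ 2 + c ^ 2 * σ ^ 2 := by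
  have hi : Integrable f ν := hf.integrable (by norm_num)
  have hsq : Integrable (fun s => ‖f s‖ ^ 2) ν := hf.integrable_norm_pow (by norm_num)
  have hexp : ∀ s, ‖b + c • f s‖ ^ 2
      = ‖b‖ ^ 2 + 2 * c * inner ℝ b (f s) + c ^ 2 * ‖f s‖ ^ 2 := by
    intro s
    rw [norm_add_sq_real, inner_smul_right, norm_smul, mul_pow, Real.norm_eq_abs, sq_abs]
    ring
  have hin : Integrable (fun s => inner ℝ b (f s)) ν := hi.const_inner b
  have h1 : Integrable (fun s => ‖b‖ ^ 2 + 2 * c * inner ℝ b (f s)) ν :=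
    (integrable_const _).add (hin.const_mul _)
  simp_rw [hexp]
  refine ⟨h1.add (hsq.const_mul _), ?_⟩
  rw [integral_add h1 (hsq.const_mul _), integral_add (integrable_const _) (hin.const_mul _),
    integral_const_mul, integral_const_mul, integral_inner hi, h0]
  simp only [inner_zero_right, mul_zero, add_zero, integral_const, probReal_univ, smul_eq_mul,
    one_mul]
  gcongr

variable [MeasurableSpace H] [BorelSpace H] [SecondCountableTopology H]

/-- Given the past, only the new sample is random, and the pointwise bound applies. The weight `Z`
is there to carry the factors of other estimators, and `a` collects the variances that have already
been integrated out. -/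
theorem lintegral_sq_add_fresh_le (h𝒢 : 𝒢 ≤ mΩ) {ζ : Ω → S}
    (hζ : Measurable ζ) (hind : Indep 𝒢 (MeasurableSpace.comap ζ inferInstance) P)
    {Z : Ω → ENNReal} (hZ : Measurable[𝒢] Z) {B : Ω → H} (hB : Measurable[𝒢] B)
    {X : Ω → 𝒳} (hX : Measurable[𝒢] X) {η : 𝒳 → S → H}
    (hη : Measurable fun q : 𝒳 × S => η q.1 q.2) {σ : ℝ} (h2 : ∀ x, MemLp (η x) 2 (P.map ζ))
    (h0 : ∀ x, ∫ s, η x s ∂(P.map ζ) = 0)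
    (hσ : ∀ x, ∫ s, ‖η x s‖ ^ 2 ∂(P.map ζ) ≤ σ ^ 2) {a : ℝ} (ha : 0 ≤ a) (c : ℝ) :
    ∫⁻ ω, Z ω * ENNReal.ofReal (a + ‖B ω + c • η (X ω) (ζ ω)‖ ^ 2) ∂P ≤
      ∫⁻ ω, Z ω * ENNReal.ofReal (a + c ^ 2 * σ ^ 2 + ‖B ω‖ ^ 2) ∂P := by
  have : IsProbabilityMeasure (P.map ζ) := Measure.isProbabilityMeasure_map hζ.aemeasurable
  have hφ : Measurable fun q : (H × 𝒳) × S =>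
      ENNReal.ofReal (a + ‖q.1.1 + c • η q.1.2 q.2‖ ^ 2) := by
    have : Measurable fun q : (H × 𝒳) × S => η q.1.2 q.2 :=
      hη.comp ((measurable_snd.comp measurable_fst).prodMk measurable_snd)
    fun_prop
  have hBX : Measurable[𝒢] fun ω => (B ω, X ω) := Measurable.prodMk hB hX
  refine (lintegral_fresh h𝒢 hζ hind hZ hBX hφ).le.trans (lintegral_mono fun ω => ?_)
  gcongr
  obtain ⟨hint, hle⟩ := integral_sq_add_le (h2 (X ω)) (h0 _) (hσ _) (B ω) c
  have hint' : Integrable (fun s => a + ‖B ω + c • η (X ω) s‖ ^ 2) (P.map ζ) :=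
    (integrable_const a).add hint
  simp only
  rw [← ofReal_integral_eq_lintegral_ofReal hint' (Filter.Eventually.of_forall fun s => by positivity)]
  apply ENNReal.ofReal_le_ofReal
  rw [integral_add (integrable_const a) hint]
  simp only [integral_const, probReal_univ, smul_eq_mul, one_mul]
  linarith

end Fresh

/-! ### Families of independent samples -/

section Family

variable {Ω S 𝒳 ι : Type*} [MeasurableSpace S]

/-- The information carried by the samples with index in `A`. -/
abbrev info (ξ : ι → Ω → S) (A : Set ι) : MeasurableSpace Ω :=
  ⨆ i ∈ A, MeasurableSpace.comap (ξ i) inferInstance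

theorem info_mono {ξ : ι → Ω → S} {A B : Set ι} (h : A ⊆ B) : info ξ A ≤ info ξ B :=
  biSup_mono h

theorem measurable_info {ξ : ι → Ω → S} {A : Set ι} {i : ι} (hi : i ∈ A) :
    Measurable[info ξ A] (ξ i) :=
  (comap_measurable (ξ i)).mono
    (le_iSup₂ (f := fun i (_ : i ∈ A) => MeasurableSpace.comap (ξ i) inferInstance) i hi) le_rfl

variable [mΩ : MeasurableSpace Ω] [MeasurableSpace 𝒳] {P : Measure Ω}

theorem info_le {ξ : ι → Ω → S} (hξ : ∀ i, Measurable (ξ i)) (A : Set ι) : info ξ A ≤ mΩ :=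
  iSup₂_le fun i _ => (hξ i).comap_le

theorem indep_info {ξ : ι → Ω → S} (hξ : ∀ i, Measurable (ξ i)) (hind : iIndepFun ξ P)
    {A : Set ι} {i : ι} (hi : i ∉ A) :
    Indep (info ξ A) (MeasurableSpace.comap (ξ i) inferInstance) P := by
  have := indep_iSup_of_disjoint (fun i => (hξ i).comap_le) ((iIndepFun_iff_iIndep _ _ _).1 hind)
    (S := A) (T := {i}) (by simpa using hi)
  simpa [info] using this

variable [IsProbabilityMeasure P]
  {H : Type*} [NormedAddCommGroup H] [InnerProductSpace ℝ H] [CompleteSpace H]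
  [MeasurableSpace H] [BorelSpace H] [SecondCountableTopology H]

/-- Integrating out independent mean-zero contributions, one for each agent. -/
theorem lintegral_sq_add_sum_fresh_le {κ : Type*} {ξ : ι → Ω → S} (hξ : ∀ i, Measurable (ξ i))
    (hind : iIndepFun ξ P) {A : Set ι} {Z : Ω → ENNReal} (hZ : Measurable[info ξ A] Z)
    {e : κ → ι} (he : Function.Injective e) {η : κ → 𝒳 → S → H}
    (hη : ∀ k, Measurable fun q : 𝒳 × S => η k q.1 q.2) {σ : ℝ}
    (h2 : ∀ k x, MemLp (η k x) 2 (P.map (ξ (e k))))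
    (h0 : ∀ k x, ∫ s, η k x s ∂(P.map (ξ (e k))) = 0)
    (hσ : ∀ k x, ∫ s, ‖η k x s‖ ^ 2 ∂(P.map (ξ (e k))) ≤ σ ^ 2)
    {X : κ → Ω → 𝒳} (hX : ∀ k, Measurable[info ξ A] (X k)) (c : κ → ℝ)
    (F : Finset κ) (hF : ∀ k ∈ F, e k ∉ A) {B : Ω → H} (hB : Measurable[info ξ A] B)
    {a : ℝ} (ha : 0 ≤ a) :
    ∫⁻ ω, Z ω * ENNReal.ofReal (a + ‖B ω + ∑ k ∈ F, c k • η k (X k ω) (ξ (e k) ω)‖ ^ 2) ∂P ≤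
      ∫⁻ ω, Z ω * ENNReal.ofReal (a + (∑ k ∈ F, c k ^ 2) * σ ^ 2 + ‖B ω‖ ^ 2) ∂P := by
  classical
  -- The constant `a` varies because each agent that is integrated out leaves `c k ^ 2 * σ ^ 2`
  -- behind. For the agent `k`, the samples of the agents in `F` count as past.
  induction F using Finset.induction_on generalizing a with
  | empty => simp
  | insert k F hk ih =>
    have hAle : info ξ A ≤ info ξ (A ∪ e '' F) := info_mono Set.subset_union_left
    have hkn : e k ∉ A ∪ e '' (F : Set κ) := by
      rintro (h | ⟨j, hj, hjk⟩)
      · exact hF k (by simp) h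
      · exact hk (by simpa [he hjk] using hj)
    have hsum : Measurable[info ξ (A ∪ e '' F)] fun ω => ∑ j ∈ F, c j • η j (X j ω) (ξ (e j) ω) := by
      refine Finset.measurable_fun_sum F fun j hj => Measurable.const_smul ?_ _
      exact (hη j).comp (((hX j).mono hAle le_rfl).prodMk
        (measurable_info (Or.inr ⟨j, hj, rfl⟩)))
    have hB' : Measurable[info ξ (A ∪ e '' F)] fun ω => B ω + ∑ j ∈ F, c j • η j (X j ω) (ξ (e j) ω) :=
      (hB.mono hAle le_rfl).add hsum
    have hstep := lintegral_sq_add_fresh_le (info_le hξ _) (hξ (e k)) (indep_info hξ hind hkn)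
      (hZ.mono hAle le_rfl) hB' ((hX k).mono hAle le_rfl) (hη k) (h2 k) (h0 k) (hσ k) ha (c k)
    have ih' := ih (a := a + c k ^ 2 * σ ^ 2) (fun j hj => hF j (by simp [hj])) (by positivity)
    simp only [Finset.sum_insert hk]
    calc _ = ∫⁻ ω, Z ω * ENNReal.ofReal (a + ‖B ω + ∑ j ∈ F, c j • η j (X j ω) (ξ (e j) ω)
            + c k • η k (X k ω) (ξ (e k) ω)‖ ^ 2) ∂P := by
          refine lintegral_congr fun ω => ?_
          congr 5
          abel
      _ ≤ _ := hstep
      _ ≤ _ := ih'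
      _ = _ := by
          refine lintegral_congr fun ω => ?_
          congr 3
          ring

end Family

end DSMO

end

noncomputable section

namespace DSMO

/-! ### Gossip averages with exponential forgetting -/

/-- The recursion `z (t + 1) k = (1 - β) ∑ⱼ W k j z t j + β (inp t k)` with `z 0 = init`. -/
def ema {K : ℕ} {E : Type*} [AddCommGroup E] [Module ℝ E] (β : ℝ) (W : Matrix (Fin K) (Fin K) ℝ)
    (init : E) (inp : ℕ → Fin K → E) : ℕ → Fin K → E
  | 0 => fun _ => init
  | t + 1 => fun k => (1 - β) • ∑ j, W k j • ema β W init inp t j + β • inp t k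

/-- The linear combination of the agents with weights `c` after one step. -/
theorem sum_smul_ema_succ {K : ℕ} {E : Type*} [AddCommGroup E] [Module ℝ E] (β : ℝ)
    (W : Matrix (Fin K) (Fin K) ℝ) (init : E) (inp : ℕ → Fin K → E) (c : Fin K → ℝ) (t : ℕ) :
    ∑ j, c j • ema β W init inp (t + 1) j =
      (1 - β) • ∑ l, (Matrix.vecMul c W) l • ema β W init inp t l
        + ∑ j, (β * c j) • inp t j := by
  simp only [ema, smul_add, Finset.sum_add_distrib, Matrix.vecMul, dotProduct, Finset.sum_smul,
    Finset.smul_sum, smul_smul]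
  congr 1
  · rw [Finset.sum_comm]
    refine Finset.sum_congr rfl fun i _ => Finset.sum_congr rfl fun j _ => ?_
    ring_nf
  · refine Finset.sum_congr rfl fun i _ => ?_
    rw [mul_comm]

/-! ### Product moments of the noise -/

section Noise

variable {K : ℕ} {Q Ω S 𝒳 : Type*} [mΩ : MeasurableSpace Ω] [MeasurableSpace S]
  [MeasurableSpace 𝒳] {P : Measure Ω} {H : Q → Type*}
  [∀ q, NormedAddCommGroup (H q)] [∀ q, InnerProductSpace ℝ (H q)]

/-- The accumulated noise of agent `k` in the estimator `q`. -/
def noise (β : ℝ) (W : Matrix (Fin K) (Fin K) ℝ) (ξ : ℕ × Fin K × Q → Ω → S)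
    (η : (q : Q) → Fin K → 𝒳 → S → H q) (X : ℕ → Fin K → Ω → 𝒳) (q : Q) (t : ℕ) (k : Fin K)
    (ω : Ω) : H q :=
  ema β W 0 (fun t k => η q k (X t k ω) (ξ (t, k, q) ω)) t k

/-- A family of mean-zero noise functions with bounded second moments, together with the points
at which they are evaluated. -/
structure IsNoise (P : Measure Ω) (ξ : ℕ × Fin K × Q → Ω → S)
    (η : (q : Q) → Fin K → 𝒳 → S → H q) (X : ℕ → Fin K → Ω → 𝒳) (σ : Q → ℝ)
    [∀ q, MeasurableSpace (H q)] : Prop where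
  meas_ξ : ∀ i, Measurable (ξ i)
  indep : iIndepFun ξ P
  meas_η : ∀ q k, Measurable fun z : 𝒳 × S => η q k z.1 z.2
  memLp : ∀ q t k x, MemLp (η q k x) 2 (P.map (ξ (t, k, q)))
  mean : ∀ q t k x, ∫ s, η q k x s ∂(P.map (ξ (t, k, q))) = 0
  moment : ∀ q t k x, ∫ s, ‖η q k x s‖ ^ 2 ∂(P.map (ξ (t, k, q))) ≤ σ q ^ 2
  meas_X : ∀ t k, Measurable[info ξ {i | i.1 < t}] (X t k)

variable [∀ q, MeasurableSpace (H q)] [∀ q, BorelSpace (H q)]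
  [∀ q, SecondCountableTopology (H q)]
  {W : Matrix (Fin K) (Fin K) ℝ} {ξ : ℕ × Fin K × Q → Ω → S}
  {η : (q : Q) → Fin K → 𝒳 → S → H q} {X : ℕ → Fin K → Ω → 𝒳} {σ : Q → ℝ}

theorem IsNoise.measurable_noise (h : IsNoise P ξ η X σ) (β : ℝ) (q : Q) (t : ℕ) (k : Fin K) :
    Measurable[info ξ {i | i.1 < t}] (noise β W ξ η X q t k) := by
  induction t generalizing k with
  | zero => exact measurable_const
  | succ t ih =>
    have hle : info ξ {i : ℕ × Fin K × Q | i.1 < t} ≤ info ξ {i | i.1 < t + 1} :=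
      info_mono fun i (hi : i.1 < t) => Nat.lt_succ_of_lt hi
    have h1 : Measurable[info ξ {i | i.1 < t + 1}]
        fun ω => (1 - β) • ∑ j, W k j • noise β W ξ η X q t j ω :=
      Measurable.const_smul (Finset.measurable_fun_sum _ fun j _ =>
        Measurable.const_smul ((ih j).mono hle le_rfl) _) _
    have h2 : Measurable[info ξ {i | i.1 < t + 1}]
        fun ω => β • η q k (X t k ω) (ξ (t, k, q) ω) :=
      Measurable.const_smul ((h.meas_η q k).comp (((h.meas_X t k).mono hle le_rfl).prodMk
        (measurable_info (show (t, k, q).1 < t + 1 from Nat.lt_succ_self t)))) _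
    exact h1.add h2

variable [∀ q, CompleteSpace (H q)] [IsProbabilityMeasure P]

/-- Given the past and the samples of the other estimators in iteration `t`, the new contribution to
one estimator is still fresh and has mean zero. The estimators in `F` can thus be integrated out one
at a time. For this the weight `Z` may depend on samples of iteration `t`, but only on those of
estimators outside `F`. -/
theorem IsNoise.lintegral_step_le (h : IsNoise P ξ η X σ) (β : ℝ) (t : ℕ) {a : Q → ℝ}
    (ha : ∀ q, 0 ≤ a q) (c : Q → Fin K → ℝ) (F : Finset Q) {Z : Ω → ENNReal}
    (hZ : Measurable[info ξ {i | i.1 < t ∨ (i.1 = t ∧ i.2.2 ∉ F)}] Z) :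
    ∫⁻ ω, Z ω * ∏ q ∈ F, ENNReal.ofReal
        (a q + ‖∑ j, c q j • noise β W ξ η X q (t + 1) j ω‖ ^ 2) ∂P ≤
      ∫⁻ ω, Z ω * ∏ q ∈ F, ENNReal.ofReal
        (a q + (∑ j, (β * c q j) ^ 2) * σ q ^ 2
          + ‖(1 - β) • ∑ l, (Matrix.vecMul (c q) W) l • noise β W ξ η X q t l ω‖ ^ 2) ∂P := by
  classical
  induction F using Finset.induction_on generalizing Z with
  | empty => simp
  | insert q F hq ih =>
    simp only [Finset.prod_insert hq, ← mul_assoc]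
    have hpast : ∀ A : Set (ℕ × Fin K × Q), {i | i.1 < t} ⊆ A → ∀ q,
        Measurable[info ξ A]
          fun ω => (1 - β) • ∑ l, (Matrix.vecMul (c q) W) l • noise β W ξ η X q t l ω :=
      fun A hA q => Measurable.const_smul (Finset.measurable_fun_sum _ fun j _ =>
        Measurable.const_smul ((h.measurable_noise β q t j).mono (info_mono hA) le_rfl) _) _
    have hnoise : ∀ A : Set (ℕ × Fin K × Q), {i | i.1 < t} ⊆ A → (∀ k, (t, k, q) ∈ A) →
        Measurable[info ξ A] fun ω => ∑ j, c q j • noise β W ξ η X q (t + 1) j ω := by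
      intro A hA hk
      simp only [noise, sum_smul_ema_succ]
      refine Measurable.add (hpast A hA q) (Finset.measurable_fun_sum _ fun j _ =>
        Measurable.const_smul ((h.meas_η q j).comp
          (((h.meas_X t j).mono (info_mono hA) le_rfl).prodMk (measurable_info (hk j)))) _)
    have hsq : Measurable fun v : H q => a q + ‖v‖ ^ 2 :=
      measurable_const.add (measurable_norm.pow_const 2)
    -- First the factor of `q` joins the weight while `F` is treated; afterwards the factors of `F`
    -- depend on the past alone and join the weight while the samples of `q` are integrated out.
    calc _ ≤ ∫⁻ ω, (Z ω * ENNReal.ofReal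
            (a q + ‖∑ j, c q j • noise β W ξ η X q (t + 1) j ω‖ ^ 2)) *
            ∏ q ∈ F, ENNReal.ofReal (a q + (∑ j, (β * c q j) ^ 2) * σ q ^ 2
              + ‖(1 - β) • ∑ l, (Matrix.vecMul (c q) W) l • noise β W ξ η X q t l ω‖ ^ 2) ∂P := by
          refine ih (Measurable.mul (hZ.mono (info_mono ?_) le_rfl) ?_)
          · rintro i (hi | ⟨h1, h2⟩)
            · exact Or.inl hi
            · exact Or.inr ⟨h1, fun hh => h2 (by simp [hh])⟩
          · have := hnoise {i | i.1 < t ∨ (i.1 = t ∧ i.2.2 ∉ F)} (fun i hi => Or.inl hi)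
              (fun k => Or.inr ⟨rfl, hq⟩)
            exact ENNReal.measurable_ofReal.comp (hsq.comp this)
      _ = ∫⁻ ω, (Z ω * ∏ q ∈ F, ENNReal.ofReal (a q + (∑ j, (β * c q j) ^ 2) * σ q ^ 2
              + ‖(1 - β) • ∑ l, (Matrix.vecMul (c q) W) l • noise β W ξ η X q t l ω‖ ^ 2)) *
            ENNReal.ofReal (a q + ‖(1 - β) • ∑ l, (Matrix.vecMul (c q) W) l •
                noise β W ξ η X q t l ω
              + ∑ j, (β * c q j) • η q j (X t j ω) (ξ (t, j, q) ω)‖ ^ 2) ∂P := by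
          refine lintegral_congr fun ω => ?_
          rw [mul_right_comm]
          simp only [noise, sum_smul_ema_succ]
      _ ≤ _ := by
          refine lintegral_sq_add_sum_fresh_le (A := {i | i.1 < t ∨ (i.1 = t ∧ i.2.2 ∉ insert q F)})
            (e := fun k => (t, k, q)) h.meas_ξ h.indep ?_ (fun i j hij => by simpa using hij)
            (fun k => h.meas_η q k) (fun k x => h.memLp q t k x) (fun k x => h.mean q t k x)
            (fun k x => h.moment q t k x)
            (fun k => (h.meas_X t k).mono (info_mono fun i hi => Or.inl hi) le_rfl) _
            Finset.univ (by simp) (hpast _ (fun i hi => Or.inl hi) q) (ha q)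
          refine hZ.mul (Finset.measurable_fun_prod _ fun q' _ => ?_)
          exact ENNReal.measurable_ofReal.comp (Measurable.comp (g := fun v : H q' => _ + ‖v‖ ^ 2)
            (measurable_const.add (measurable_norm.pow_const 2))
            (hpast _ (fun i hi => Or.inl hi) q'))
      _ = _ := by
          refine lintegral_congr fun ω => ?_
          rw [mul_right_comm]

/-- The product moments of the noises of distinct estimators are at most the products of the
bounds `σ² w` on their second moments. -/
theorem IsNoise.lintegral_prod_le (h : IsNoise P ξ η X σ) {β : ℝ} {w : (Fin K → ℝ) → ℝ}
    (hw0 : ∀ c, 0 ≤ w c)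
    (hw : ∀ c, (1 - β) ^ 2 * w (Matrix.vecMul c W) + ∑ j, (β * c j) ^ 2 ≤ w c) (t : ℕ)
    (F : Finset Q) {a : Q → ℝ} (ha : ∀ q, 0 ≤ a q) {b : Q → ℝ} (hb : ∀ q, 0 ≤ b q)
    (c : Q → Fin K → ℝ) :
    ∫⁻ ω, ∏ q ∈ F, ENNReal.ofReal (a q + b q * ‖∑ j, c q j • noise β W ξ η X q t j ω‖ ^ 2) ∂P ≤
      ∏ q ∈ F, ENNReal.ofReal (a q + b q * (σ q ^ 2 * w (c q))) := by
  induction t generalizing a b c with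
  | zero =>
    simp only [noise, ema, smul_zero, Finset.sum_const_zero, norm_zero]
    rw [lintegral_const, measure_univ, mul_one]
    refine Finset.prod_le_prod' fun q _ => ENNReal.ofReal_le_ofReal ?_
    have := mul_nonneg (hb q) (mul_nonneg (sq_nonneg (σ q)) (hw0 (c q)))
    linarith
  | succ t ih =>
    -- The factor `b q` is moved into the coefficients as its square root, so that the one-step
    -- bound applies.
    have hsq : ∀ q, Real.sqrt (b q) ^ 2 = b q := fun q => Real.sq_sqrt (hb q)
    have h1 := h.lintegral_step_le (W := W) β t ha (fun q j => Real.sqrt (b q) * c q j) F (Z := 1)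
      measurable_const
    have hvm : ∀ q, Matrix.vecMul (fun j => Real.sqrt (b q) * c q j) W
        = Real.sqrt (b q) • Matrix.vecMul (c q) W := fun q => by
      rw [← Matrix.smul_vecMul]; rfl
    simp only [Pi.one_apply, one_mul, hvm, Pi.smul_apply, smul_eq_mul, mul_smul,
      ← Finset.smul_sum, norm_smul, mul_pow, Real.norm_eq_abs, sq_abs, hsq] at h1
    refine h1.trans ?_
    -- One step backwards in time adds the fresh variance to `a`, multiplies `b` by `(1 - β)²` and
    -- replaces `c` by `c W`. The hypothesis `hw` says exactly that the bound `w` survives this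
    -- exchange.
    have h2 := ih (a := fun q => a q + (∑ j, β ^ 2 * (b q * c q j ^ 2)) * σ q ^ 2)
      (b := fun q => (1 - β) ^ 2 * b q) (fun q => by
        refine add_nonneg (ha q) (mul_nonneg (Finset.sum_nonneg fun j _ => ?_) (sq_nonneg _))
        have := hb q
        positivity)
      (fun q => mul_nonneg (sq_nonneg _) (hb q)) (fun q => Matrix.vecMul (c q) W)
    simp only [← mul_assoc] at h2 ⊢
    refine h2.trans (Finset.prod_le_prod' fun q _ => ENNReal.ofReal_le_ofReal ?_)
    have h3 := mul_le_mul_of_nonneg_left (hw (c q)) (mul_nonneg (hb q) (sq_nonneg (σ q)))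
    have h4 : (∑ j, β ^ 2 * b q * c q j ^ 2) = b q * ∑ j, (β * c q j) ^ 2 := by
      rw [Finset.mul_sum]
      exact Finset.sum_congr rfl fun j _ => by ring
    rw [h4]
    nlinarith [h3]

end Noise

end DSMO

end

noncomputable section

namespace DSMO

/-! ### Averages over the agents -/

/-- The average over the agents. -/
def avg {K : ℕ} {E : Type*} [AddCommGroup E] [Module ℝ E] (X : Fin K → E) : E :=
  (K : ℝ)⁻¹ • ∑ k, X k

section Avg

variable {K : ℕ} {E E' : Type*} [AddCommGroup E] [Module ℝ E] [AddCommGroup E'] [Module ℝ E']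

theorem avg_add (X Y : Fin K → E) : avg (fun k => X k + Y k) = avg X + avg Y := by
  simp [avg, Finset.sum_add_distrib]

theorem avg_sub (X Y : Fin K → E) : avg (fun k => X k - Y k) = avg X - avg Y := by
  simp [avg, Finset.sum_sub_distrib, smul_sub]

theorem avg_smul (c : ℝ) (X : Fin K → E) : avg (fun k => c • X k) = c • avg X := by
  simp [avg, ← Finset.smul_sum, smul_comm c]

theorem avg_mul (c : ℝ) (X : Fin K → ℝ) : avg (fun k => c * X k) = c * avg X := avg_smul c X

theorem avg_map (L : E →ₗ[ℝ] E') (X : Fin K → E) : avg (fun k => L (X k)) = L (avg X) := by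
  simp [avg]

theorem avg_const (hK : 1 ≤ K) (c : E) : avg (fun _ : Fin K => c) = c := by
  have : (K : ℝ) ≠ 0 := by positivity
  simp [avg, ← Nat.cast_smul_eq_nsmul ℝ, smul_smul, this]

theorem avg_mono {X Y : Fin K → ℝ} (h : ∀ k, X k ≤ Y k) : avg X ≤ avg Y := by
  simp only [avg, smul_eq_mul]
  exact mul_le_mul_of_nonneg_left (Finset.sum_le_sum fun k _ => h k) (by positivity)

theorem avg_nonneg {X : Fin K → ℝ} (h : ∀ k, 0 ≤ X k) : 0 ≤ avg X := by
  simp only [avg, smul_eq_mul]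
  exact mul_nonneg (by positivity) (Finset.sum_nonneg fun k _ => h k)

theorem avg_le_of_le (hK : 1 ≤ K) {X : Fin K → ℝ} {c : ℝ} (h : ∀ k, X k ≤ c) : avg X ≤ c :=
  (avg_mono h).trans (avg_const hK c).le

theorem norm_avg_le {E : Type*} [NormedAddCommGroup E] [NormedSpace ℝ E] (X : Fin K → E) :
    ‖avg X‖ ≤ avg fun k => ‖X k‖ := by
  simp only [avg, norm_smul, norm_inv, RCLike.norm_natCast, smul_eq_mul]
  gcongr
  exact norm_sum_le _ _

theorem avg_sq_le (X : Fin K → ℝ) : avg X ^ 2 ≤ avg fun k => X k ^ 2 := by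
  rcases Nat.eq_zero_or_pos K with rfl | hK
  · simp [avg]
  have h := sq_sum_le_card_mul_sum_sq (s := Finset.univ) (f := X)
  have hK' : (0 : ℝ) < K := by exact_mod_cast hK
  simp only [avg, smul_eq_mul, Finset.card_univ, Fintype.card_fin] at h ⊢
  rw [mul_pow, inv_mul_eq_div, inv_pow, inv_mul_eq_div, div_le_div_iff₀ (by positivity) hK']
  nlinarith

theorem norm_avg_sq_le {E : Type*} [NormedAddCommGroup E] [NormedSpace ℝ E] (X : Fin K → E) :
    ‖avg X‖ ^ 2 ≤ avg fun k => ‖X k‖ ^ 2 :=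
  (pow_le_pow_left₀ (norm_nonneg _) (norm_avg_le X) 2).trans (avg_sq_le _)

theorem avg_norm_sub_avg_sq {E : Type*} [NormedAddCommGroup E] [InnerProductSpace ℝ E]
    (X : Fin K → E) :
    avg (fun k => ‖X k - avg X‖ ^ 2) = avg (fun k => ‖X k‖ ^ 2) - ‖avg X‖ ^ 2 := by
  rcases Nat.eq_zero_or_pos K with rfl | hK
  · simp [avg]
  have h1 : ∀ k, ‖X k - avg X‖ ^ 2
      = ‖X k‖ ^ 2 - 2 * (innerₗ E (avg X)) (X k) + ‖avg X‖ ^ 2 := by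
    intro k
    rw [norm_sub_sq_real, innerₗ_apply_apply, real_inner_comm]
  have h2 := avg_map (innerₗ E (avg X)) X
  simp only [h1, avg_add, avg_sub, avg_const hK, avg_mul, h2]
  rw [innerₗ_apply_apply, real_inner_self_eq_norm_sq]
  ring

/-- The mean squared distance of the agents from their average. -/
def disp {E : Type*} [NormedAddCommGroup E] [NormedSpace ℝ E] (X : Fin K → E) : ℝ :=
  avg fun k => ‖X k - avg X‖ ^ 2

theorem disp_nonneg {E : Type*} [NormedAddCommGroup E] [NormedSpace ℝ E] (X : Fin K → E) :
    0 ≤ disp X := avg_nonneg fun _ => by positivity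

theorem disp_le {E : Type*} [NormedAddCommGroup E] [InnerProductSpace ℝ E] (X : Fin K → E) :
    disp X ≤ avg fun k => ‖X k‖ ^ 2 := by
  rw [disp, avg_norm_sub_avg_sq]
  linarith [sq_nonneg ‖avg X‖]

end Avg

/-! ### Gossip matrices -/

section Gossip

variable {K : ℕ} {W : Matrix (Fin K) (Fin K) ℝ} {ρ : ℝ}

namespace IsGossip


theorem nonneg (hW : IsGossip W ρ) (i j : Fin K) : 0 ≤ W i j := (mem_doublyStochastic_iff_sum.1 hW.doublyStochastic).1 i j

theorem row_sum (hW : IsGossip W ρ) (i : Fin K) : ∑ j, W i j = 1 :=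
  (mem_doublyStochastic_iff_sum.1 hW.doublyStochastic).2.1 i

theorem col_sum (hW : IsGossip W ρ) (j : Fin K) : ∑ i, W i j = 1 :=
  (mem_doublyStochastic_iff_sum.1 hW.doublyStochastic).2.2 j

theorem rho_nonneg (hW : IsGossip W ρ) : 0 ≤ ρ := hW.gap ▸ sq_nonneg _

theorem one_sub_pos (hW : IsGossip W ρ) : 0 < 1 - ρ := sub_pos.2 hW.lt_one

theorem avg_mix (hW : IsGossip W ρ) {E : Type*} [AddCommGroup E] [Module ℝ E] (X : Fin K → E) :
    avg (fun k => ∑ j, W k j • X j) = avg X := by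
  simp only [avg]
  rw [Finset.sum_comm]
  simp_rw [← Finset.sum_smul, hW.col_sum, one_smul]

theorem sum_mulVec_sub_sq_le (hW : IsGossip W ρ) (x : Fin K → ℝ) :
    ∑ k, (∑ j, W k j * x j - avg x) ^ 2 ≤ ρ * ∑ j, x j ^ 2 := by
  have h := (Matrix.toEuclideanCLM (n := Fin K) (𝕜 := ℝ)
    (W - Matrix.of fun _ _ => (K : ℝ)⁻¹)).le_opNorm (WithLp.toLp 2 x)
  have h2 := pow_le_pow_left₀ (norm_nonneg _) h 2
  rw [mul_pow, hW.gap, EuclideanSpace.norm_sq_eq, EuclideanSpace.norm_sq_eq] at h2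
  simpa [Matrix.mulVec, dotProduct, sub_mul, Finset.sum_sub_distrib, avg, Finset.mul_sum,
    Matrix.toEuclideanCLM_toLp] using h2

/-- Centring `x` changes both sides in a controlled way, since the rows of `W` sum to one. -/
theorem sum_mulVec_sub_sq_le' (hW : IsGossip W ρ) (x : Fin K → ℝ) :
    ∑ k, (∑ j, W k j * x j - avg x) ^ 2 ≤ ρ * ∑ j, (x j - avg x) ^ 2 := by
  rcases Nat.eq_zero_or_pos K with rfl | hK
  · simp
  have h := hW.sum_mulVec_sub_sq_le fun j => x j - avg x
  have h0 : avg (fun j => x j - avg x) = 0 := by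
    rw [avg_sub, avg_const hK, sub_self]
  simp only [h0, mul_sub, Finset.sum_sub_distrib, ← Finset.sum_mul, hW.row_sum, one_mul,
    sub_zero] at h
  exact h

/-- The scalar contraction is applied in each coordinate, which ties the statement to Euclidean
norms. Operator-valued estimators are later moved to a Euclidean space for this reason. -/
theorem disp_mix_le (hW : IsGossip W ρ) {ι : Type*} [Fintype ι] (X : Fin K → EuclideanSpace ℝ ι) :
    disp (fun k => ∑ j, W k j • X j) ≤ ρ * disp X := by
  have key : ∑ k, ‖∑ j, W k j • X j - avg X‖ ^ 2 ≤ ρ * ∑ k, ‖X k - avg X‖ ^ 2 := by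
    simp only [EuclideanSpace.norm_sq_eq, Real.norm_eq_abs, sq_abs]
    rw [Finset.sum_comm, Finset.sum_comm (f := fun k i => ((X k - avg X).ofLp i) ^ 2),
      Finset.mul_sum]
    refine Finset.sum_le_sum fun i _ => ?_
    have := hW.sum_mulVec_sub_sq_le' fun j => X j i
    simpa [avg] using this
  have h1 : avg (fun k => ∑ j, W k j • X j) = avg X := hW.avg_mix X
  have h2 := mul_le_mul_of_nonneg_left key (inv_nonneg.2 (Nat.cast_nonneg (α := ℝ) K))
  simp only [disp, h1]
  simp only [avg, smul_eq_mul] at h2 ⊢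
  linarith

/-- One gossip step with damping `l` and new contributions `b`. -/
theorem disp_step_le (hW : IsGossip W ρ) {ι : Type*} [Fintype ι] (X b : Fin K → EuclideanSpace ℝ ι) {l : ℝ}
    (hl0 : 0 ≤ l) (hl1 : l ≤ 1) :
    disp (fun k => l • ∑ j, W k j • X j + b k) ≤
      (1 - (1 - ρ) / 2) * disp X + (2 / (1 - ρ)) * avg fun k => ‖b k‖ ^ 2 := by
  have hρ := hW.rho_nonneg
  have hρ1 := hW.one_sub_pos
  set Y : Fin K → EuclideanSpace ℝ ι := fun k => ∑ j, W k j • X j with hY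
  -- Convexity of the square with weights `(1 + ρ)/2` and `(1 - ρ)/2`. After the contraction by `ρ`
  -- the first coefficient is `2ρ/(1 + ρ)`, which is at most `(1 + ρ)/2`.
  have key : ∀ u v : EuclideanSpace ℝ ι,
      ‖l • u + v‖ ^ 2 ≤ (2 / (1 + ρ)) * ‖u‖ ^ 2 + (2 / (1 - ρ)) * ‖v‖ ^ 2 := by
    intro u v
    have h1 : ‖l • u + v‖ ≤ ‖u‖ + ‖v‖ := by
      refine (norm_add_le _ _).trans ?_
      rw [norm_smul, Real.norm_eq_abs, abs_of_nonneg hl0]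
      nlinarith [norm_nonneg u]
    refine (pow_le_pow_left₀ (norm_nonneg _) h1 2).trans ?_
    rw [div_mul_eq_mul_div, div_mul_eq_mul_div, div_add_div _ _ (by positivity) (by positivity),
      le_div_iff₀ (by positivity)]
    nlinarith [sq_nonneg ((1 - ρ) * ‖u‖ - (1 + ρ) * ‖v‖)]
  calc disp (fun k => l • Y k + b k)
      = avg fun k => ‖l • (Y k - avg Y) + (b k - avg b)‖ ^ 2 := by
        simp only [disp, avg_add, avg_smul]
        congr 1
        ext k
        congr 2
        simp only [smul_sub]
        abel
    _ ≤ avg fun k => (2 / (1 + ρ)) * ‖Y k - avg Y‖ ^ 2 + (2 / (1 - ρ)) * ‖b k - avg b‖ ^ 2 :=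
        avg_mono fun k => key _ _
    _ = (2 / (1 + ρ)) * disp Y + (2 / (1 - ρ)) * disp b := by
        simp only [avg_add, avg_mul, disp]
    _ ≤ (2 / (1 + ρ)) * (ρ * disp X) + (2 / (1 - ρ)) * avg fun k => ‖b k‖ ^ 2 := by
        gcongr
        · exact hW.disp_mix_le X
        · exact disp_le b
    _ ≤ _ := by
        have : (2 / (1 + ρ)) * ρ ≤ 1 - (1 - ρ) / 2 := by
          rw [div_mul_eq_mul_div, div_le_iff₀ (by positivity)]
          nlinarith [sq_nonneg (1 - ρ)]
        have := mul_le_mul_of_nonneg_right this (disp_nonneg X)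
        linarith

/-- The weight that governs the second moment of linear combinations of the noise. -/
theorem noise_weight (hW : IsGossip W ρ) {β : ℝ} (hβ0 : 0 ≤ β) (hβ1 : β ≤ 1) (hK : 1 ≤ K) (c : Fin K → ℝ) :
    (1 - β) ^ 2 * ((∑ j, Matrix.vecMul c W j) ^ 2 * (β / K)
        + (∑ j, (Matrix.vecMul c W j - avg (Matrix.vecMul c W)) ^ 2) * (β ^ 2 / (1 - ρ)))
      + ∑ j, (β * c j) ^ 2 ≤
    (∑ j, c j) ^ 2 * (β / K) + (∑ j, (c j - avg c) ^ 2) * (β ^ 2 / (1 - ρ)) := by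
  have hρ := hW.rho_nonneg
  have hρ1 := hW.one_sub_pos
  have hK' : (0 : ℝ) < K := by exact_mod_cast hK
  have hv : Matrix.vecMul c W = fun k => ∑ j, W k j * c j := by
    ext k
    simp only [Matrix.vecMul, dotProduct]
    refine Finset.sum_congr rfl fun j _ => ?_
    rw [mul_comm, hW.symm.apply]
  have ha : avg (Matrix.vecMul c W) = avg c := by
    rw [hv]; exact hW.avg_mix c
  have hs : ∑ j, Matrix.vecMul c W j = ∑ j, c j := by
    have := congrArg (fun z => (K : ℝ) * z) ha
    simpa [avg, hK'.ne'] using this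
  have hd : ∑ j, (Matrix.vecMul c W j - avg (Matrix.vecMul c W)) ^ 2
      ≤ ρ * ∑ j, (c j - avg c) ^ 2 := by
    rw [ha, hv]; exact hW.sum_mulVec_sub_sq_le' c
  -- The fresh variance is split orthogonally. Along the constants, forgetting makes room for it
  -- because `(1 - β)² + β ≤ 1`; on the complement, gossip does, because `ρ/(1 - ρ) + 1 = 1/(1 -
  -- ρ)`.
  have hc : ∑ j, (β * c j) ^ 2 = β ^ 2 * ((∑ j, c j) ^ 2 / K + ∑ j, (c j - avg c) ^ 2) := by
    have h := avg_norm_sub_avg_sq c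
    simp only [Real.norm_eq_abs, sq_abs] at h
    have h2 : (∑ j, (c j - avg c) ^ 2) = (∑ j, c j ^ 2) - (∑ j, c j) ^ 2 / K := by
      have := congrArg (fun z => (K : ℝ) * z) h
      simp only [avg, smul_eq_mul] at this ⊢
      field_simp at this ⊢
      linarith
    simp_rw [h2, mul_pow, ← Finset.mul_sum]
    ring
  rw [hs, hc]
  set s := (∑ j, c j) ^ 2
  set e := ∑ j, (c j - avg c) ^ 2
  have hs0 : 0 ≤ s := sq_nonneg _
  have he0 : 0 ≤ e := Finset.sum_nonneg fun j _ => sq_nonneg _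
  have h1 : (1 - β) ^ 2 ≤ 1 := by nlinarith
  have e1 : (1 - β) ^ 2 * (s * (β / K)) + β ^ 2 * (s / K) ≤ s * (β / K) := by
    have : (1 - β) ^ 2 * (s * (β / K)) + β ^ 2 * (s / K) = ((1 - β) ^ 2 + β) * (s * (β / K)) := by
      ring
    rw [this]
    have h0 : 0 ≤ s * (β / K) := by positivity
    have h2 : (1 - β) ^ 2 + β ≤ 1 := by nlinarith
    exact (mul_le_mul_of_nonneg_right h2 h0).trans (one_mul _).le
  have e2 : (1 - β) ^ 2 * ((∑ j, (Matrix.vecMul c W j - avg (Matrix.vecMul c W)) ^ 2)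
      * (β ^ 2 / (1 - ρ))) ≤ ρ * e * (β ^ 2 / (1 - ρ)) := by
    have h0 : 0 ≤ β ^ 2 / (1 - ρ) := by positivity
    have h3 : 0 ≤ (∑ j, (Matrix.vecMul c W j - avg (Matrix.vecMul c W)) ^ 2)
        * (β ^ 2 / (1 - ρ)) :=
      mul_nonneg (Finset.sum_nonneg fun j _ => sq_nonneg _) h0
    calc _ ≤ 1 * ((∑ j, (Matrix.vecMul c W j - avg (Matrix.vecMul c W)) ^ 2)
        * (β ^ 2 / (1 - ρ))) := by gcongr
      _ ≤ _ := by rw [one_mul]; gcongr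
  have e3 : ρ * e * (β ^ 2 / (1 - ρ)) + β ^ 2 * e = e * (β ^ 2 / (1 - ρ)) := by
    field_simp
    ring
  linarith

end IsGossip

end Gossip

/-! ### Scalar recursions -/

/-- The quantity `r ∑ a + a T` grows by at most `r b T` per step. -/
theorem sum_le_of_recursion {a b : ℕ → ℝ} {r : ℝ} (hr : 0 < r) (ha : ∀ t, 0 ≤ a t)
    (h : ∀ t, a (t + 1) ≤ (1 - r) * a t + r * b t) (T : ℕ) :
    ∑ t ∈ Finset.range T, a t ≤ a 0 / r + ∑ t ∈ Finset.range T, b t := by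
  have key : r * ∑ t ∈ Finset.range T, a t + a T ≤ a 0 + r * ∑ t ∈ Finset.range T, b t := by
    induction T with
    | zero => simp
    | succ T ih =>
      rw [Finset.sum_range_succ, Finset.sum_range_succ]
      nlinarith [h T]
  have := ha T
  rw [← sub_le_iff_le_add, le_div_iff₀ hr]
  linarith

theorem le_of_recursion {a : ℕ → ℝ} {r B : ℝ} (hr1 : r ≤ 1) (h0 : a 0 ≤ B)
    (h : ∀ t, a (t + 1) ≤ (1 - r) * a t + r * B) (t : ℕ) : a t ≤ B := by
  induction t with
  | zero => exact h0
  | succ t ih => nlinarith [h t]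

/-! ### Bounds on exponentially forgetting averages -/

section Ema

variable {K : ℕ} {W : Matrix (Fin K) (Fin K) ℝ} {ρ β : ℝ}

theorem ema_map {E E' : Type*} [AddCommGroup E] [Module ℝ E] [AddCommGroup E'] [Module ℝ E']
    (L : E →ₗ[ℝ] E') (init : E) (inp : ℕ → Fin K → E) (t : ℕ) (k : Fin K) :
    L (ema β W init inp t k) = ema β W (L init) (fun t k => L (inp t k)) t k := by
  induction t generalizing k with
  | zero => rfl
  | succ t ih => simp [ema, ih]

theorem ema_add {E : Type*} [AddCommGroup E] [Module ℝ E] (i₁ i₂ : E)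
    (p₁ p₂ : ℕ → Fin K → E) (t : ℕ) (k : Fin K) :
    ema β W (i₁ + i₂) (fun t k => p₁ t k + p₂ t k) t k
      = ema β W i₁ p₁ t k + ema β W i₂ p₂ t k := by
  induction t generalizing k with
  | zero => rfl
  | succ t ih =>
    simp only [ema, ih, smul_add, Finset.sum_add_distrib]
    abel

/-- Every step is a convex combination, with weights from a row of `W` and from `1 - β`, `β`. It is
used for norm balls and for the operators within distance `1 - κ` of the identity after scaling. -/
theorem ema_mem (hW : IsGossip W ρ) (hβ0 : 0 ≤ β) (hβ1 : β ≤ 1) {E : Type*} [AddCommGroup E]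
    [Module ℝ E] {s : Set E} (hs : Convex ℝ s) {init : E} {inp : ℕ → Fin K → E} (h0 : init ∈ s)
    (h : ∀ t k, inp t k ∈ s) (t : ℕ) (k : Fin K) : ema β W init inp t k ∈ s := by
  induction t generalizing k with
  | zero => exact h0
  | succ t ih =>
    exact hs (hs.sum_mem (fun j _ => hW.nonneg k j) (hW.row_sum k) fun j _ => ih j) (h t k)
      (by linarith) hβ0 (by ring)

theorem avg_ema_succ (hW : IsGossip W ρ) {E : Type*} [AddCommGroup E] [Module ℝ E] (init : E)
    (inp : ℕ → Fin K → E) (t : ℕ) :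
    avg (ema β W init inp (t + 1)) = (1 - β) • avg (ema β W init inp t) + β • avg (inp t) := by
  have : ema β W init inp (t + 1) = fun k =>
    (1 - β) • ∑ j, W k j • ema β W init inp t j + β • inp t k := rfl
  rw [this, avg_add, avg_smul, avg_smul, hW.avg_mix]

/-- The bound is the fixed point of the one-step inequality for `disp`, and the recursion starts at
zero because all agents share `init`. -/
theorem disp_ema_le_euclidean (hW : IsGossip W ρ) (hβ0 : 0 ≤ β) (hβ1 : β ≤ 1) (hK : 1 ≤ K)
    {ι : Type*} [Fintype ι] {init : EuclideanSpace ℝ ι} {inp : ℕ → Fin K → EuclideanSpace ℝ ι}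
    {B : ℝ} (h : ∀ t k, ‖inp t k‖ ≤ B) (t : ℕ) :
    disp (ema β W init inp t) ≤ 4 * (β / (1 - ρ)) ^ 2 * B ^ 2 := by
  have hρ := hW.rho_nonneg
  have hρ1 := hW.one_sub_pos
  refine le_of_recursion (a := fun t => disp (ema β W init inp t)) (r := (1 - ρ) / 2)
    (by linarith) ?_ (fun t => ?_) t
  · have : disp (ema β W init inp 0) = 0 := by
      have h1 : avg (ema β W init inp 0) = init := avg_const hK init
      simp only [disp, h1]
      simp [ema, avg]
    rw [this]; positivity
  · refine (hW.disp_step_le (ema β W init inp t) (fun k => β • inp t k) (l := 1 - β)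
      (by linarith) (by linarith)).trans ?_
    have h1 : avg (fun k => ‖β • inp t k‖ ^ 2) ≤ β ^ 2 * B ^ 2 := by
      refine avg_le_of_le hK fun k => ?_
      rw [norm_smul, mul_pow, Real.norm_eq_abs, sq_abs]
      have := pow_le_pow_left₀ (norm_nonneg _) (h t k) 2
      gcongr
    have h2 : 2 / (1 - ρ) * avg (fun k => ‖β • inp t k‖ ^ 2) ≤ 2 / (1 - ρ) * (β ^ 2 * B ^ 2) := by
      gcongr
    have h3 : (1 - ρ) / 2 * (4 * (β / (1 - ρ)) ^ 2 * B ^ 2) = 2 / (1 - ρ) * (β ^ 2 * B ^ 2) := by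
      field_simp
      ring
    rw [h3]
    linarith

/-- The identification of a finite-dimensional space with a Euclidean one. -/
def toEucl (E : Type*) [NormedAddCommGroup E] [NormedSpace ℝ E] [FiniteDimensional ℝ E] :
    E →L[ℝ] EuclideanSpace ℝ (Fin (Module.finrank ℝ E)) :=
  (toEuclidean (E := E)).toContinuousLinearMap

/-- The inverse of `toEucl`. -/
def ofEucl (E : Type*) [NormedAddCommGroup E] [NormedSpace ℝ E] [FiniteDimensional ℝ E] :
    EuclideanSpace ℝ (Fin (Module.finrank ℝ E)) →L[ℝ] E :=
  (toEuclidean (E := E)).symm.toContinuousLinearMap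

theorem ofEucl_toEucl {E : Type*} [NormedAddCommGroup E] [NormedSpace ℝ E]
    [FiniteDimensional ℝ E] (x : E) : ofEucl E (toEucl E x) = x :=
  (toEuclidean (E := E)).symm_apply_apply x

/-- A constant comparing the norm of a finite-dimensional space with a Euclidean one. -/
def euclConst (E : Type*) [NormedAddCommGroup E] [NormedSpace ℝ E] [FiniteDimensional ℝ E] : ℝ :=
  ‖ofEucl E‖ ^ 2 * ‖toEucl E‖ ^ 2

/-- The linear recursion commutes with the identification of `E` with a Euclidean space; the change
of norm costs the factor `euclConst E`. -/
theorem disp_ema_le (hW : IsGossip W ρ) (hβ0 : 0 ≤ β) (hβ1 : β ≤ 1) (hK : 1 ≤ K)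
    {E : Type*} [NormedAddCommGroup E] [NormedSpace ℝ E] [FiniteDimensional ℝ E] {init : E}
    {inp : ℕ → Fin K → E} {B : ℝ} (h : ∀ t k, ‖inp t k‖ ≤ B) (t : ℕ) :
    disp (ema β W init inp t) ≤ euclConst E * (4 * (β / (1 - ρ)) ^ 2 * B ^ 2) := by
  set L := toEucl E
  set L' := ofEucl E
  have h1 := disp_ema_le_euclidean hW hβ0 hβ1 hK (init := L init) (inp := fun t k => L (inp t k))
    (B := ‖L‖ * B) (fun t k => (L.le_opNorm _).trans (by gcongr; exact h t k)) t
  have h2 : disp (ema β W init inp t) ≤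
      ‖L'‖ ^ 2 * disp (ema β W (L init) (fun t k => L (inp t k)) t) := by
    simp only [disp]
    rw [← avg_mul]
    refine avg_mono fun k => ?_
    have e1 : avg (ema β W (L init) (fun t k => L (inp t k)) t) = L (avg (ema β W init inp t)) := by
      refine Eq.trans ?_ (avg_map L.toLinearMap _)
      congr 1
      ext1 k
      exact (ema_map L.toLinearMap init inp t k).symm
    have e2 : ema β W (L init) (fun t k => L (inp t k)) t k = L (ema β W init inp t k) :=
      (ema_map L.toLinearMap init inp t k).symm
    rw [e1, e2, ← map_sub, ← mul_pow]
    refine pow_le_pow_left₀ (norm_nonneg _) ?_ 2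
    have := L'.le_opNorm (L (ema β W init inp t k - avg (ema β W init inp t)))
    rwa [ofEucl_toEucl] at this
  refine h2.trans ((mul_le_mul_of_nonneg_left h1 (sq_nonneg _)).trans (le_of_eq ?_))
  rw [euclConst]
  ring

/-- Tracking of a moving target `τ` by an exponentially forgetting average. -/
theorem sum_norm_sub_sq_le {E : Type*} [NormedAddCommGroup E] [NormedSpace ℝ E] {a b τ : ℕ → E}
    (hβ0 : 0 < β) (hβ1 : β ≤ 1) (h : ∀ t, a (t + 1) = (1 - β) • a t + β • b t) (T : ℕ) :
    ∑ t ∈ Finset.range T, ‖a t - τ t‖ ^ 2 ≤ ‖a 0 - τ 0‖ ^ 2 / β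
      + ∑ t ∈ Finset.range T, (2 * ‖b t - τ t‖ ^ 2 + 2 / β ^ 2 * ‖τ t - τ (t + 1)‖ ^ 2) := by
  refine sum_le_of_recursion (a := fun t => ‖a t - τ t‖ ^ 2) hβ0 (fun t => sq_nonneg _)
    (fun t => ?_) T
  -- The drift of the target is charged to the part with weight `β`, hence the factor `β⁻¹`, which
  -- squares to the `2 / β ^ 2` of the statement.
  have e : a (t + 1) - τ (t + 1) = (1 - β) • (a t - τ t)
      + β • ((b t - τ t) + β⁻¹ • (τ t - τ (t + 1))) := by
    rw [h, smul_add, smul_smul, mul_inv_cancel₀ hβ0.ne', one_smul]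
    simp only [smul_sub, sub_smul, one_smul]
    abel
  set x := ‖a t - τ t‖
  set y := ‖b t - τ t‖
  set z := ‖τ t - τ (t + 1)‖
  have h1 : ‖a (t + 1) - τ (t + 1)‖ ≤ (1 - β) * x + β * (y + β⁻¹ * z) := by
    rw [e]
    refine (norm_add_le _ _).trans ?_
    rw [norm_smul, norm_smul, Real.norm_of_nonneg (by linarith), Real.norm_of_nonneg hβ0.le]
    gcongr
    refine (norm_add_le _ _).trans ?_
    rw [norm_smul, Real.norm_of_nonneg (by positivity)]
  have h2 := pow_le_pow_left₀ (norm_nonneg _) h1 2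
  have h3 : 2 / β ^ 2 * z ^ 2 = 2 * (β⁻¹ * z) ^ 2 := by
    field_simp
  rw [h3]
  refine h2.trans ?_
  set w := β⁻¹ * z
  nlinarith [sq_nonneg (x - (y + w)), mul_nonneg hβ0.le (sub_nonneg.2 hβ1),
    mul_nonneg (mul_nonneg hβ0.le (sub_nonneg.2 hβ1)) (sq_nonneg (x - (y + w))),
    mul_nonneg hβ0.le (sq_nonneg (y - w))]

end Ema

end DSMO

end

noncomputable section

namespace DSMO

/-! ### Partial derivatives -/

/-- Cauchy–Schwarz in coordinates. The Frobenius hypotheses enter the proof only through this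
comparison. -/
theorem norm_le_frob {n p : ℕ} (A : Vec n →L[ℝ] Vec p) : ‖A‖ ≤ frob A := by
  refine A.opNorm_le_bound (Real.sqrt_nonneg _) fun x => ?_
  have hx : x = ∑ i, x i • EuclideanSpace.single i (1 : ℝ) := by
    ext j
    simp [Pi.single_apply]
  have h1 : ‖A x‖ ≤ ∑ i, ‖A (EuclideanSpace.single i (1 : ℝ))‖ * |x i| := by
    conv_lhs => rw [hx]
    rw [map_sum]
    refine (norm_sum_le _ _).trans (Finset.sum_le_sum fun i _ => ?_)
    rw [map_smul, norm_smul, Real.norm_eq_abs, mul_comm]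
  refine h1.trans ((Real.sum_mul_le_sqrt_mul_sqrt _ _ _).trans (le_of_eq ?_))
  simp only [frob, EuclideanSpace.norm_eq, Real.norm_eq_abs]

section Partial

variable {n p : ℕ} {φ : Vec n → Vec p → ℝ}

theorem hasGradientAt_grad₁ (h : Differentiable ℝ fun q : Vec n × Vec p => φ q.1 q.2)
    (a : Vec n) (y : Vec p) : HasGradientAt (fun x => φ x y) (grad₁ φ a y) a := by
  have : Differentiable ℝ fun x => φ x y :=
    h.comp (differentiable_id.prodMk (differentiable_const y))
  exact (this a).hasGradientAt

theorem hasGradientAt_grad₂ (h : Differentiable ℝ fun q : Vec n × Vec p => φ q.1 q.2)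
    (a : Vec n) (y : Vec p) : HasGradientAt (fun y => φ a y) (grad₂ φ a y) y := by
  have : Differentiable ℝ fun y => φ a y :=
    h.comp ((differentiable_const a).prodMk differentiable_id)
  exact (this y).hasGradientAt

/-- The derivative of a function of two vectors in terms of its partial gradients. -/
theorem fderiv_eq_grad (h : Differentiable ℝ fun q : Vec n × Vec p => φ q.1 q.2)
    (a v : Vec n) (y w : Vec p) :
    fderiv ℝ (fun q : Vec n × Vec p => φ q.1 q.2) (a, y) (v, w)
      = inner ℝ (grad₁ φ a y) v + inner ℝ (grad₂ φ a y) w := by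
  set D := fderiv ℝ (fun q : Vec n × Vec p => φ q.1 q.2) (a, y) with hD
  have hd : HasFDerivAt (fun q : Vec n × Vec p => φ q.1 q.2) D (a, y) := (h (a, y)).hasFDerivAt
  have h1 := (hasGradientAt_iff_hasFDerivAt.1 (hasGradientAt_grad₁ h a y)).unique
    (HasFDerivAt.comp (f := fun x => (x, y)) a hd ((hasFDerivAt_id a).prodMk (hasFDerivAt_const y a)))
  have h2 := (hasGradientAt_iff_hasFDerivAt.1 (hasGradientAt_grad₂ h a y)).unique
    (HasFDerivAt.comp (f := fun y => (a, y)) y hd ((hasFDerivAt_const a y).prodMk (hasFDerivAt_id y)))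
  have e1 := congrArg (fun L => L v) h1
  have e2 := congrArg (fun L => L w) h2
  simp at e1 e2
  rw [e1, e2, ← map_add]
  simp

theorem differentiable_grad₂ (h : ContDiff ℝ 2 fun q : Vec n × Vec p => φ q.1 q.2) :
    Differentiable ℝ fun q : Vec n × Vec p => grad₂ φ q.1 q.2 := by
  have hd : Differentiable ℝ fun q : Vec n × Vec p => φ q.1 q.2 := h.differentiable (by norm_num)
  have h1 : Differentiable ℝ (fderiv ℝ fun q : Vec n × Vec p => φ q.1 q.2) :=
    (h.fderiv_right (m := 1) (by norm_num)).differentiable (by norm_num)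
  have e : (fun q : Vec n × Vec p => grad₂ φ q.1 q.2) = fun q =>
      (InnerProductSpace.toDual ℝ (Vec p)).symm
        ((fderiv ℝ (fun q : Vec n × Vec p => φ q.1 q.2) q).comp
          (ContinuousLinearMap.inr ℝ (Vec n) (Vec p))) := by
    ext1 q
    rw [LinearIsometryEquiv.eq_symm_apply]
    ext w
    have := fderiv_eq_grad hd q.1 0 q.2 w
    simp only [inner_zero_right, zero_add] at this
    simp [this]
  rw [e]
  exact (InnerProductSpace.toDual ℝ (Vec p)).symm.differentiable.comp
    (h1.clm_comp (differentiable_const _))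

/-- The derivative of the partial gradient in terms of the second derivatives. -/
theorem hasFDerivAt_grad₂ (h : ContDiff ℝ 2 fun q : Vec n × Vec p => φ q.1 q.2)
    (a : Vec n) (y : Vec p) :
    HasFDerivAt (fun q : Vec n × Vec p => grad₂ φ q.1 q.2)
      ((ContinuousLinearMap.adjoint (hess₁₂ φ a y)).comp (ContinuousLinearMap.fst ℝ _ _)
        + (hess₂₂ φ a y).comp (ContinuousLinearMap.snd ℝ _ _)) (a, y) := by
  have hd := (differentiable_grad₂ h (a, y)).hasFDerivAt
  set D := fderiv ℝ (fun q : Vec n × Vec p => grad₂ φ q.1 q.2) (a, y)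
  have h1 : fderiv ℝ (fun x => grad₂ φ x y) a
      = D.comp ((ContinuousLinearMap.id ℝ (Vec n)).prod 0) :=
    (HasFDerivAt.comp (f := fun x => (x, y)) a hd
      ((hasFDerivAt_id a).prodMk (hasFDerivAt_const y a))).fderiv
  have h2 : fderiv ℝ (fun y => grad₂ φ a y) y
      = D.comp (ContinuousLinearMap.prod 0 (ContinuousLinearMap.id ℝ (Vec p))) :=
    (HasFDerivAt.comp (f := fun y => (a, y)) y hd
      ((hasFDerivAt_const a y).prodMk (hasFDerivAt_id y))).fderiv
  have e : (ContinuousLinearMap.adjoint (hess₁₂ φ a y)).comp (ContinuousLinearMap.fst ℝ _ _)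
        + (hess₂₂ φ a y).comp (ContinuousLinearMap.snd ℝ _ _) = D := by
    refine ContinuousLinearMap.ext fun q => ?_
    simp [hess₁₂, hess₂₂, h1, h2, ← map_add]
  rw [e]
  exact hd

/-- Symmetry of second derivatives. It makes the inverse Hessians self-adjoint, which allows
transposing the derivative of the best responses. -/
theorem hess₂₂_symm (h : ContDiff ℝ 2 fun q : Vec n × Vec p => φ q.1 q.2)
    (a : Vec n) (y v w : Vec p) :
    inner ℝ (hess₂₂ φ a y v) w = inner ℝ v (hess₂₂ φ a y w) := by
  have hc : ContDiff ℝ 2 fun y => φ a y := h.comp (contDiff_const.prodMk contDiff_id)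
  have hs : IsSymmSndFDerivAt ℝ (fun y => φ a y) y :=
    hc.contDiffAt.isSymmSndFDerivAt (by simp)
  have h1 : Differentiable ℝ (fderiv ℝ fun y => φ a y) :=
    (hc.fderiv_right (m := 1) (by norm_num)).differentiable (by norm_num)
  have e : (fun y => grad₂ φ a y) = fun y =>
      (InnerProductSpace.toDual ℝ (Vec p)).symm (fderiv ℝ (fun y => φ a y) y) := rfl
  have hh : ∀ v, hess₂₂ φ a y v = (InnerProductSpace.toDual ℝ (Vec p)).symm
      (fderiv ℝ (fderiv ℝ fun y => φ a y) y v) := by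
    intro v
    have hL : HasFDerivAt (fun ℓ => (InnerProductSpace.toDual ℝ (Vec p)).symm ℓ)
        ((InnerProductSpace.toDual ℝ (Vec p)).symm.toContinuousLinearEquiv.toContinuousLinearMap
          : _ →L[ℝ] Vec p) (fderiv ℝ (fun y => φ a y) y) :=
      (InnerProductSpace.toDual ℝ (Vec p)).symm.toContinuousLinearEquiv.hasFDerivAt
    have := (hL.comp y (h1 y).hasFDerivAt).fderiv
    rw [hess₂₂, e]
    exact congrArg (fun A => A v) this
  rw [hh, hh, InnerProductSpace.toDual_symm_apply, real_inner_comm,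
    InnerProductSpace.toDual_symm_apply]
  exact hs.eq v w

end Partial

/-! ### Second moments of sampled derivatives -/

/-- Nonnegativity of the variance of `‖X‖`. Together with unbiasedness it transfers the hypotheses
on sampled derivatives to the exact ones. -/
theorem SecondMomentLE.norm_integral_le {S E : Type*} [MeasurableSpace S] [NormedAddCommGroup E]
    [NormedSpace ℝ E] {ν : Measure S} [IsProbabilityMeasure ν] {X : S → E} {r : ℝ}
    (h : SecondMomentLE ν X r) (hr : 0 ≤ r) : ‖∫ s, X s ∂ν‖ ≤ r := by
  have hi : Integrable (fun s => ‖X s‖) ν := (h.1.integrable (by norm_num)).norm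
  have h2 : Integrable (fun s => ‖X s‖ ^ 2) ν := h.1.integrable_norm_pow (by norm_num)
  refine (MeasureTheory.norm_integral_le_integral_norm _).trans (abs_le_of_sq_le_sq' ?_ hr).2
  set m := ∫ s, ‖X s‖ ∂ν
  have h0 : 0 ≤ ∫ s, (‖X s‖ - m) ^ 2 ∂ν := integral_nonneg fun s => sq_nonneg _
  have e : ∫ s, (‖X s‖ - m) ^ 2 ∂ν = (∫ s, ‖X s‖ ^ 2 ∂ν) - 2 * m * m + m ^ 2 := by
    have : ∀ s, (‖X s‖ - m) ^ 2 = ‖X s‖ ^ 2 - 2 * m * ‖X s‖ + m ^ 2 := fun s => by ring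
    simp_rw [this]
    have h3 : Integrable (fun s => ‖X s‖ ^ 2 - 2 * m * ‖X s‖) ν := h2.sub (hi.const_mul _)
    rw [integral_add h3 (integrable_const _), integral_sub h2 (hi.const_mul _), integral_const_mul]
    simp [m]
  have := h.2
  nlinarith

/-! ### Convexity and contraction -/

/-- By convexity the difference quotients at `y` towards `z` are at most `ψ z - ψ y`, and they tend
to zero. -/
theorem isMin_of_hasFDerivAt_zero {E : Type*} [NormedAddCommGroup E] [NormedSpace ℝ E] {ψ : E → ℝ}
    (hc : ConvexOn ℝ Set.univ ψ) {y : E} (h : HasFDerivAt ψ (0 : E →L[ℝ] ℝ) y) (z : E) :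
    ψ y ≤ ψ z := by
  have hl := (h.hasLineDerivAt (z - y)).tendsto_slope_zero_right
  simp only [zero_apply] at hl
  have : (0 : ℝ) ≤ ψ z - ψ y := by
    refine le_of_tendsto hl ?_
    have hmem : Set.Ioo (0 : ℝ) 1 ∈ nhdsWithin (0 : ℝ) (Set.Ioi 0) :=
      Ioo_mem_nhdsGT one_pos
    filter_upwards [hmem] with t ht
    have h1 := hc.2 (Set.mem_univ y) (Set.mem_univ z) (sub_nonneg.2 ht.2.le) ht.1.le (by ring)
    have e : (1 - t) • y + t • z = y + t • (z - y) := by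
      rw [smul_sub, sub_smul, one_smul]; abel
    rw [e] at h1
    simp only [smul_eq_mul] at h1 ⊢
    rw [inv_mul_le_iff₀ ht.1]
    linarith
  linarith

/-- An operator that is close to a multiple of the identity. -/
theorem isUnit_of_norm_one_sub_le {E : Type*} [NormedAddCommGroup E] [NormedSpace ℝ E]
    [CompleteSpace E] {A : E →L[ℝ] E} {L κ : ℝ} (hL : 0 < L) (hκ : 0 < κ)
    (h : ‖ContinuousLinearMap.id ℝ E - L⁻¹ • A‖ ≤ 1 - κ) : IsUnit A := by
  have h1 : IsUnit (1 - (ContinuousLinearMap.id ℝ E - L⁻¹ • A)) :=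
    isUnit_one_sub_of_norm_lt_one (by linarith)
  have e : (1 - (ContinuousLinearMap.id ℝ E - L⁻¹ • A)) = L⁻¹ • A := sub_sub_cancel _ _
  rw [e] at h1
  have h2 : A = L • (L⁻¹ • A) := by rw [smul_smul, mul_inv_cancel₀ hL.ne', one_smul]
  rw [h2, Algebra.smul_def]
  exact ((Units.mk0 L hL.ne').isUnit.map (algebraMap ℝ (E →L[ℝ] E))).mul h1

theorem le_norm_apply_of_norm_one_sub_le {E : Type*} [NormedAddCommGroup E] [NormedSpace ℝ E]
    {A : E →L[ℝ] E} {L κ : ℝ} (hL : 0 < L)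
    (h : ‖ContinuousLinearMap.id ℝ E - L⁻¹ • A‖ ≤ 1 - κ) (v : E) : κ * L * ‖v‖ ≤ ‖A v‖ := by
  have h1 := ((ContinuousLinearMap.id ℝ E - L⁻¹ • A).le_of_opNorm_le h v)
  have h2 : ‖v‖ ≤ ‖v - L⁻¹ • A v‖ + L⁻¹ * ‖A v‖ := by
    have := norm_add_le (v - L⁻¹ • A v) (L⁻¹ • A v)
    rwa [sub_add_cancel, norm_smul, Real.norm_of_nonneg (by positivity)] at this
  simp only [sub_apply, ContinuousLinearMap.id_apply,
    smul_apply] at h1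
  have h3 : κ * ‖v‖ ≤ L⁻¹ * ‖A v‖ := by linarith
  rwa [inv_mul_eq_div, le_div_iff₀ hL, mul_right_comm] at h3

section Inverse

variable {E : Type*} [NormedAddCommGroup E] [NormedSpace ℝ E] [CompleteSpace E]
  {A A' : E →L[ℝ] E} {L κ : ℝ}

theorem apply_inverse (hL : 0 < L) (hκ : 0 < κ)
    (h : ‖ContinuousLinearMap.id ℝ E - L⁻¹ • A‖ ≤ 1 - κ) (v : E) :
    A (Ring.inverse A v) = v :=
  congrArg (fun B : E →L[ℝ] E => B v)
    (Ring.mul_inverse_cancel A (isUnit_of_norm_one_sub_le hL hκ h))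

theorem inverse_apply (hL : 0 < L) (hκ : 0 < κ)
    (h : ‖ContinuousLinearMap.id ℝ E - L⁻¹ • A‖ ≤ 1 - κ) (v : E) :
    Ring.inverse A (A v) = v :=
  congrArg (fun B : E →L[ℝ] E => B v)
    (Ring.inverse_mul_cancel A (isUnit_of_norm_one_sub_le hL hκ h))

theorem norm_inverse_apply_le (hL : 0 < L) (hκ : 0 < κ)
    (h : ‖ContinuousLinearMap.id ℝ E - L⁻¹ • A‖ ≤ 1 - κ) (v : E) :
    ‖Ring.inverse A v‖ ≤ (κ * L)⁻¹ * ‖v‖ := by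
  have := le_norm_apply_of_norm_one_sub_le hL h (Ring.inverse A v)
  rw [apply_inverse hL hκ h] at this
  rwa [inv_mul_eq_div, le_div_iff₀ (by positivity), mul_comm]

/-- The resolvent identity `A⁻¹ - A'⁻¹ = A⁻¹ (A' - A) A'⁻¹`. -/
theorem norm_inverse_sub_apply_le (hL : 0 < L) (hκ : 0 < κ)
    (h : ‖ContinuousLinearMap.id ℝ E - L⁻¹ • A‖ ≤ 1 - κ)
    (h' : ‖ContinuousLinearMap.id ℝ E - L⁻¹ • A'‖ ≤ 1 - κ) (v : E) :
    ‖Ring.inverse A v - Ring.inverse A' v‖ ≤ (κ * L)⁻¹ * (‖A' - A‖ * ((κ * L)⁻¹ * ‖v‖)) := by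
  have e : Ring.inverse A v - Ring.inverse A' v
      = Ring.inverse A ((A' - A) (Ring.inverse A' v)) := by
    rw [sub_apply, apply_inverse hL hκ h', map_sub, inverse_apply hL hκ h]
  rw [e]
  refine (norm_inverse_apply_le hL hκ h _).trans ?_
  have : 0 ≤ (κ * L)⁻¹ := by positivity
  gcongr
  refine ((A' - A).le_opNorm _).trans ?_
  gcongr
  exact norm_inverse_apply_le hL hκ h' v

end Inverse

end DSMO

end

/-! ### The averaged problem: best responses, their derivatives, and the hypergradient -/

noncomputable section

namespace DSMO

namespace Problem

variable {M K : ℕ} {d : Fin (M + 1) → ℕ}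

/-- The gradient in `y` of an averaged inner objective. -/
def G (p : Problem M K d) (m : Fin M) (a : Vec (d m.castSucc)) (y : Vec (d m.succ)) :
    Vec (d m.succ) := avg fun k => grad₂ (p.g k m) a y

/-- The mixed second derivative of an averaged inner objective. -/
def U (p : Problem M K d) (m : Fin M) (a : Vec (d m.castSucc)) (y : Vec (d m.succ)) :
    Vec (d m.succ) →L[ℝ] Vec (d m.castSucc) := avg fun k => hess₁₂ (p.g k m) a y

/-- The Hessian in `y` of an averaged inner objective. -/
def H (p : Problem M K d) (m : Fin M) (a : Vec (d m.castSucc)) (y : Vec (d m.succ)) :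
    Vec (d m.succ) →L[ℝ] Vec (d m.succ) := avg fun k => hess₂₂ (p.g k m) a y

/-- The averaged partial gradient of the outer objectives in the first argument. -/
def f₁ (p : Problem M K d) (x : Vec (d 0)) (y : Vec (d (Fin.last M))) : Vec (d 0) :=
  avg fun k => grad₁ (p.f k) x y

/-- The averaged partial gradient of the outer objectives in the second argument. -/
def f₂ (p : Problem M K d) (x : Vec (d 0)) (y : Vec (d (Fin.last M))) : Vec (d (Fin.last M)) :=
  avg fun k => grad₂ (p.f k) x y

/-- Deterministic regularity of a problem with uniform constants. -/
structure Regular (p : Problem M K d) (Λ κ : ℝ) (L : Fin M → ℝ) : Prop where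
  K_pos : 1 ≤ K
  one_le : 1 ≤ Λ
  κ_pos : 0 < κ
  κ_le_one : κ ≤ 1
  L_pos : ∀ m, 0 < L m
  L_le : ∀ m, L m ≤ Λ
  L_inv_le : ∀ m, (L m)⁻¹ ≤ Λ
  f_diff : ∀ k, Differentiable ℝ fun q : Vec (d 0) × Vec (d (Fin.last M)) => p.f k q.1 q.2
  f_bound₁ : ∀ k x y, ‖grad₁ (p.f k) x y‖ ≤ Λ
  f_bound₂ : ∀ k x y, ‖grad₂ (p.f k) x y‖ ≤ Λ
  f_lip₁ : ∀ k x x' y y',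
    ‖grad₁ (p.f k) x y - grad₁ (p.f k) x' y'‖ ≤ Λ * (‖x - x'‖ + ‖y - y'‖)
  f_lip₂ : ∀ k x x' y y',
    ‖grad₂ (p.f k) x y - grad₂ (p.f k) x' y'‖ ≤ Λ * (‖x - x'‖ + ‖y - y'‖)
  g_contDiff : ∀ k m,
    ContDiff ℝ 2 fun q : Vec (d m.castSucc) × Vec (d m.succ) => p.g k m q.1 q.2
  g_convex : ∀ m a, ConvexOn ℝ Set.univ (p.gAvg m a)
  g_lip : ∀ k m a a' y y',
    ‖grad₂ (p.g k m) a y - grad₂ (p.g k m) a' y'‖ ≤ L m * (‖a - a'‖ + ‖y - y'‖)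
  bound₁₂ : ∀ k m a y, ‖hess₁₂ (p.g k m) a y‖ ≤ Λ
  contraction : ∀ k m a y,
    ‖ContinuousLinearMap.id ℝ (Vec (d m.succ)) - (L m)⁻¹ • hess₂₂ (p.g k m) a y‖ ≤ 1 - κ
  lip₁₂ : ∀ k m a a' y y',
    ‖hess₁₂ (p.g k m) a y - hess₁₂ (p.g k m) a' y'‖ ≤ Λ * (‖a - a'‖ + ‖y - y'‖)
  lip₂₂ : ∀ k m a a' y y',
    ‖hess₂₂ (p.g k m) a y - hess₂₂ (p.g k m) a' y'‖ ≤ Λ * (‖a - a'‖ + ‖y - y'‖)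

end Problem

theorem norm_avg_sub_avg_le {K : ℕ} (hK : 1 ≤ K) {E : Type*} [NormedAddCommGroup E]
    [NormedSpace ℝ E] {X Y : Fin K → E} {C : ℝ} (h : ∀ k, ‖X k - Y k‖ ≤ C) :
    ‖avg X - avg Y‖ ≤ C := by
  rw [← avg_sub]
  exact (norm_avg_le _).trans (avg_le_of_le hK h)

theorem norm_avg_le_of_le {K : ℕ} (hK : 1 ≤ K) {E : Type*} [NormedAddCommGroup E]
    [NormedSpace ℝ E] {X : Fin K → E} {C : ℝ} (h : ∀ k, ‖X k‖ ≤ C) : ‖avg X‖ ≤ C :=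
  (norm_avg_le _).trans (avg_le_of_le hK h)

theorem avg_apply {K : ℕ} {E F : Type*} [NormedAddCommGroup E] [NormedSpace ℝ E]
    [NormedAddCommGroup F] [NormedSpace ℝ F] (A : Fin K → E →L[ℝ] F) (v : E) :
    avg A v = avg fun k => A k v := by
  simp [avg]

namespace Problem.Regular

variable {M K : ℕ} {d : Fin (M + 1) → ℕ} {p : Problem M K d} {Λ κ : ℝ} {L : Fin M → ℝ}

theorem Λ_pos (h : p.Regular Λ κ L) : 0 < Λ := one_pos.trans_le h.one_le

theorem f₁_bound (h : p.Regular Λ κ L) (x y) : ‖p.f₁ x y‖ ≤ Λ :=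
  norm_avg_le_of_le h.K_pos fun _ => h.f_bound₁ _ _ _

theorem f₂_bound (h : p.Regular Λ κ L) (x y) : ‖p.f₂ x y‖ ≤ Λ :=
  norm_avg_le_of_le h.K_pos fun _ => h.f_bound₂ _ _ _

theorem f₁_lip (h : p.Regular Λ κ L) (x x' y y') :
    ‖p.f₁ x y - p.f₁ x' y'‖ ≤ Λ * (‖x - x'‖ + ‖y - y'‖) :=
  norm_avg_sub_avg_le h.K_pos fun _ => h.f_lip₁ _ _ _ _ _

theorem f₂_lip (h : p.Regular Λ κ L) (x x' y y') :
    ‖p.f₂ x y - p.f₂ x' y'‖ ≤ Λ * (‖x - x'‖ + ‖y - y'‖) :=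
  norm_avg_sub_avg_le h.K_pos fun _ => h.f_lip₂ _ _ _ _ _

theorem G_lip (h : p.Regular Λ κ L) (m a a' y y') :
    ‖p.G m a y - p.G m a' y'‖ ≤ L m * (‖a - a'‖ + ‖y - y'‖) :=
  norm_avg_sub_avg_le h.K_pos fun _ => h.g_lip _ _ _ _ _ _

theorem U_bound (h : p.Regular Λ κ L) (m a y) : ‖p.U m a y‖ ≤ Λ :=
  norm_avg_le_of_le h.K_pos fun _ => h.bound₁₂ _ _ _ _

theorem U_lip (h : p.Regular Λ κ L) (m a a' y y') :
    ‖p.U m a y - p.U m a' y'‖ ≤ Λ * (‖a - a'‖ + ‖y - y'‖) :=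
  norm_avg_sub_avg_le h.K_pos fun _ => h.lip₁₂ _ _ _ _ _ _

theorem H_lip (h : p.Regular Λ κ L) (m a a' y y') :
    ‖p.H m a y - p.H m a' y'‖ ≤ Λ * (‖a - a'‖ + ‖y - y'‖) :=
  norm_avg_sub_avg_le h.K_pos fun _ => h.lip₂₂ _ _ _ _ _ _

theorem H_contraction (h : p.Regular Λ κ L) (m a y) :
    ‖ContinuousLinearMap.id ℝ (Vec (d m.succ)) - (L m)⁻¹ • p.H m a y‖ ≤ 1 - κ := by
  rw [H, ← avg_smul, ← avg_const h.K_pos (ContinuousLinearMap.id ℝ (Vec (d m.succ))), ← avg_sub]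
  exact norm_avg_le_of_le h.K_pos fun _ => h.contraction _ _ _ _

theorem H_symm (h : p.Regular Λ κ L) (m a y) (v w : Vec (d m.succ)) :
    inner ℝ (p.H m a y v) w = inner ℝ v (p.H m a y w) := by
  simp only [H, avg_apply]
  simp only [avg, inner_smul_left, inner_smul_right, sum_inner, inner_sum,
    hess₂₂_symm (h.g_contDiff _ m), RCLike.conj_to_real]

theorem inverse_symm (h : p.Regular Λ κ L) (m a y) (v w : Vec (d m.succ)) :
    inner ℝ (Ring.inverse (p.H m a y) v) w = inner ℝ v (Ring.inverse (p.H m a y) w) := by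
  have hv := apply_inverse (h.L_pos m) h.κ_pos (h.H_contraction m a y) v
  have hw := apply_inverse (h.L_pos m) h.κ_pos (h.H_contraction m a y) w
  conv_lhs => rw [← hw]
  conv_rhs => rw [← hv]
  rw [h.H_symm]

theorem inverse_bound (h : p.Regular Λ κ L) (m a y) (v : Vec (d m.succ)) :
    ‖Ring.inverse (p.H m a y) v‖ ≤ Λ / κ * ‖v‖ := by
  refine (norm_inverse_apply_le (h.L_pos m) h.κ_pos (h.H_contraction m a y) v).trans ?_
  have := h.L_inv_le m
  have := h.κ_pos
  rw [mul_inv_rev, div_eq_mul_inv]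
  gcongr

theorem inverse_lip (h : p.Regular Λ κ L) (m a a' y y') (v : Vec (d m.succ)) :
    ‖Ring.inverse (p.H m a y) v - Ring.inverse (p.H m a' y') v‖ ≤
      Λ / κ * (Λ * (‖a - a'‖ + ‖y - y'‖) * (Λ / κ * ‖v‖)) := by
  refine (norm_inverse_sub_apply_le (h.L_pos m) h.κ_pos (h.H_contraction m a y)
    (h.H_contraction m a' y') v).trans ?_
  have h1 : (κ * L m)⁻¹ ≤ Λ / κ := by
    rw [mul_inv_rev, div_eq_mul_inv]
    have := h.κ_pos
    gcongr
    exact h.L_inv_le m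
  have h2 : 0 ≤ (κ * L m)⁻¹ := inv_nonneg.2 (mul_pos h.κ_pos (h.L_pos m)).le
  have h3 := h.H_lip m a a' y y'
  have h4 : 0 ≤ Λ / κ := h2.trans h1
  have h5 := h.Λ_pos
  rw [norm_sub_rev] at h3
  gcongr

theorem hasGradientAt_gAvg (h : p.Regular Λ κ L) (m a y) :
    HasGradientAt (p.gAvg m a) (p.G m a y) y := by
  rw [hasGradientAt_iff_hasFDerivAt]
  have := (HasFDerivAt.fun_sum (u := Finset.univ) fun k _ => hasGradientAt_iff_hasFDerivAt.1
    (hasGradientAt_grad₂ ((h.g_contDiff k m).differentiable (by norm_num)) a y)).const_smul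
      ((K : ℝ)⁻¹)
  refine HasFDerivAt.congr_fderiv (f := p.gAvg m a) this ?_
  ext v
  simp [G, avg]

theorem hasFDerivAt_G (h : p.Regular Λ κ L) (m a y) :
    HasFDerivAt (fun q : Vec (d m.castSucc) × Vec (d m.succ) => p.G m q.1 q.2)
      ((ContinuousLinearMap.adjoint (p.U m a y)).comp (ContinuousLinearMap.fst ℝ _ _)
        + (p.H m a y).comp (ContinuousLinearMap.snd ℝ _ _)) (a, y) := by
  have := (HasFDerivAt.fun_sum (u := Finset.univ) fun k (_ : k ∈ Finset.univ) =>
    hasFDerivAt_grad₂ (h.g_contDiff k m) a y).const_smul ((K : ℝ)⁻¹)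
  refine HasFDerivAt.congr_fderiv
    (f := fun q : Vec (d m.castSucc) × Vec (d m.succ) => p.G m q.1 q.2) this ?_
  refine ContinuousLinearMap.ext fun q => ?_
  simp [U, H, avg, Finset.sum_add_distrib]

theorem hasFDerivAt_G_snd (h : p.Regular Λ κ L) (m a y) :
    HasFDerivAt (fun y => p.G m a y) (p.H m a y) y := by
  have := HasFDerivAt.comp (f := fun y => (a, y)) y (h.hasFDerivAt_G m a y)
    ((hasFDerivAt_const a y).prodMk (hasFDerivAt_id y))
  refine HasFDerivAt.congr_fderiv (f := fun y => p.G m a y) this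
    (ContinuousLinearMap.ext fun v => ?_)
  simp

/-- A gradient step with step size `1 / L` is a contraction. -/
theorem gradient_step (h : p.Regular Λ κ L) (m a y y') :
    ‖(y - (L m)⁻¹ • p.G m a y) - (y' - (L m)⁻¹ • p.G m a y')‖ ≤ (1 - κ) * ‖y - y'‖ := by
  have hd : ∀ z, HasFDerivAt (fun y => y - (L m)⁻¹ • p.G m a y)
      (ContinuousLinearMap.id ℝ (Vec (d m.succ)) - (L m)⁻¹ • p.H m a z) z := fun z =>
    (hasFDerivAt_id z).fun_sub ((h.hasFDerivAt_G_snd m a z).fun_const_smul _)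
  exact Convex.norm_image_sub_le_of_norm_fderiv_le (𝕜 := ℝ)
    (f := fun y => y - (L m)⁻¹ • p.G m a y) (s := Set.univ)
    (fun z _ => (hd z).differentiableAt)
    (fun z _ => by rw [(hd z).fderiv]; exact h.H_contraction m a z) convex_univ
    (Set.mem_univ y') (Set.mem_univ y)

/-- As `argmin` is a mere choice, a minimizer has to be exhibited first: the fixed point of the
contracting gradient step is stationary, hence minimal by convexity. The chosen point is then a
minimizer as well, and so stationary. -/
theorem G_argmin (h : p.Regular Λ κ L) (m a) : p.G m a (argmin (p.gAvg m a)) = 0 := by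
  have hr : ((1 - κ).toNNReal : ℝ) = 1 - κ := Real.coe_toNNReal _ (sub_nonneg.2 h.κ_le_one)
  have hc : ContractingWith (1 - κ).toNNReal
      fun y => y - (L m)⁻¹ • p.G m a y := by
    refine ⟨?_, LipschitzWith.of_dist_le_mul fun y y' => ?_⟩
    · rw [← NNReal.coe_lt_coe]
      simpa [hr] using h.κ_pos
    · rw [hr]
      simpa [dist_eq_norm] using h.gradient_step m a y y'
  have hfix := hc.fixedPoint_isFixedPt
  set z := ContractingWith.fixedPoint _ hc
  have hz : p.G m a z = 0 := by
    have h1 : z - (L m)⁻¹ • p.G m a z = z := hfix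
    simpa [(h.L_pos m).ne'] using h1
  have hmin : ∀ y, p.gAvg m a z ≤ p.gAvg m a y := by
    refine isMin_of_hasFDerivAt_zero (h.g_convex m a) ?_
    have := hasGradientAt_iff_hasFDerivAt.1 (h.hasGradientAt_gAvg m a z)
    rwa [hz, map_zero] at this
  have hs : ∀ y, p.gAvg m a (argmin (p.gAvg m a)) ≤ p.gAvg m a y :=
    Classical.epsilon_spec (p := fun y => ∀ z, p.gAvg m a y ≤ p.gAvg m a z) ⟨z, hmin⟩
  have hl : IsLocalMin (p.gAvg m a) (argmin (p.gAvg m a)) := Filter.Eventually.of_forall hs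
  have := hl.hasFDerivAt_eq_zero (hasGradientAt_iff_hasFDerivAt.1 (h.hasGradientAt_gAvg m a _))
  simpa using this

theorem G_best (h : p.Regular Λ κ L) (m : Fin M) (x) :
    p.G m (p.best m.castSucc x) (p.best m.succ x) = 0 := by
  have : p.best m.succ x = argmin (p.gAvg m (p.best m.castSucc x)) := by
    simp [best, Fin.induction_succ]
  rw [this]
  exact h.G_argmin m _

/-- The point `y` is fixed by the gradient step at `a`, while that step moves `y'` by at most `‖a -
a'‖`. Contraction with factor `1 - κ` bounds the distance of `y'` from the fixed point. -/
theorem norm_zero_sub_zero_le (h : p.Regular Λ κ L) {m a a' y y'} (hy : p.G m a y = 0)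
    (hy' : p.G m a' y' = 0) : ‖y - y'‖ ≤ κ⁻¹ * ‖a - a'‖ := by
  have h1 := h.gradient_step m a y y'
  have h2 := h.G_lip m a a' y' y'
  rw [hy, smul_zero, sub_zero] at h1
  rw [hy', sub_zero, sub_self, norm_zero, add_zero] at h2
  have h3 : ‖y - y'‖ ≤ ‖y - (y' - (L m)⁻¹ • p.G m a y')‖ + (L m)⁻¹ * ‖p.G m a y'‖ := by
    have := norm_sub_le (y - (y' - (L m)⁻¹ • p.G m a y')) ((L m)⁻¹ • p.G m a y')
    rw [norm_smul, Real.norm_of_nonneg (inv_nonneg.2 (h.L_pos m).le)] at this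
    refine le_trans (le_of_eq ?_) this
    congr 1
    abel
  have h4 : (L m)⁻¹ * ‖p.G m a y'‖ ≤ ‖a - a'‖ := by
    rw [inv_mul_le_iff₀ (h.L_pos m)]; exact h2
  rw [inv_mul_eq_div, le_div_iff₀ h.κ_pos]
  linarith

/-- The common Lipschitz constant of the best responses. -/
theorem best_lip (h : p.Regular Λ κ L) (i : Fin (M + 1)) (x x') :
    ‖p.best i x - p.best i x'‖ ≤ κ⁻¹ ^ M * ‖x - x'‖ := by
  have key : ‖p.best i x - p.best i x'‖ ≤ κ⁻¹ ^ (i : ℕ) * ‖x - x'‖ := by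
    induction i using Fin.induction with
    | zero => simp [best]
    | succ m ih =>
      refine (h.norm_zero_sub_zero_le (h.G_best m x) (h.G_best m x')).trans ?_
      have := h.κ_pos
      rw [Fin.val_succ, pow_succ', mul_assoc]
      gcongr
      exact ih
  refine key.trans ?_
  gcongr
  · exact (one_le_inv₀ h.κ_pos).2 h.κ_le_one
  · exact Nat.lt_succ_iff.1 i.2

/-- The derivative of the best response to a moving point. -/
theorem hasFDerivAt_of_zero (h : p.Regular Λ κ L) {m} {E : Type*} [NormedAddCommGroup E]
    [NormedSpace ℝ E] {a : E → Vec (d m.castSucc)} {y : E → Vec (d m.succ)} {x : E}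
    {J : E →L[ℝ] Vec (d m.castSucc)} (hz : ∀ x, p.G m (a x) (y x) = 0) (ha : HasFDerivAt a J x) :
    HasFDerivAt y (-((Ring.inverse (p.H m (a x) (y x))).comp
      ((ContinuousLinearMap.adjoint (p.U m (a x) (y x))).comp J))) x := by
  set Hi := Ring.inverse (p.H m (a x) (y x)) with hHi
  set B := ContinuousLinearMap.adjoint (p.U m (a x) (y x)) with hB
  -- No implicit function theorem is needed: `y` is already known to be Lipschitz in `a`, so the
  -- linearization of `G` at the zero `(a x, y x)` has an error `o(x' - x)` along the curve of
  -- zeros, and applying the inverse Hessian isolates `y x' - y x`.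
  have hbig : (fun x' => a x' - a x) =O[nhds x] fun x' => x' - x := ha.isBigO_sub
  have hylip : (fun x' => y x' - y x) =O[nhds x] fun x' => a x' - a x :=
    Asymptotics.isBigO_of_le' (c := κ⁻¹) _ fun x' => h.norm_zero_sub_zero_le (hz x') (hz x)
  have hcont : Filter.Tendsto (fun x' => (a x', y x')) (nhds x) (nhds (a x, y x)) := by
    refine ha.continuousAt.tendsto.prodMk_nhds ?_
    have h0 : Filter.Tendsto (fun x' => a x' - a x) (nhds x) (nhds 0) := by
      simpa using ha.continuousAt.tendsto.sub_const (a x)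
    simpa using (hylip.trans_tendsto h0).add_const (y x)
  have hG := (h.hasFDerivAt_G m (a x) (y x)).isLittleO.comp_tendsto hcont
  simp only [Function.comp_def, hz, sub_self, zero_sub] at hG
  have hpair : (fun x' => (a x', y x') - (a x, y x)) =O[nhds x] fun x' => x' - x :=
    (hbig.prod_left (hylip.trans hbig))
  have hG2 := hG.trans_isBigO hpair
  have hHG := (Hi.isBigO_comp _ _).trans_isLittleO hG2
  have hJ := ((Hi.comp B).isBigO_comp _ _).trans_isLittleO ha.isLittleO
  refine HasFDerivAt.of_isLittleO ?_
  refine ((hHG.neg_left).sub hJ).congr_left fun x' => ?_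
  have e : Hi (p.H m (a x) (y x) (y x' - y x)) = y x' - y x :=
    inverse_apply (h.L_pos m) h.κ_pos (h.H_contraction m _ _) _
  simp only [Prod.mk_sub_mk, add_apply, ContinuousLinearMap.comp_apply,
    ContinuousLinearMap.coe_fst', ContinuousLinearMap.coe_snd', map_neg, map_add, neg_apply,
    map_sub] at e ⊢
  rw [e]
  abel

end Problem.Regular

/-- The vectors `u_{i+1} q_{i+1} ⋯ u_M q_M h` with the exact derivatives along the best responses:
up to sign, the derivative of the outer objective with respect to `y_i`. -/
def Problem.adj {M K : ℕ} {d : Fin (M + 1) → ℕ} (p : Problem M K d) (x : Vec (d 0))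
    (i : Fin (M + 1)) : Vec (d i) :=
  Fin.reverseInduction (motive := fun i => Vec (d i)) (p.f₂ x (p.best (Fin.last M) x))
    (fun m w => p.U m (p.best m.castSucc x) (p.best m.succ x)
      (Ring.inverse (p.H m (p.best m.castSucc x) (p.best m.succ x)) w)) i

namespace Problem.Regular

variable {M K : ℕ} {d : Fin (M + 1) → ℕ} {p : Problem M K d} {Λ κ : ℝ} {L : Fin M → ℝ}

/-- The Jacobian of the next level is `-H⁻¹ Uᵀ J`. Transposing `H⁻¹` and `Uᵀ` onto `p.adj` turns its
value at `m.succ` into the one at `m.castSucc`, and each level contributes one sign. Only this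
pairing with `p.adj` is needed, so no product formula for `J` appears. -/
theorem hasFDerivAt_best (h : p.Regular Λ κ L) (x) (i : Fin (M + 1)) :
    ∃ J : Vec (d 0) →L[ℝ] Vec (d i), HasFDerivAt (p.best i) J x ∧
      ∀ v, inner ℝ (p.adj x i) (J v) = (-1) ^ (i : ℕ) * inner ℝ (p.adj x 0) v := by
  induction i using Fin.induction with
  | zero => exact ⟨ContinuousLinearMap.id ℝ _, hasFDerivAt_id x, fun v => by simp⟩
  | succ m ih =>
    obtain ⟨J, hJ, hv⟩ := ih
    refine ⟨_, h.hasFDerivAt_of_zero (fun x => h.G_best m x) hJ, fun v => ?_⟩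
    have hv' := hv v
    have e : p.adj x m.castSucc = p.U m (p.best m.castSucc x) (p.best m.succ x)
      (Ring.inverse (p.H m (p.best m.castSucc x) (p.best m.succ x)) (p.adj x m.succ)) := by
      simp only [adj, Fin.reverseInduction_castSucc]
    rw [e] at hv'
    simp only [neg_apply, ContinuousLinearMap.comp_apply, inner_neg_right]
    rw [← h.inverse_symm, ContinuousLinearMap.adjoint_inner_right, hv', Fin.val_succ, pow_succ]
    simp

theorem hasGradientAt_F (h : p.Regular Λ κ L) (x) :
    HasGradientAt p.F (p.f₁ x (p.best (Fin.last M) x) + (-1 : ℝ) ^ M • p.adj x 0) x := by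
  obtain ⟨J, hJ, hv⟩ := h.hasFDerivAt_best x (Fin.last M)
  have hf : HasFDerivAt (fun q : Vec (d 0) × Vec (d (Fin.last M)) => p.fAvg q.1 q.2) _
      (x, p.best (Fin.last M) x) :=
    (HasFDerivAt.fun_sum (u := Finset.univ) fun k (_ : k ∈ Finset.univ) =>
      (h.f_diff k (x, p.best (Fin.last M) x)).hasFDerivAt).const_smul ((K : ℝ)⁻¹)
  have hF := HasFDerivAt.comp (f := fun x => (x, p.best (Fin.last M) x)) x hf
    ((hasFDerivAt_id x).prodMk hJ)
  rw [hasGradientAt_iff_hasFDerivAt]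
  refine HasFDerivAt.congr_fderiv (f := p.F) hF (ContinuousLinearMap.ext fun v => ?_)
  have e : p.adj x (Fin.last M) = p.f₂ x (p.best (Fin.last M) x) := by
    simp only [adj, Fin.reverseInduction_last]
  have hv' := hv v
  rw [e, Fin.val_last] at hv'
  simp only [InnerProductSpace.toDual_apply_apply, inner_add_left, inner_smul_left,
    RCLike.conj_to_real, ← hv', ContinuousLinearMap.comp_apply, smul_apply, sum_apply,
    ContinuousLinearMap.prod_apply, ContinuousLinearMap.id_apply, fderiv_eq_grad (h.f_diff _),
    Finset.sum_add_distrib, f₁, f₂, avg, sum_inner, smul_eq_mul, mul_add]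

theorem differentiable_F (h : p.Regular Λ κ L) : Differentiable ℝ p.F := fun x =>
  (h.hasGradientAt_F x).differentiableAt

theorem gradient_F (h : p.Regular Λ κ L) (x) :
    gradient p.F x = p.f₁ x (p.best (Fin.last M) x) + (-1 : ℝ) ^ M • p.adj x 0 :=
  (h.hasGradientAt_F x).gradient

end Problem.Regular

end DSMO

end

noncomputable section

namespace DSMO

/-! ### Smoothness of the overall objective -/

section Smoothness

variable {M : ℕ} (d : Fin (M + 1) → ℕ) {Λ κ : ℝ}

/-- The constant is chosen before the number of agents and the problem, so it depends only on `d`,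
`Λ`, `κ` and the level. The existence statements below have the same form for the same reason. -/
theorem exists_adj_bound (hΛ : 1 ≤ Λ) (hκ : 0 < κ) (i : Fin (M + 1)) :
    ∃ C, 0 ≤ C ∧ ∀ {K : ℕ} {p : Problem M K d} {L : Fin M → ℝ}, p.Regular Λ κ L →
      ∀ x, ‖p.adj x i‖ ≤ C := by
  induction i using Fin.reverseInduction with
  | last =>
    refine ⟨Λ, by linarith, fun h x => ?_⟩
    simp only [Problem.adj, Fin.reverseInduction_last]
    exact h.f₂_bound _ _
  | cast m ih =>
    obtain ⟨C, hC, hb⟩ := ih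
    refine ⟨Λ * (Λ / κ * C), by positivity, fun {K p L} h x => ?_⟩
    have := hb h x
    simp only [Problem.adj, Fin.reverseInduction_castSucc] at this ⊢
    refine (ContinuousLinearMap.le_of_opNorm_le _ (h.U_bound m _ _) _).trans ?_
    gcongr
    refine (h.inverse_bound m _ _ _).trans ?_
    gcongr

/-- The difference of the products `U H⁻¹ w` is telescoped in its three factors, each of which is
bounded and Lipschitz along the best responses. -/
theorem exists_adj_lip (hΛ : 1 ≤ Λ) (hκ : 0 < κ) (i : Fin (M + 1)) :
    ∃ C, 0 ≤ C ∧ ∀ {K : ℕ} {p : Problem M K d} {L : Fin M → ℝ}, p.Regular Λ κ L →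
      ∀ x x', ‖p.adj x i - p.adj x' i‖ ≤ C * ‖x - x'‖ := by
  induction i using Fin.reverseInduction with
  | last =>
    refine ⟨Λ * (1 + κ⁻¹ ^ M), by positivity, fun h x x' => ?_⟩
    simp only [Problem.adj, Fin.reverseInduction_last]
    refine (h.f₂_lip _ _ _ _).trans ?_
    rw [mul_assoc, add_mul, one_mul]
    gcongr
    exact h.best_lip _ _ _
  | cast m ih =>
    obtain ⟨C, hC, hb⟩ := ih
    obtain ⟨B, hB, hbd⟩ := exists_adj_bound d hΛ hκ m.succ
    refine ⟨Λ * (2 * κ⁻¹ ^ M) * (Λ / κ * B)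
      + Λ * (Λ / κ * (Λ * (2 * κ⁻¹ ^ M) * (Λ / κ * B))) + Λ * (Λ / κ * C), by positivity,
      fun {K p L} h x x' => ?_⟩
    have h1 := hb h x x'
    have h2 := hbd h x
    simp only [Problem.adj, Fin.reverseInduction_castSucc] at h1 h2 ⊢
    set w := Fin.reverseInduction (motive := fun i => Vec (d i)) _ _ m.succ with hw
    set w' := Fin.reverseInduction (motive := fun i => Vec (d i))
      (p.f₂ x' (p.best (Fin.last M) x')) _ m.succ with hw'
    set a := p.best m.castSucc x
    set a' := p.best m.castSucc x'
    set y := p.best m.succ x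
    set y' := p.best m.succ x'
    have hd : ‖a - a'‖ + ‖y - y'‖ ≤ 2 * κ⁻¹ ^ M * ‖x - x'‖ := by
      have e1 := h.best_lip m.castSucc x x'
      have e2 := h.best_lip m.succ x x'
      linarith
    have e : p.U m a y (Ring.inverse (p.H m a y) w) - p.U m a' y' (Ring.inverse (p.H m a' y') w')
        = (p.U m a y - p.U m a' y') (Ring.inverse (p.H m a y) w)
          + p.U m a' y' (Ring.inverse (p.H m a y) w - Ring.inverse (p.H m a' y') w)
          + p.U m a' y' (Ring.inverse (p.H m a' y') (w - w')) := by
      simp only [sub_apply, map_sub]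
      abel
    rw [e]
    have b1 : ‖(p.U m a y - p.U m a' y') (Ring.inverse (p.H m a y) w)‖
        ≤ Λ * (2 * κ⁻¹ ^ M * ‖x - x'‖) * (Λ / κ * B) := by
      refine (ContinuousLinearMap.le_opNorm _ _).trans ?_
      have e1 := (h.U_lip m a a' y y').trans (mul_le_mul_of_nonneg_left hd h.Λ_pos.le)
      have e2 : ‖Ring.inverse (p.H m a y) w‖ ≤ Λ / κ * B :=
        (h.inverse_bound m a y w).trans (by gcongr)
      gcongr
    have b2 : ‖p.U m a' y' (Ring.inverse (p.H m a y) w - Ring.inverse (p.H m a' y') w)‖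
        ≤ Λ * (Λ / κ * (Λ * (2 * κ⁻¹ ^ M * ‖x - x'‖) * (Λ / κ * B))) := by
      refine (ContinuousLinearMap.le_of_opNorm_le _ (h.U_bound m a' y') _).trans ?_
      gcongr
      refine (h.inverse_lip m a a' y y' w).trans ?_
      gcongr
    have b3 : ‖p.U m a' y' (Ring.inverse (p.H m a' y') (w - w'))‖
        ≤ Λ * (Λ / κ * (C * ‖x - x'‖)) := by
      refine (ContinuousLinearMap.le_of_opNorm_le _ (h.U_bound m a' y') _).trans ?_
      gcongr
      refine (h.inverse_bound m a' y' _).trans ?_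
      gcongr
    refine (norm_add₃_le).trans ((add_le_add (add_le_add b1 b2) b3).trans (le_of_eq ?_))
    ring

theorem exists_gradient_bound (hΛ : 1 ≤ Λ) (hκ : 0 < κ) :
    ∃ C, 1 ≤ C ∧ ∀ {K : ℕ} {p : Problem M K d} {L : Fin M → ℝ}, p.Regular Λ κ L →
      (∀ x, ‖gradient p.F x‖ ≤ C) ∧
        ∀ x x', ‖gradient p.F x - gradient p.F x'‖ ≤ C * ‖x - x'‖ := by
  obtain ⟨B, hB, hb⟩ := exists_adj_bound d hΛ hκ 0
  obtain ⟨C, hC, hl⟩ := exists_adj_lip d hΛ hκ 0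
  have hone : ‖(-1 : ℝ) ^ M‖ = 1 := by simp
  have hQ : 0 ≤ κ⁻¹ ^ M := by positivity
  refine ⟨Λ + B + C + Λ * (1 + κ⁻¹ ^ M), by nlinarith, fun {K p L} h => ⟨fun x => ?_, fun x x' => ?_⟩⟩
  · rw [h.gradient_F]
    refine (norm_add_le _ _).trans ?_
    rw [norm_smul, hone, one_mul]
    have := h.f₁_bound x (p.best (Fin.last M) x)
    have := hb h x
    have : 0 ≤ Λ * (1 + κ⁻¹ ^ M) := by positivity
    linarith
  · rw [h.gradient_F, h.gradient_F, add_sub_add_comm, ← smul_sub]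
    refine (norm_add_le _ _).trans ?_
    rw [norm_smul, hone, one_mul]
    have e1 := h.f₁_lip x x' (p.best (Fin.last M) x) (p.best (Fin.last M) x')
    have e2 := hl h x x'
    have e3 := mul_le_mul_of_nonneg_left (h.best_lip (Fin.last M) x x') h.Λ_pos.le
    have e4 : 0 ≤ (Λ + B) * ‖x - x'‖ := by positivity
    nlinarith

end Smoothness

/-- The mean value inequality for `F - ⟨∇F x, ·⟩` on the ball about `x` through `y`. It gives the
factor `C` in place of `C / 2`, which suffices. -/
theorem Problem.Regular.descent {M K : ℕ} {d : Fin (M + 1) → ℕ} {p : Problem M K d} {Λ κ : ℝ}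
    {L : Fin M → ℝ} (h : p.Regular Λ κ L) {C : ℝ}
    (hC : ∀ x x', ‖gradient p.F x - gradient p.F x'‖ ≤ C * ‖x - x'‖) (x y : Vec (d 0)) :
    p.F y ≤ p.F x + inner ℝ (gradient p.F x) (y - x) + C * ‖y - x‖ ^ 2 := by
  have hd : ∀ z, HasFDerivAt (fun z => p.F z - InnerProductSpace.toDual ℝ (Vec (d 0)) (gradient p.F x) z)
      (InnerProductSpace.toDual ℝ (Vec (d 0)) (gradient p.F z)
        - InnerProductSpace.toDual ℝ (Vec (d 0)) (gradient p.F x)) z := fun z =>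
    (hasGradientAt_iff_hasFDerivAt.1 (h.differentiable_F z).hasGradientAt).fun_sub
      (ContinuousLinearMap.hasFDerivAt _)
  -- The sign of `C` is not assumed; it follows from the Lipschitz bound as soon as `y ≠ x`.
  by_cases hxy : y = x
  · simp [hxy]
  have hC0 : 0 ≤ C := by
    have := (norm_nonneg _).trans (hC y x)
    exact nonneg_of_mul_nonneg_left this (norm_pos_iff.2 (sub_ne_zero.2 hxy))
  have := (convex_closedBall x ‖y - x‖).norm_image_sub_le_of_norm_hasFDerivWithin_le
    (C := C * ‖y - x‖) (fun z _ => (hd z).hasFDerivWithinAt) (fun z hz => by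
      rw [← map_sub, LinearIsometryEquiv.norm_map]
      refine (hC z x).trans ?_
      rw [Metric.mem_closedBall, dist_eq_norm] at hz
      gcongr) (Metric.mem_closedBall_self (norm_nonneg _))
    (show y ∈ Metric.closedBall x ‖y - x‖ by simp [dist_eq_norm])
  have h2 := (le_abs_self _).trans this
  simp only [InnerProductSpace.toDual_apply_apply] at h2
  rw [inner_sub_right]
  nlinarith

/-! ### Uniform constants -/

/-- The dimension of a Euclidean space that contains the noise of an estimator. -/
def noiseDim {M : ℕ} (d : Fin (M + 1) → ℕ) : Query M → ℕ
  | Query.outer => Module.finrank ℝ (Vec (d (Fin.last M)))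
  | Query.inner m => Module.finrank ℝ (Vec (d m.succ) →L[ℝ] Vec (d m.castSucc))
  | Query.hess m _ => Module.finrank ℝ (Vec (d m.succ) →L[ℝ] Vec (d m.succ))

/-- The norms of the identification of `E` with a Euclidean space are at most `Λ`. -/
structure EuclBound (E : Type*) [NormedAddCommGroup E] [NormedSpace ℝ E] [FiniteDimensional ℝ E]
    (Λ : ℝ) : Prop where
  to_le : ‖toEucl E‖ ≤ Λ
  of_le : ‖ofEucl E‖ ≤ Λ

theorem EuclBound.const_le {E : Type*} [NormedAddCommGroup E] [NormedSpace ℝ E]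
    [FiniteDimensional ℝ E] {Λ : ℝ} (h : EuclBound E Λ) : euclConst E ≤ Λ ^ 4 := by
  have h1 := pow_le_pow_left₀ (norm_nonneg _) h.to_le 2
  have h2 := pow_le_pow_left₀ (norm_nonneg _) h.of_le 2
  calc euclConst E ≤ Λ ^ 2 * Λ ^ 2 := by
        rw [euclConst]
        gcongr
    _ = Λ ^ 4 := by ring

/-- Two numbers that bound all constants of a problem class. -/
structure Constants.Uniform {M : ℕ} (c : Constants M) (d : Fin (M + 1) → ℕ) (Λ κ : ℝ) : Prop where
  one_le : 1 ≤ Λ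
  κ_pos : 0 < κ
  κ_le_one : κ ≤ 1
  Cf_le : c.Cf ≤ Λ
  Lf_le : c.Lf ≤ Λ
  Cg_le : ∀ m, c.Cg m ≤ Λ
  Lg_le : ∀ m, c.Lg m ≤ Λ
  Lg_inv_le : ∀ m, (c.Lg m)⁻¹ ≤ Λ
  Lg'_le : ∀ m, c.Lg' m ≤ Λ
  μ_le : ∀ m, c.μ m ≤ Λ
  κ_le : ∀ m, κ ≤ c.κ m
  D_le : c.D ≤ Λ
  Δ_le : c.Δ ≤ Λ
  eucl_vec : ∀ i, EuclBound (Vec (d i)) Λ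
  eucl_mixed : ∀ m : Fin M, EuclBound (Vec (d m.succ) →L[ℝ] Vec (d m.castSucc)) Λ
  eucl_end : ∀ m : Fin M, EuclBound (Vec (d m.succ) →L[ℝ] Vec (d m.succ)) Λ

theorem eventually_euclBound (E : Type*) [NormedAddCommGroup E] [NormedSpace ℝ E]
    [FiniteDimensional ℝ E] : ∀ᶠ Λ in Filter.atTop, EuclBound E Λ := by
  filter_upwards [Filter.eventually_ge_atTop ‖toEucl E‖, Filter.eventually_ge_atTop ‖ofEucl E‖]
    with Λ h1 h2 using ⟨h1, h2⟩

/-- Finitely many conditions, each true for all small `κ > 0` or for all large `Λ`. -/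
theorem Constants.Valid.exists_uniform {M : ℕ} {c : Constants M} (hc : c.Valid)
    (d : Fin (M + 1) → ℕ) : ∃ Λ κ, c.Uniform d Λ κ := by
  have hκ : ∀ᶠ κ in nhdsWithin (0 : ℝ) (Set.Ioi 0), 0 < κ ∧ κ ≤ 1 ∧ ∀ m, κ ≤ c.κ m := by
    refine (eventually_mem_nhdsWithin).and (Filter.Eventually.and ?_ (Filter.eventually_all.2
      fun m => ?_))
    · exact nhdsWithin_le_nhds ((eventually_lt_nhds one_pos).mono fun _ h => h.le)
    · exact nhdsWithin_le_nhds ((eventually_lt_nhds (hc.κ_pos m)).mono fun _ h => h.le)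
  obtain ⟨κ, h1, h2, h3⟩ := hκ.exists
  have ge := fun a : ℝ => Filter.eventually_ge_atTop a
  have ge' := fun a : Fin M → ℝ => Filter.eventually_all.2 fun m => Filter.eventually_ge_atTop (a m)
  have hΛ : ∀ᶠ Λ in Filter.atTop, c.Uniform d Λ κ := by
    filter_upwards [ge 1, ge c.Cf, ge c.Lf, ge' c.Cg, ge' c.Lg, ge' fun m => (c.Lg m)⁻¹, ge' c.Lg',
      ge' c.μ, ge c.D, ge c.Δ, Filter.eventually_all.2 fun i => eventually_euclBound (Vec (d i)),
      Filter.eventually_all.2 fun m : Fin M =>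
        eventually_euclBound (Vec (d m.succ) →L[ℝ] Vec (d m.castSucc)),
      Filter.eventually_all.2 fun m : Fin M =>
        eventually_euclBound (Vec (d m.succ) →L[ℝ] Vec (d m.succ))]
      with Λ e1 e2 e3 e4 e5 e6 e7 e8 e9 e10 e11 e12 e13
    exact ⟨e1, h1, h2, e2, e3, e4, e5, e6, e7, e8, h3, e9, e10, e11, e12, e13⟩
  obtain ⟨Λ, h⟩ := hΛ.exists
  exact ⟨Λ, κ, h⟩

/-- An exact derivative is the mean of its samples, so it inherits their second moment bounds; in
particular the exact Hessian inherits the contraction property. -/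
theorem Constants.Uniform.regular {M K : ℕ} {d : Fin (M + 1) → ℕ} {c : Constants M} {Λ κ : ℝ}
    (hu : c.Uniform d Λ κ) (hc : c.Valid) (hK : 1 ≤ K) {S : Type*} [MeasurableSpace S]
    {p : Problem M K d} {O : Oracle M K d S} (hO : O.Unbiased p) (hf : OuterAssumptions c p O)
    (hg : InnerAssumptions c p O) : p.Regular Λ κ c.Lg := by
  have probF := hO.probF
  have probG := hO.probG
  have hmul : ∀ {n p : ℕ} {C : ℝ}, C ≤ Λ → ∀ {a a' : Vec n} {y y' : Vec p} {z : ℝ},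
      z ≤ C * (‖a - a'‖ + ‖y - y'‖) → z ≤ Λ * (‖a - a'‖ + ‖y - y'‖) := fun h _ _ _ _ _ hz =>
    hz.trans (by gcongr)
  refine
    { K_pos := hK
      one_le := hu.one_le
      κ_pos := hu.κ_pos
      κ_le_one := hu.κ_le_one
      L_pos := hc.Lg_pos
      L_le := hu.Lg_le
      L_inv_le := hu.Lg_inv_le
      f_diff := hf.diff
      f_bound₁ := fun k x y => ?_
      f_bound₂ := fun k x y => ?_
      f_lip₁ := fun k x x' y y' => hmul hu.Lf_le (hf.lip₁ k x x' y y')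
      f_lip₂ := fun k x x' y y' => hmul hu.Lf_le (hf.lip₂ k x x' y y')
      g_contDiff := hg.contDiff
      g_convex := fun m a => ((hg.strongConvex m a).strictConvexOn (hc.μ_pos m)).convexOn
      g_lip := hg.lip₂
      bound₁₂ := fun k m a y => ?_
      contraction := fun k m a y => ?_
      lip₁₂ := fun k m a a' y y' =>
        hmul (hu.Lg'_le m) ((norm_le_frob _).trans (hg.lip₁₂ k m a a' y y'))
      lip₂₂ := fun k m a a' y y' =>
        hmul (hu.Lg'_le m) ((norm_le_frob _).trans (hg.lip₂₂ k m a a' y y')) }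
  · rw [← (hO.int_f₁ k x y).2]
    exact ((hf.moment₁ k x y).norm_integral_le hc.Cf_pos.le).trans hu.Cf_le
  · rw [← (hO.int_f₂ k x y).2]
    exact ((hf.moment₂ k x y).norm_integral_le hc.Cf_pos.le).trans hu.Cf_le
  · rw [← (hO.int_g₁₂ k m a y).2]
    exact ((hg.moment₁₂ k m a y).norm_integral_le (hc.Lg_pos m).le).trans (hu.Lg_le m)
  · have h1 := (hg.contraction k m a y).norm_integral_le (sub_nonneg.2 (hc.κ_lt_one m).le)
    have hi : Integrable (fun s => (c.Lg m)⁻¹ • O.g₂₂ k m a y s) (O.lawG k m) :=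
      Integrable.smul (f := O.g₂₂ k m a y) (c.Lg m)⁻¹ (hO.int_g₂₂ k m a y).1
    rw [integral_sub (integrable_const _) hi, integral_smul,
      (hO.int_g₂₂ k m a y).2] at h1
    simp only [integral_const, probReal_univ, one_smul] at h1
    linarith [hu.κ_le m]

end DSMO

end

noncomputable section

namespace DSMO

/-! ### Second moments about the mean -/

/-- The mean is the best constant approximation in mean square. It is used with `c = 0` for raw
second moments, and with `c` the averaged gradient, about which the moments of the sampled inner
gradients are assumed. -/
theorem integral_norm_sub_mean_sq_le {S H : Type*} [MeasurableSpace S] [NormedAddCommGroup H]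
    [InnerProductSpace ℝ H] [CompleteSpace H] {ν : Measure S} [IsProbabilityMeasure ν] {X : S → H}
    (h : MemLp X 2 ν) (c : H) : ∫ s, ‖X s - ∫ z, X z ∂ν‖ ^ 2 ∂ν ≤ ∫ s, ‖X s - c‖ ^ 2 ∂ν := by
  have hi : Integrable X ν := h.integrable (by norm_num)
  set m := ∫ z, X z ∂ν with hm
  have hsq : Integrable (fun s => ‖X s - m‖ ^ 2) ν :=
    (h.sub (memLp_const m)).integrable_norm_pow (by norm_num)
  have hin : Integrable (fun s => inner ℝ (m - c) (X s - m)) ν :=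
    (hi.sub (integrable_const m)).const_inner _
  have e : ∀ s, ‖X s - c‖ ^ 2 = ‖X s - m‖ ^ 2 + 2 * inner ℝ (m - c) (X s - m) + ‖m - c‖ ^ 2 := by
    intro s
    have : X s - c = (X s - m) + (m - c) := by abel
    rw [this, norm_add_sq_real, real_inner_comm]
  have h0 : ∫ s, inner ℝ (m - c) (X s - m) ∂ν = 0 := by
    have hz : Integrable (fun s => X s - m) ν := hi.sub (integrable_const m)
    rw [integral_inner hz, integral_sub hi (integrable_const m)]
    simp [hm]
  simp_rw [e]
  have h1 : Integrable (fun s => ‖X s - m‖ ^ 2 + 2 * inner ℝ (m - c) (X s - m)) ν :=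
    hsq.add (hin.const_mul 2)
  rw [integral_add h1 (integrable_const _), integral_add hsq (hin.const_mul 2),
    integral_const_mul, h0]
  simp

/-- Orthogonality arguments need an inner product, which the operator norm does not provide; the
centred samples are therefore moved to a Euclidean space. The level `Λ²` comes from the norm of
`toEucl` times the moment bound. -/
theorem SecondMomentLE.toEucl_sub_mean {S E : Type*} [MeasurableSpace S] [NormedAddCommGroup E]
    [NormedSpace ℝ E] [FiniteDimensional ℝ E] {ν : Measure S} [IsProbabilityMeasure ν]
    {X : S → E} {r Λ : ℝ} (hX : SecondMomentLE ν X r) (hr0 : 0 ≤ r) (hr : r ≤ Λ)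
    (hE : EuclBound E Λ) {m : E} (hm : ∫ s, X s ∂ν = m) :
    MemLp (fun s => toEucl E (X s - m)) 2 ν ∧ ∫ s, toEucl E (X s - m) ∂ν = 0 ∧
      ∫ s, ‖toEucl E (X s - m)‖ ^ 2 ∂ν ≤ (Λ ^ 2) ^ 2 := by
  have : CompleteSpace E := FiniteDimensional.complete ℝ E
  have hi : Integrable X ν := hX.1.integrable (by norm_num)
  have hL : MemLp (fun s => toEucl E (X s)) 2 ν := (toEucl E).comp_memLp' hX.1
  have hint : ∫ s, toEucl E (X s) ∂ν = toEucl E m := by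
    rw [(toEucl E).integral_comp_comm hi, hm]
  have hc := hL.integrable (by norm_num)
  simp only [map_sub]
  refine ⟨hL.sub (memLp_const _), ?_, ?_⟩
  · rw [integral_sub hc (integrable_const _), hint]
    simp
  · have h1 := integral_norm_sub_mean_sq_le hL 0
    rw [hint] at h1
    simp only [sub_zero] at h1
    have h2 : ∫ s, ‖toEucl E (X s)‖ ^ 2 ∂ν ≤ ∫ s, Λ ^ 2 * ‖X s‖ ^ 2 ∂ν := by
      refine integral_mono (hL.integrable_norm_pow (by norm_num))
        ((hX.1.integrable_norm_pow (by norm_num)).const_mul _) fun s => ?_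
      simp only
      rw [← mul_pow]
      exact pow_le_pow_left₀ (norm_nonneg _)
        (ContinuousLinearMap.le_of_opNorm_le _ hE.to_le _) 2
    rw [integral_const_mul] at h2
    have h3 : r ^ 2 ≤ Λ ^ 2 := pow_le_pow_left₀ hr0 hr 2
    calc _ ≤ Λ ^ 2 * ∫ s, ‖X s‖ ^ 2 ∂ν := h1.trans h2
      _ ≤ Λ ^ 2 * Λ ^ 2 := by gcongr; exact hX.2.trans h3
      _ = _ := by ring

/-! ### Decomposition of the estimators -/

/-- Linearity of the recursion. The difference of the inputs makes a detour through Euclidean space,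
and the initial value stays with the part driven by `g`. -/
theorem ema_split {K : ℕ} {β : ℝ} {W : Matrix (Fin K) (Fin K) ℝ} {E : Type*}
    [NormedAddCommGroup E] [NormedSpace ℝ E] [FiniteDimensional ℝ E] (init : E)
    (f g : ℕ → Fin K → E) (t : ℕ) (k : Fin K) :
    ema β W init f t k = ema β W init g t k
      + ofEucl E (ema β W 0 (fun t k => toEucl E (f t k - g t k)) t k) := by
  have h1 := ema_map (β := β) (W := W) (ofEucl E).toLinearMap 0
    (fun t k => toEucl E (f t k - g t k)) t k
  simp only [ContinuousLinearMap.coe_coe, ofEucl_toEucl, map_zero] at h1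
  rw [h1, ← ema_add]
  simp

section Run

variable {M K : ℕ} {d : Fin (M + 1) → ℕ} {S : Type*} [MeasurableSpace S]
  (θ : Params M) (W : Matrix (Fin K) (Fin K) ℝ) (p : Problem M K d) (O : Oracle M K d S)
  (σ : ℕ → Fin K → Query M → S)

theorem run_s (t : ℕ) (k : Fin K) : (run θ W O σ t k).s = ema θ.β W 0 (fun t k =>
    O.f₁ k ((run θ W O σ t k).pt 0) ((run θ W O σ t k).pt (Fin.last M)) (σ t k Query.outer)) t k := by
  induction t generalizing k with
  | zero => rfl
  | succ t ih => simp only [run, step, ema, ih]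

theorem run_h (t : ℕ) (k : Fin K) : (run θ W O σ t k).h = ema θ.β W 0 (fun t k =>
    O.f₂ k ((run θ W O σ t k).pt 0) ((run θ W O σ t k).pt (Fin.last M)) (σ t k Query.outer)) t k := by
  induction t generalizing k with
  | zero => rfl
  | succ t ih => simp only [run, step, ema, ih]

theorem run_u (m : Fin M) (t : ℕ) (k : Fin K) : (run θ W O σ t k).u m = ema θ.β W 0 (fun t k =>
    O.g₁₂ k m ((run θ W O σ t k).pt m.castSucc) ((run θ W O σ t k).pt m.succ)
      (σ t k (Query.inner m))) t k := by
  induction t generalizing k with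
  | zero => rfl
  | succ t ih => simp only [run, step, ema, ih]

theorem run_v (m : Fin M) (i t : ℕ) (k : Fin K) : (run θ W O σ t k).v m i =
    ema θ.β W (θ.μ m • ContinuousLinearMap.id ℝ (Vec (d m.succ))) (fun t k =>
      O.g₂₂ k m ((run θ W O σ t k).pt m.castSucc) ((run θ W O σ t k).pt m.succ)
        (σ t k (Query.hess m i))) t k := by
  induction t generalizing k with
  | zero => rfl
  | succ t ih => simp only [run, step, ema, ih]

/-- The vectors `u_{i+1} q_{i+1} ⋯ u_M q_M h`, where `q_m` is the truncated Neumann series. -/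
def chainAt (L : Fin M → ℝ) (b : Fin M → ℕ) (h : Vec (d (Fin.last M)))
    (u : (m : Fin M) → (Vec (d m.succ) →L[ℝ] Vec (d m.castSucc)))
    (v : (m : Fin M) → ℕ → (Vec (d m.succ) →L[ℝ] Vec (d m.succ))) (i : Fin (M + 1)) : Vec (d i) :=
  Fin.reverseInduction (motive := fun i => Vec (d i)) h
    (fun m w => u m ((L m)⁻¹ • neumann (L m) (v m) (b m) w)) i

theorem chainAt_last (L : Fin M → ℝ) (b : Fin M → ℕ) (h : Vec (d (Fin.last M)))
    (u : (m : Fin M) → (Vec (d m.succ) →L[ℝ] Vec (d m.castSucc)))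
    (v : (m : Fin M) → ℕ → (Vec (d m.succ) →L[ℝ] Vec (d m.succ))) :
    chainAt L b h u v (Fin.last M) = h := by
  simp only [chainAt, Fin.reverseInduction_last]

theorem chainAt_castSucc (L : Fin M → ℝ) (b : Fin M → ℕ) (h : Vec (d (Fin.last M)))
    (u : (m : Fin M) → (Vec (d m.succ) →L[ℝ] Vec (d m.castSucc)))
    (v : (m : Fin M) → ℕ → (Vec (d m.succ) →L[ℝ] Vec (d m.succ))) (m : Fin M) :
    chainAt L b h u v m.castSucc
      = u m ((L m)⁻¹ • neumann (L m) (v m) (b m) (chainAt L b h u v m.succ)) := by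
  simp only [chainAt, Fin.reverseInduction_castSucc]

theorem run_chain (t : ℕ) (k : Fin K) : (run θ W O σ t k).chain =
    chainAt θ.L θ.b (run θ W O σ t k).h (run θ W O σ t k).u (run θ W O σ t k).v 0 := by
  cases t with
  | zero =>
    -- Initially the stored `q = 0` is not the truncated Neumann series of `v`. The two chains agree
    -- nevertheless, because `h = 0` annihilates both.
    have h1 : ∀ (A : AgentState M d) (i : Fin (M + 1)), A.h = 0 →
        Fin.reverseInduction (motive := fun i => Vec (d i)) A.h (fun m w => A.u m (A.q m w)) i = 0 ∧
        chainAt θ.L θ.b A.h A.u A.v i = 0 := by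
      intro A i hA
      induction i using Fin.reverseInduction with
      | last => simp [chainAt_last, hA]
      | cast m ih => simp [chainAt_castSucc, ih.1, ih.2]
    have h2 := h1 (initState d θ) 0 rfl
    exact h2.1.trans h2.2.symm
  | succ t => rfl

/-- The noise functions of the estimators that enter the hypergradient through the chain. -/
def chainNoise : (q : Query M) → Fin K → (∀ i, Vec (d i)) → S →
    EuclideanSpace ℝ (Fin (noiseDim d q))
  | Query.outer => fun k x s =>
      toEucl _ (O.f₂ k (x 0) (x (Fin.last M)) s - grad₂ (p.f k) (x 0) (x (Fin.last M)))
  | Query.inner m => fun k x s =>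
      toEucl _ (O.g₁₂ k m (x m.castSucc) (x m.succ) s - hess₁₂ (p.g k m) (x m.castSucc) (x m.succ))
  | Query.hess m _ => fun k x s =>
      toEucl _ (O.g₂₂ k m (x m.castSucc) (x m.succ) s - hess₂₂ (p.g k m) (x m.castSucc) (x m.succ))

/-- The noise function of the estimator `s`. -/
def outerNoise : (q : Query M) → Fin K → (∀ i, Vec (d i)) → S →
    EuclideanSpace ℝ (Fin (Module.finrank ℝ (Vec (d 0))))
  | Query.outer => fun k x s =>
      toEucl _ (O.f₁ k (x 0) (x (Fin.last M)) s - grad₁ (p.f k) (x 0) (x (Fin.last M)))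
  | _ => fun _ _ _ => 0

/-- The exponentially forgetting average of the exact `∇₁ f` at the points of the agents. -/
def smoothS (t : ℕ) (k : Fin K) : Vec (d 0) :=
  ema θ.β W 0 (fun t k => grad₁ (p.f k) ((run θ W O σ t k).pt 0)
    ((run θ W O σ t k).pt (Fin.last M))) t k

/-- The exponentially forgetting average of the exact `∇₂ f` at the points of the agents. -/
def smoothH (t : ℕ) (k : Fin K) : Vec (d (Fin.last M)) :=
  ema θ.β W 0 (fun t k => grad₂ (p.f k) ((run θ W O σ t k).pt 0)
    ((run θ W O σ t k).pt (Fin.last M))) t k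

/-- The exponentially forgetting average of the exact `∇²₁₂ g` at the points of the agents. -/
def smoothU (m : Fin M) (t : ℕ) (k : Fin K) : Vec (d m.succ) →L[ℝ] Vec (d m.castSucc) :=
  ema θ.β W 0 (fun t k => hess₁₂ (p.g k m) ((run θ W O σ t k).pt m.castSucc)
    ((run θ W O σ t k).pt m.succ)) t k

/-- The exponentially forgetting average of the exact `∇²₂₂ g` at the points of the agents. -/
def smoothV (m : Fin M) (t : ℕ) (k : Fin K) : Vec (d m.succ) →L[ℝ] Vec (d m.succ) :=
  ema θ.β W (θ.μ m • ContinuousLinearMap.id ℝ (Vec (d m.succ)))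
    (fun t k => hess₂₂ (p.g k m) ((run θ W O σ t k).pt m.castSucc)
      ((run θ W O σ t k).pt m.succ)) t k

variable {Ω : Type*} (ξ : ℕ → Fin K → Query M → Ω → S)

/-- The samples as a family with a single index. -/
def flat (i : ℕ × Fin K × Query M) : Ω → S := ξ i.1 i.2.1 i.2.2

/-- The points of the agents as random variables. -/
def points (t : ℕ) (k : Fin K) (ω : Ω) : ∀ i, Vec (d i) :=
  (run θ W O (fun r k q => ξ r k q ω) t k).pt

theorem run_s_split (t : ℕ) (k : Fin K) (ω : Ω) :
    (run θ W O (fun r k q => ξ r k q ω) t k).s = smoothS θ W p O (fun r k q => ξ r k q ω) t k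
      + ofEucl _ (noise θ.β W (flat ξ) (outerNoise p O) (points θ W O ξ) Query.outer t k ω) := by
  rw [run_s, ema_split]
  rfl

theorem run_h_split (t : ℕ) (k : Fin K) (ω : Ω) :
    (run θ W O (fun r k q => ξ r k q ω) t k).h = smoothH θ W p O (fun r k q => ξ r k q ω) t k
      + ofEucl _ (noise θ.β W (flat ξ) (chainNoise p O) (points θ W O ξ) Query.outer t k ω) := by
  rw [run_h, ema_split]
  rfl

theorem run_u_split (m : Fin M) (t : ℕ) (k : Fin K) (ω : Ω) :
    (run θ W O (fun r k q => ξ r k q ω) t k).u m = smoothU θ W p O (fun r k q => ξ r k q ω) m t k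
      + ofEucl _ (noise θ.β W (flat ξ) (chainNoise p O) (points θ W O ξ) (Query.inner m) t k ω) := by
  rw [run_u, ema_split]
  rfl

theorem run_v_split (m : Fin M) (i t : ℕ) (k : Fin K) (ω : Ω) :
    (run θ W O (fun r k q => ξ r k q ω) t k).v m i = smoothV θ W p O (fun r k q => ξ r k q ω) m t k
      + ofEucl _ (noise θ.β W (flat ξ) (chainNoise p O) (points θ W O ξ) (Query.hess m i) t k ω) := by
  rw [run_v, ema_split]
  rfl

end Run

/-! ### Measurability of the iterates -/

theorem measurable_clm_apply {Ω E F : Type*} [MeasurableSpace Ω] [NormedAddCommGroup E]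
    [NormedSpace ℝ E] [NormedAddCommGroup F] [NormedSpace ℝ F] [SecondCountableTopology E]
    [MeasurableSpace E] [BorelSpace E] [MeasurableSpace F] [BorelSpace F] {A : Ω → E →L[ℝ] F}
    {w : Ω → E} (hA : Measurable A) (hw : Measurable w) : Measurable fun ω => A ω (w ω) :=
  isBoundedBilinearMap_apply.continuous.measurable.comp (hA.prodMk hw)

theorem measurable_neumann {Ω : Type*} [MeasurableSpace Ω] {n : ℕ} (L : ℝ)
    {v : Ω → ℕ → (Vec n →L[ℝ] Vec n)} (hv : ∀ i, Measurable fun ω => v ω i) {w : Ω → Vec n}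
    (hw : Measurable w) (i : ℕ) : Measurable fun ω => neumann L (v ω) i (w ω) := by
  induction i with
  | zero => exact hw
  | succ i ih =>
    have h1 : Measurable fun ω => v ω i (neumann L (v ω) i (w ω)) := measurable_clm_apply (hv i) ih
    exact hw.add (ih.sub (h1.const_smul L⁻¹))

theorem measurable_chainAt {Ω : Type*} [MeasurableSpace Ω] {M : ℕ} {d : Fin (M + 1) → ℕ}
    (L : Fin M → ℝ) (b : Fin M → ℕ) {h : Ω → Vec (d (Fin.last M))}
    {u : Ω → (m : Fin M) → (Vec (d m.succ) →L[ℝ] Vec (d m.castSucc))}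
    {v : Ω → (m : Fin M) → ℕ → (Vec (d m.succ) →L[ℝ] Vec (d m.succ))} (hh : Measurable h)
    (hu : ∀ m, Measurable fun ω => u ω m) (hv : ∀ m i, Measurable fun ω => v ω m i)
    (i : Fin (M + 1)) : Measurable fun ω => chainAt L b (h ω) (u ω) (v ω) i := by
  induction i using Fin.reverseInduction with
  | last => simpa only [chainAt_last] using hh
  | cast m ih =>
    simp only [chainAt_castSucc]
    exact measurable_clm_apply (hu m)
      (Measurable.fun_const_smul (measurable_neumann _ (hv m) ih _) _)

/-- All variables of the agents that determine the further course are measurable. -/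
structure MeasurableState {Ω : Type*} [MeasurableSpace Ω] {M K : ℕ} {d : Fin (M + 1) → ℕ}
    (A : Ω → Fin K → AgentState M d) : Prop where
  pt : ∀ k i, Measurable fun ω => (A ω k).pt i
  s : ∀ k, Measurable fun ω => (A ω k).s
  h : ∀ k, Measurable fun ω => (A ω k).h
  u : ∀ k m, Measurable fun ω => (A ω k).u m
  v : ∀ k m i, Measurable fun ω => (A ω k).v m i
  chain : ∀ k, Measurable fun ω => (A ω k).chain

theorem measurable_mix {Ω E : Type*} [MeasurableSpace Ω] [NormedAddCommGroup E]
    [NormedSpace ℝ E] [FiniteDimensional ℝ E] [MeasurableSpace E] [BorelSpace E] {K : ℕ}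
    (a b : ℝ) (w : Fin K → ℝ) {X : Fin K → Ω → E} (hX : ∀ k, Measurable (X k)) {Y : Ω → E}
    (hY : Measurable Y) : Measurable fun ω => a • ∑ k, w k • X k ω + b • Y ω := by
  have := FiniteDimensional.proper ℝ E
  have h1 : Measurable fun ω => ∑ k, w k • X k ω :=
    Finset.measurable_fun_sum _ fun k _ => (hX k).const_smul _
  exact (h1.const_smul a).add (hY.const_smul b)

/-- The σ-algebra on `Ω` is arbitrary and only the samples before `t` are assumed measurable. The
statement can thus be used with the σ-algebra of the past, which yields adaptedness of the points.
-/
theorem measurableState_run {Ω : Type*} [MeasurableSpace Ω] {M K : ℕ} {d : Fin (M + 1) → ℕ}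
    {S : Type*} [MeasurableSpace S] {p : Problem M K d} {O : Oracle M K d S} (hO : O.Unbiased p)
    (θ : Params M) (W : Matrix (Fin K) (Fin K) ℝ) (ξ : ℕ → Fin K → Query M → Ω → S) (t : ℕ)
    (hξ : ∀ s < t, ∀ k q, Measurable (ξ s k q)) :
    MeasurableState fun ω => run θ W O (fun r k q => ξ r k q ω) t := by
  induction t with
  | zero =>
    have e : ∀ k, (fun ω : Ω => (run θ W O (fun r k q => ξ r k q ω) 0 k).chain)
        = fun _ => (initState d θ).chain := fun _ => rfl
    exact ⟨fun _ _ => measurable_const, fun _ => measurable_const, fun _ => measurable_const,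
      fun _ _ => measurable_const, fun _ _ _ => measurable_const,
      fun k => by rw [e]; exact measurable_const⟩
  | succ t ih =>
    obtain ⟨hpt, hs, hh, hu, hv, hc⟩ := ih fun s hs => hξ s (hs.trans (Nat.lt_succ_self t))
    have hξt := hξ t (Nat.lt_succ_self t)
    have X : ∀ k i j {Y : Ω → S}, Measurable Y → Measurable fun ω =>
        ((run θ W O (fun r k q => ξ r k q ω) t k).pt i,
          (run θ W O (fun r k q => ξ r k q ω) t k).pt j, Y ω) :=
      fun k i j Y hY => (hpt k i).prodMk ((hpt k j).prodMk hY)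
    have H : ∀ k, Measurable fun ω => (run θ W O (fun r k q => ξ r k q ω) (t + 1) k).h :=
      fun k => measurable_mix (1 - θ.β) θ.β (W k) hh
        ((hO.meas_f₂ k).comp (X k 0 (Fin.last M) (hξt k Query.outer)))
    have U : ∀ k m, Measurable fun ω => (run θ W O (fun r k q => ξ r k q ω) (t + 1) k).u m :=
      fun k m => measurable_mix (1 - θ.β) θ.β (W k) (fun k => hu k m)
        ((hO.meas_g₁₂ k m).comp (X k m.castSucc m.succ (hξt k (Query.inner m))))
    have V : ∀ k m i, Measurable fun ω => (run θ W O (fun r k q => ξ r k q ω) (t + 1) k).v m i :=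
      fun k m i => measurable_mix (1 - θ.β) θ.β (W k) (fun k => hv k m i)
        ((hO.meas_g₂₂ k m).comp (X k m.castSucc m.succ (hξt k (Query.hess m i))))
    refine ⟨fun k i => ?_, fun k => measurable_mix (1 - θ.β) θ.β (W k) hs
        ((hO.meas_f₁ k).comp (X k 0 (Fin.last M) (hξt k Query.outer))), H, U, V, fun k => ?_⟩
    · cases i using Fin.cases with
      | zero =>
        have h1 : Measurable fun ω => (run θ W O (fun r k q => ξ r k q ω) t k).s
            + (-1 : ℝ) ^ M • (run θ W O (fun r k q => ξ r k q ω) t k).chain :=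
          (hs k).add ((hc k).fun_const_smul _)
        have h2 := measurable_mix 1 (-θ.α) (W k) (fun k => hpt k 0) h1
        simp only [one_smul, neg_smul, ← sub_eq_add_neg] at h2
        exact h2
      | succ m =>
        have h2 := measurable_mix 1 (-θ.γ) (W k) (fun k => hpt k m.succ)
          ((hO.meas_g₂ k m).comp (X k m.castSucc m.succ (hξt k (Query.inner m))))
        simp only [one_smul, neg_smul, ← sub_eq_add_neg] at h2
        exact h2
    · simp only [run_chain]
      exact measurable_chainAt _ _ (H k) (U k) (V k) 0

end DSMO

end

noncomputable section

namespace DSMO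

/-! ### Quantities whose products with the noises have controlled means -/

/-- `Z` has mean at most `z`, and its products with the squared noises `n q`, for finitely many
distinct `q` outside of `J`, behave as if these factors were independent with means `x`. -/
structure Dom {Ω Q : Type*} [MeasurableSpace Ω] (P : Measure Ω) (n : Q → Ω → ℝ) (x : ℝ) (J : Set Q)
    (Z : Ω → ℝ) (z : ℝ) : Prop where
  meas : Measurable Z
  nonneg : ∀ ω, 0 ≤ Z ω
  bound : ∀ F : Finset Q, (∀ q ∈ F, q ∉ J) → Integrable (fun ω => Z ω * ∏ q ∈ F, n q ω) P ∧
    ∫ ω, Z ω * ∏ q ∈ F, n q ω ∂P ≤ z * x ^ F.card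

namespace Dom

variable {Ω Q : Type*} [MeasurableSpace Ω] {P : Measure Ω} {n : Q → Ω → ℝ} {x : ℝ} {J J' : Set Q}
  {Z Z' : Ω → ℝ} {z z' : ℝ}

theorem integrable (h : Dom P n x J Z z) : Integrable Z P := by
  simpa using (h.bound ∅ (by simp)).1

theorem integral_le (h : Dom P n x J Z z) : ∫ ω, Z ω ∂P ≤ z := by
  simpa using (h.bound ∅ (by simp)).2

theorem value_nonneg (h : Dom P n x J Z z) : 0 ≤ z :=
  (integral_nonneg h.nonneg).trans h.integral_le

theorem add (h : Dom P n x J Z z) (h' : Dom P n x J Z' z') :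
    Dom P n x J (fun ω => Z ω + Z' ω) (z + z') where
  meas := h.meas.add h'.meas
  nonneg ω := add_nonneg (h.nonneg ω) (h'.nonneg ω)
  bound F hF := by
    obtain ⟨i1, b1⟩ := h.bound F hF
    obtain ⟨i2, b2⟩ := h'.bound F hF
    simp only [add_mul]
    refine ⟨i1.add i2, ?_⟩
    rw [integral_add i1 i2]
    exact add_le_add b1 b2

theorem smul (h : Dom P n x J Z z) {c : ℝ} (hc : 0 ≤ c) :
    Dom P n x J (fun ω => c * Z ω) (c * z) where
  meas := h.meas.const_mul c
  nonneg ω := mul_nonneg hc (h.nonneg ω)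
  bound F hF := by
    obtain ⟨i1, b1⟩ := h.bound F hF
    simp only [mul_assoc]
    refine ⟨i1.const_mul c, ?_⟩
    rw [integral_const_mul]
    gcongr

/-- The product with `q` is an instance of the bound for `insert q F`. Afterwards `q` belongs to
`J'` and cannot be used again. -/
theorem mul_noise (h : Dom P n x J Z z) {q : Q} (hq : q ∉ J) (hqJ : q ∈ J') (hJ : J ⊆ J')
    (hn : Measurable (n q)) (hn0 : ∀ ω, 0 ≤ n q ω) :
    Dom P n x J' (fun ω => n q ω * Z ω) (x * z) where
  meas := hn.mul h.meas
  nonneg ω := mul_nonneg (hn0 ω) (h.nonneg ω)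
  bound F hF := by
    classical
    have hqF : q ∉ F := fun h => hF q h hqJ
    obtain ⟨i1, b1⟩ := h.bound (insert q F) fun r hr => by
      rcases Finset.mem_insert.1 hr with rfl | hr
      · exact hq
      · exact fun h => hF r hr (hJ h)
    have e : ∀ ω, Z ω * ∏ r ∈ insert q F, n r ω = n q ω * Z ω * ∏ r ∈ F, n r ω := fun ω => by
      rw [Finset.prod_insert hqF]; ring
    simp only [e, Finset.card_insert_of_notMem hqF] at i1 b1
    refine ⟨i1, b1.trans (le_of_eq ?_)⟩
    ring

theorem mono (h : Dom P n x J Z z) (hZ' : Measurable Z') (h0 : ∀ ω, 0 ≤ Z' ω)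
    (hle : ∀ ω, Z' ω ≤ Z ω) (hJ : J ⊆ J') (hz : z ≤ z') (hx : 0 ≤ x)
    (hn : ∀ q, Measurable (n q)) (hn0 : ∀ q ω, 0 ≤ n q ω) : Dom P n x J' Z' z' where
  meas := hZ'
  nonneg := h0
  bound F hF := by
    obtain ⟨i1, b1⟩ := h.bound F fun q hq h => hF q hq (hJ h)
    have hp : ∀ ω, 0 ≤ ∏ q ∈ F, n q ω := fun ω => Finset.prod_nonneg fun q _ => hn0 q ω
    have hpt : ∀ ω, Z' ω * ∏ q ∈ F, n q ω ≤ Z ω * ∏ q ∈ F, n q ω := fun ω =>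
      mul_le_mul_of_nonneg_right (hle ω) (hp ω)
    have hi : Integrable (fun ω => Z' ω * ∏ q ∈ F, n q ω) P := by
      refine i1.mono' (hZ'.mul (Finset.measurable_fun_prod _ fun q _ => hn q)).aestronglyMeasurable
        (Filter.Eventually.of_forall fun ω => ?_)
      rw [Real.norm_of_nonneg (mul_nonneg (h0 ω) (hp ω))]
      exact hpt ω
    refine ⟨hi, (integral_mono hi i1 hpt).trans (b1.trans ?_)⟩
    gcongr

end Dom

/-- Convexity of the square with weights `κ/2`, `1 - κ`, `κ/2`. -/
theorem sq_weighted_le {κ : ℝ} (hκ : 0 < κ) (hκ1 : κ ≤ 1) (a b c : ℝ) :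
    (a + (1 - κ) * b + c) ^ 2 ≤ 2 / κ * a ^ 2 + (1 - κ) * b ^ 2 + 2 / κ * c ^ 2 := by
  obtain ⟨A, rfl⟩ : ∃ A, a = κ / 2 * A := ⟨2 / κ * a, by field_simp⟩
  obtain ⟨C, rfl⟩ : ∃ C, c = κ / 2 * C := ⟨2 / κ * c, by field_simp⟩
  have e1 : ∀ X : ℝ, 2 / κ * (κ / 2 * X) ^ 2 = κ / 2 * X ^ 2 := fun X => by field_simp
  rw [e1, e1]
  have h1 : 0 ≤ κ / 2 * (1 - κ) := by have := sub_nonneg.2 hκ1; positivity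
  nlinarith [mul_nonneg h1 (sq_nonneg (A - b)), mul_nonneg h1 (sq_nonneg (C - b)),
    mul_nonneg (sq_nonneg (κ / 2)) (sq_nonneg (A - C))]

section Chain

variable {Ω Q : Type*} [MeasurableSpace Ω] {P : Measure Ω} {n : Q → Ω → ℝ} {x Λ κ : ℝ}

/-- A Neumann step with a noisy operator. -/
theorem Dom.neumann {dim : ℕ} {L : ℝ} {J : Set Q} {e : ℕ → Q} (hn : ∀ q, Measurable (n q))
    (hn0 : ∀ q ω, 0 ≤ n q ω) (hx : 0 ≤ x) (hκ : 0 < κ) (hκ1 : κ ≤ 1) (hL0 : 0 < L)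
    (hL : L⁻¹ ≤ Λ) (hsmall : 2 / κ * (Λ ^ 2 * x) ≤ κ / 2) (he : Function.Injective e)
    (heJ : ∀ i, e i ∉ J) {v : Ω → ℕ → (Vec dim →L[ℝ] Vec dim)} {v' : Ω → (Vec dim →L[ℝ] Vec dim)}
    (hv : ∀ i, Measurable fun ω => v ω i) (hv' : Measurable v')
    (hb : ∀ ω, ‖ContinuousLinearMap.id ℝ (Vec dim) - L⁻¹ • v' ω‖ ≤ 1 - κ)
    (hvn : ∀ ω i, ‖v ω i - v' ω‖ ^ 2 ≤ n (e i) ω) {w w' : Ω → Vec dim} (hw : Measurable w)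
    (hw' : Measurable w') {z y : ℝ} (hz : Dom P n x J (fun ω => ‖w ω‖ ^ 2) z)
    (hy : Dom P n x J (fun ω => ‖w ω - w' ω‖ ^ 2) y) (i : ℕ) :
    Dom P n x (J ∪ e '' Set.Iio i) (fun ω => ‖DSMO.neumann L (v ω) i (w ω)‖ ^ 2) (4 / κ ^ 2 * z) ∧
      Dom P n x (J ∪ e '' Set.Iio i)
        (fun ω => ‖DSMO.neumann L (v ω) i (w ω) - DSMO.neumann L (fun _ => v' ω) i (w' ω)‖ ^ 2)
        (2 / κ ^ 2 * (y + Λ ^ 2 * x * (4 / κ ^ 2 * z))) := by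
  have hz0 := hz.value_nonneg
  have hy0 := hy.value_nonneg
  have hκ2 : (1 : ℝ) ≤ 1 / κ ^ 2 := by
    rw [le_div_iff₀ (by positivity)]
    nlinarith
  induction i with
  | zero =>
    refine ⟨hz.mono (hw.norm.pow_const 2) (fun ω => by positivity) (fun ω => le_rfl)
      Set.subset_union_left ?_ hx hn hn0, hy.mono ((hw.sub hw').norm.pow_const 2)
      (fun ω => by positivity) (fun ω => le_rfl) Set.subset_union_left ?_ hx hn hn0⟩
    · rw [show 4 / κ ^ 2 = 4 * (1 / κ ^ 2) by ring]
      nlinarith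
    · have h0 : 0 ≤ Λ ^ 2 * x * (4 / κ ^ 2 * z) := by positivity
      rw [show 2 / κ ^ 2 = 2 * (1 / κ ^ 2) by ring]
      nlinarith
  | succ i ih =>
    obtain ⟨ih1, ih2⟩ := ih
    have hsub : J ∪ e '' Set.Iio i ⊆ J ∪ e '' Set.Iio (i + 1) :=
      Set.union_subset_union_right _ (Set.image_mono fun j (hj : j < i) => Nat.lt_succ_of_lt hj)
    have hJ : J ⊆ J ∪ e '' Set.Iio (i + 1) := Set.subset_union_left
    -- The first `i` factors do not involve the `i`-th operator, so its squared noise may be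
    -- multiplied with the partial product.
    have hei : e i ∉ J ∪ e '' Set.Iio i := by
      rintro (h | ⟨j, hj, hji⟩)
      · exact heJ i h
      · exact (lt_irrefl i) (he hji ▸ hj)
    have hei' : e i ∈ J ∪ e '' Set.Iio (i + 1) := Or.inr ⟨i, Nat.lt_succ_self i, rfl⟩
    have hmn := ih1.mul_noise hei hei' hsub (hn (e i)) (hn0 (e i))
    have lift : ∀ {J₀ : Set Q} {Z : Ω → ℝ} {z}, J₀ ⊆ J ∪ e '' Set.Iio (i + 1) → Dom P n x J₀ Z z →
        Dom P n x (J ∪ e '' Set.Iio (i + 1)) Z z := fun hJ h =>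
      h.mono h.meas h.nonneg (fun _ => le_rfl) hJ le_rfl hx hn hn0
    have c1 : 0 ≤ 2 / κ := by positivity
    have c2 : 0 ≤ 1 - κ := sub_nonneg.2 hκ1
    have c3 : 0 ≤ 2 / κ * Λ ^ 2 := by positivity
    have key : ∀ ω, (‖v ω i - v' ω‖ * L⁻¹ * ‖DSMO.neumann L (v ω) i (w ω)‖) ^ 2
        ≤ Λ ^ 2 * (n (e i) ω * ‖DSMO.neumann L (v ω) i (w ω)‖ ^ 2) := by
      intro ω
      have h1 := hvn ω i
      have h2 : L⁻¹ ^ 2 ≤ Λ ^ 2 := pow_le_pow_left₀ (by positivity) hL 2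
      calc _ = L⁻¹ ^ 2 * (‖v ω i - v' ω‖ ^ 2 * ‖DSMO.neumann L (v ω) i (w ω)‖ ^ 2) := by ring
        _ ≤ _ := by gcongr
    constructor
    · refine (((lift hJ (hz.smul c1)).add (lift hsub (ih1.smul c2))).add (hmn.smul c3)).mono
        ((measurable_neumann L hv hw (i + 1)).norm.pow_const 2) (fun ω => by positivity)
        (fun ω => ?_) le_rfl ?_ hx hn hn0
      · set p := DSMO.neumann L (v ω) i (w ω)
        have e1 : DSMO.neumann L (v ω) (i + 1) (w ω) = w ω
            + (ContinuousLinearMap.id ℝ (Vec dim) - L⁻¹ • v' ω) p - L⁻¹ • (v ω i - v' ω) p := by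
          simp only [DSMO.neumann, add_apply, sub_apply, smul_apply, ContinuousLinearMap.comp_apply,
            ContinuousLinearMap.id_apply, smul_sub]
          abel
        have h1 : ‖DSMO.neumann L (v ω) (i + 1) (w ω)‖
            ≤ ‖w ω‖ + (1 - κ) * ‖p‖ + ‖v ω i - v' ω‖ * L⁻¹ * ‖p‖ := by
          rw [e1]
          refine (norm_sub_le _ _).trans (add_le_add ((norm_add_le _ _).trans
            (add_le_add le_rfl (ContinuousLinearMap.le_of_opNorm_le _ (hb ω) _))) ?_)
          rw [norm_smul, Real.norm_of_nonneg (by positivity), mul_comm _ L⁻¹, mul_assoc]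
          gcongr
          exact ContinuousLinearMap.le_opNorm _ _
        refine (pow_le_pow_left₀ (norm_nonneg _) h1 2).trans
          ((sq_weighted_le hκ hκ1 _ _ _).trans ?_)
        have := mul_le_mul_of_nonneg_left (key ω) c1
        linarith
      -- The value `4 / κ ^ 2 * z` reproduces itself: the three terms contribute the fractions
      -- `κ/2`, `1 - κ` and, by `hsmall`, at most `κ/2` of it. This makes the bound independent of
      -- the number of factors.
      · have h1 : 2 / κ * z = κ / 2 * (4 / κ ^ 2 * z) := by field_simp; ring
        have h2 := mul_le_mul_of_nonneg_right hsmall (show 0 ≤ 4 / κ ^ 2 * z by positivity)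
        rw [h1]
        linarith
    · refine (((lift hJ (hy.smul c1)).add (lift hsub (ih2.smul c2))).add (hmn.smul c3)).mono
        (((measurable_neumann L hv hw (i + 1)).sub
          (measurable_neumann L (fun _ => hv') hw' (i + 1))).norm.pow_const 2)
        (fun ω => by positivity) (fun ω => ?_) le_rfl ?_ hx hn hn0
      · set p := DSMO.neumann L (v ω) i (w ω)
        set p' := DSMO.neumann L (fun _ => v' ω) i (w' ω)
        have e1 : DSMO.neumann L (v ω) (i + 1) (w ω) - DSMO.neumann L (fun _ => v' ω) (i + 1) (w' ω)
            = (w ω - w' ω) + (ContinuousLinearMap.id ℝ (Vec dim) - L⁻¹ • v' ω) (p - p')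
              - L⁻¹ • (v ω i - v' ω) p := by
          simp only [DSMO.neumann, add_apply, sub_apply, smul_apply, ContinuousLinearMap.comp_apply,
            ContinuousLinearMap.id_apply, smul_sub, map_sub]
          abel
        have h1 : ‖DSMO.neumann L (v ω) (i + 1) (w ω) - DSMO.neumann L (fun _ => v' ω) (i + 1) (w' ω)‖
            ≤ ‖w ω - w' ω‖ + (1 - κ) * ‖p - p'‖ + ‖v ω i - v' ω‖ * L⁻¹ * ‖p‖ := by
          rw [e1]
          refine (norm_sub_le _ _).trans (add_le_add ((norm_add_le _ _).trans
            (add_le_add le_rfl (ContinuousLinearMap.le_of_opNorm_le _ (hb ω) _))) ?_)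
          rw [norm_smul, Real.norm_of_nonneg (by positivity), mul_comm _ L⁻¹, mul_assoc]
          gcongr
          exact ContinuousLinearMap.le_opNorm _ _
        refine (pow_le_pow_left₀ (norm_nonneg _) h1 2).trans
          ((sq_weighted_le hκ hκ1 _ _ _).trans ?_)
        have := mul_le_mul_of_nonneg_left (key ω) c1
        linarith
      -- The bound is the exact fixed point of the affine recursion with factor `1 - κ`.
      · apply le_of_eq
        field_simp
        ring

/-- The samples that enter the chain at the levels above `i`. -/
def usedAbove {M : ℕ} (i : Fin (M + 1)) : Set (Query M)
  | Query.outer => True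
  | Query.inner m => i ≤ m.castSucc
  | Query.hess m _ => i ≤ m.castSucc

/-- The growth factor of the bounds along the chain. -/
def chainFactor (Λ κ : ℝ) : ℝ := 16 * Λ ^ 6 / κ ^ 4

/-- The second moments of the noisy chain and of its distance from the chain without noise. -/
theorem Dom.chainAt {M : ℕ} {d : Fin (M + 1) → ℕ} {n : Query M → Ω → ℝ} {L : Fin M → ℝ}
    {b : Fin M → ℕ} (hn : ∀ q, Measurable (n q)) (hn0 : ∀ q ω, 0 ≤ n q ω) (hx : 0 ≤ x)
    (hx1 : x ≤ 1) (hΛ : 1 ≤ Λ) (hκ : 0 < κ) (hκ1 : κ ≤ 1) (hL0 : ∀ m, 0 < L m)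
    (hL : ∀ m, (L m)⁻¹ ≤ Λ) (hsmall : 2 / κ * (Λ ^ 2 * x) ≤ κ / 2)
    (hone : Dom P n x ∅ (fun _ => 1) 1)
    {h h' : Ω → Vec (d (Fin.last M))}
    {u u' : Ω → (m : Fin M) → (Vec (d m.succ) →L[ℝ] Vec (d m.castSucc))}
    {v : Ω → (m : Fin M) → ℕ → (Vec (d m.succ) →L[ℝ] Vec (d m.succ))}
    {v' : Ω → (m : Fin M) → (Vec (d m.succ) →L[ℝ] Vec (d m.succ))}
    (mh : Measurable h) (mh' : Measurable h') (mu : ∀ m, Measurable fun ω => u ω m)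
    (mu' : ∀ m, Measurable fun ω => u' ω m) (mv : ∀ m i, Measurable fun ω => v ω m i)
    (mv' : ∀ m, Measurable fun ω => v' ω m)
    (bh : ∀ ω, ‖h' ω‖ ≤ Λ) (bu : ∀ ω m, ‖u' ω m‖ ≤ Λ)
    (bv : ∀ ω m, ‖ContinuousLinearMap.id ℝ (Vec (d m.succ)) - (L m)⁻¹ • v' ω m‖ ≤ 1 - κ)
    (nh : ∀ ω, ‖h ω - h' ω‖ ^ 2 ≤ n Query.outer ω)
    (nu : ∀ ω m, ‖u ω m - u' ω m‖ ^ 2 ≤ n (Query.inner m) ω)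
    (nv : ∀ ω m i, ‖v ω m i - v' ω m‖ ^ 2 ≤ n (Query.hess m i) ω) (i : Fin (M + 1)) :
    Dom P n x (usedAbove i) (fun ω => ‖chainAt L b (h ω) (u ω) (v ω) i‖ ^ 2)
        (4 * Λ ^ 2 * (2 * chainFactor Λ κ) ^ (M - (i : ℕ))) ∧
      Dom P n x (usedAbove i) (fun ω => ‖chainAt L b (h ω) (u ω) (v ω) i
          - chainAt L b (h' ω) (u' ω) (fun m _ => v' ω m) i‖ ^ 2)
        (4 * Λ ^ 2 * (2 * chainFactor Λ κ) ^ (M - (i : ℕ)) * x) := by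
  have hΛ0 : 0 < Λ := one_pos.trans_le hΛ
  have hΛ2 : 1 ≤ Λ ^ 2 := one_le_pow₀ hΛ
  induction i using Fin.reverseInduction with
  | last =>
    have hq : Query.outer ∈ usedAbove (Fin.last M) := trivial
    have h1 := hone.mul_noise (q := Query.outer) (J' := usedAbove (Fin.last M)) (by simp) hq
      (by simp) (hn _) (hn0 _)
    have h2 : Dom P n x (usedAbove (Fin.last M)) (fun _ => 1) 1 :=
      hone.mono measurable_const (fun _ => zero_le_one) (fun _ => le_rfl) (by simp) le_rfl hx hn hn0
    simp only [chainAt_last, Fin.val_last, Nat.sub_self, pow_zero, mul_one]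
    refine ⟨((h2.smul (c := 2 * Λ ^ 2) (by positivity)).add (h1.smul (c := 2) (by norm_num))).mono
      (mh.norm.pow_const 2) (fun ω => by positivity) (fun ω => ?_) le_rfl ?_ hx hn hn0,
      h1.mono ((mh.sub mh').norm.pow_const 2) (fun ω => by positivity) (fun ω => ?_) le_rfl ?_ hx
      hn hn0⟩
    · have e1 : ‖h ω‖ ≤ Λ + ‖h ω - h' ω‖ := by
        have := norm_add_le (h' ω) (h ω - h' ω)
        rw [add_sub_cancel] at this
        linarith [bh ω]
      have e2 := pow_le_pow_left₀ (norm_nonneg _) e1 2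
      have := nh ω
      nlinarith [sq_nonneg (Λ - ‖h ω - h' ω‖)]
    · nlinarith
    · simpa using nh ω
    · nlinarith
  | cast m ih =>
    obtain ⟨ih1, ih2⟩ := ih
    set z := 4 * Λ ^ 2 * (2 * chainFactor Λ κ) ^ (M - (m.succ : ℕ)) with hzdef
    -- The part of the chain above level `m` involves no sample of that level, so the noises of its
    -- Hessians and of its mixed derivative may enter now.
    have hJ1 : ∀ i, Query.hess m i ∉ usedAbove m.succ := fun i hi =>
      absurd (show m.succ ≤ m.castSucc from hi) (by simp [Fin.le_def])
    have hJ2 : Query.inner m ∉ usedAbove m.succ := fun hi =>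
      absurd (show m.succ ≤ m.castSucc from hi) (by simp [Fin.le_def])
    have hz0 : 0 ≤ z := ih1.value_nonneg
    obtain ⟨N1, N2⟩ := Dom.neumann hn hn0 hx hκ hκ1 (hL0 m) (hL m) hsmall
      (e := fun i => Query.hess m i) (fun i j hij => by simpa using hij) hJ1 (mv m) (mv' m)
      (fun ω => bv ω m) (fun ω i => nv ω m i) (measurable_chainAt L b mh mu mv m.succ)
      (measurable_chainAt L b mh' mu' (fun m _ => mv' m) m.succ) ih1 ih2 (b m)
    have hmem : Query.inner m ∈ usedAbove m.castSucc := le_refl m.castSucc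
    have hJ3 : Query.inner m ∉ usedAbove m.succ ∪ (fun i => Query.hess m i) '' Set.Iio (b m) := by
      rintro (h | ⟨j, _, hj⟩)
      · exact hJ2 h
      · simp at hj
    have hmono : usedAbove m.succ ∪ (fun i => Query.hess m i) '' Set.Iio (b m)
        ⊆ usedAbove m.castSucc := by
      rintro q (h | ⟨j, _, rfl⟩)
      · cases q with
        | outer => trivial
        | inner m' => exact (Fin.castSucc_lt_succ).le.trans (show m.succ ≤ m'.castSucc from h)
        | hess m' i => exact (Fin.castSucc_lt_succ).le.trans (show m.succ ≤ m'.castSucc from h)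
      · exact le_refl m.castSucc
    have lift : ∀ {Z : Ω → ℝ} {z},
        Dom P n x (usedAbove m.succ ∪ (fun i => Query.hess m i) '' Set.Iio (b m)) Z z →
        Dom P n x (usedAbove m.castSucc) Z z := fun h =>
      h.mono h.meas h.nonneg (fun _ => le_rfl) hmono le_rfl hx hn hn0
    have NN := N1.mul_noise hJ3 hmem hmono (hn _) (hn0 _)
    have m1 := measurable_chainAt L b mh mu mv m.castSucc
    have m2 := measurable_chainAt L b mh' mu' (fun m _ => mv' m) m.castSucc
    have hexp : M - (m.castSucc : ℕ) = M - (m.succ : ℕ) + 1 := by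
      have := m.2
      simp only [Fin.val_castSucc, Fin.val_succ]
      omega
    have hLsq : (L m)⁻¹ ^ 2 ≤ Λ ^ 2 := pow_le_pow_left₀ (inv_nonneg.2 (hL0 m).le) (hL m) 2
    have hκ4 : 4 / κ ^ 2 ≤ 4 / κ ^ 4 := by
      apply div_le_div_of_nonneg_left (by norm_num) (by positivity)
      exact pow_le_pow_of_le_one hκ.le hκ1 (by norm_num)
    have hΛ4 : Λ ^ 2 ≤ Λ ^ 4 := pow_le_pow_right₀ hΛ (by norm_num)
    have hΛ6 : Λ ^ 4 ≤ Λ ^ 6 := pow_le_pow_right₀ hΛ (by norm_num)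
    rw [hexp, pow_succ]
    constructor
    · refine ((lift (N1.smul (c := 2 * Λ ^ 4) (by positivity))).add
        (NN.smul (c := 2 * Λ ^ 2) (by positivity))).mono (m1.norm.pow_const 2)
        (fun ω => by positivity) (fun ω => ?_) le_rfl ?_ hx hn hn0
      · rw [chainAt_castSucc]
        set q := DSMO.neumann (L m) (v ω m) (b m) (DSMO.chainAt L b (h ω) (u ω) (v ω) m.succ)
        have e1 : ‖u ω m‖ ≤ Λ + ‖u ω m - u' ω m‖ := by
          have := norm_add_le (u' ω m) (u ω m - u' ω m)
          rw [add_sub_cancel] at this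
          linarith [bu ω m]
        -- The noise of `u` is unbounded, so `u` is not estimated by a constant; its square is split
        -- into a bounded part and a noise factor that `NN` handles.
        have e2 : ‖u ω m‖ ^ 2 ≤ 2 * Λ ^ 2 + 2 * n (Query.inner m) ω := by
          have := pow_le_pow_left₀ (norm_nonneg _) e1 2
          nlinarith [nu ω m, sq_nonneg (Λ - ‖u ω m - u' ω m‖)]
        have e3 : ‖u ω m ((L m)⁻¹ • q)‖ ≤ ‖u ω m‖ * ((L m)⁻¹ * ‖q‖) := by
          refine ((u ω m).le_opNorm _).trans (le_of_eq ?_)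
          rw [norm_smul, Real.norm_of_nonneg (inv_nonneg.2 (hL0 m).le)]
        calc _ ≤ (‖u ω m‖ * ((L m)⁻¹ * ‖q‖)) ^ 2 := pow_le_pow_left₀ (norm_nonneg _) e3 2
          _ = ‖u ω m‖ ^ 2 * ((L m)⁻¹ ^ 2 * ‖q‖ ^ 2) := by ring
          _ ≤ (2 * Λ ^ 2 + 2 * n (Query.inner m) ω) * (Λ ^ 2 * ‖q‖ ^ 2) := by
              have := hn0 (Query.inner m) ω
              gcongr
          _ = _ := by ring
      · have h1 : 2 * Λ ^ 4 * (4 / κ ^ 2 * z) + 2 * Λ ^ 2 * (x * (4 / κ ^ 2 * z))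
            ≤ 4 * Λ ^ 6 * (4 / κ ^ 4 * z) := by
          have e0 : 0 ≤ 4 / κ ^ 2 * z := by positivity
          have e1 : 4 / κ ^ 2 * z ≤ 4 / κ ^ 4 * z := by gcongr
          have e2 : 2 * Λ ^ 4 * (4 / κ ^ 2 * z) ≤ 2 * Λ ^ 6 * (4 / κ ^ 4 * z) := by gcongr
          have e3 : 2 * Λ ^ 2 * (x * (4 / κ ^ 2 * z)) ≤ 2 * Λ ^ 6 * (1 * (4 / κ ^ 4 * z)) :=
            mul_le_mul (mul_le_mul_of_nonneg_left (hΛ4.trans hΛ6) (by norm_num))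
              (mul_le_mul hx1 e1 e0 zero_le_one) (mul_nonneg hx e0) (by positivity)
          linarith
        refine h1.trans ?_
        have h2 : 4 * Λ ^ 6 * (4 / κ ^ 4 * z) = z * chainFactor Λ κ := by
          rw [chainFactor]; ring
        have h3 : 0 ≤ z * chainFactor Λ κ := by rw [← h2]; positivity
        rw [h2]
        calc z * chainFactor Λ κ ≤ 2 * (z * chainFactor Λ κ) := by linarith
          _ = _ := by rw [hzdef]; ring
    · refine ((lift (N2.smul (c := 2 * Λ ^ 4) (by positivity))).add
        (NN.smul (c := 2 * Λ ^ 2) (by positivity))).mono ((m1.sub m2).norm.pow_const 2)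
        (fun ω => by positivity) (fun ω => ?_) le_rfl ?_ hx hn hn0
      · rw [chainAt_castSucc, chainAt_castSucc]
        set q := DSMO.neumann (L m) (v ω m) (b m) (DSMO.chainAt L b (h ω) (u ω) (v ω) m.succ)
        set q' := DSMO.neumann (L m) (fun _ => v' ω m) (b m)
          (DSMO.chainAt L b (h' ω) (u' ω) (fun m _ => v' ω m) m.succ)
        have e1 : u ω m ((L m)⁻¹ • q) - u' ω m ((L m)⁻¹ • q')
            = u' ω m ((L m)⁻¹ • (q - q')) + (u ω m - u' ω m) ((L m)⁻¹ • q) := by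
          simp only [smul_sub, map_sub, sub_apply]
          abel
        have hLn : ‖(L m)⁻¹‖ = (L m)⁻¹ := Real.norm_of_nonneg (inv_nonneg.2 (hL0 m).le)
        have hL0' : 0 ≤ (L m)⁻¹ := inv_nonneg.2 (hL0 m).le
        -- The error is split so that the smooth operator acts on the error of the vector, while the
        -- noise of `u` acts on the full noisy vector, whose second moment is known from `N1`.
        have e2 : ‖u' ω m ((L m)⁻¹ • (q - q'))‖ ≤ Λ * (Λ * ‖q - q'‖) := by
          refine (ContinuousLinearMap.le_of_opNorm_le _ (bu ω m) _).trans ?_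
          rw [norm_smul, hLn]
          gcongr
          exact hL m
        have e3 : ‖(u ω m - u' ω m) ((L m)⁻¹ • q)‖ ≤ ‖u ω m - u' ω m‖ * (Λ * ‖q‖) := by
          refine (ContinuousLinearMap.le_opNorm _ _).trans ?_
          rw [norm_smul, hLn]
          gcongr
          exact hL m
        have e4 : ‖u ω m ((L m)⁻¹ • q) - u' ω m ((L m)⁻¹ • q')‖
            ≤ Λ * (Λ * ‖q - q'‖) + ‖u ω m - u' ω m‖ * (Λ * ‖q‖) := by
          rw [e1]; exact (norm_add_le _ _).trans (add_le_add e2 e3)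
        calc _ ≤ (Λ * (Λ * ‖q - q'‖) + ‖u ω m - u' ω m‖ * (Λ * ‖q‖)) ^ 2 :=
              pow_le_pow_left₀ (norm_nonneg _) e4 2
          _ ≤ 2 * (Λ * (Λ * ‖q - q'‖)) ^ 2 + 2 * (‖u ω m - u' ω m‖ * (Λ * ‖q‖)) ^ 2 := by
              nlinarith [sq_nonneg (Λ * (Λ * ‖q - q'‖) - ‖u ω m - u' ω m‖ * (Λ * ‖q‖))]
          _ = 2 * Λ ^ 4 * ‖q - q'‖ ^ 2 + 2 * Λ ^ 2 * (‖u ω m - u' ω m‖ ^ 2 * ‖q‖ ^ 2) := by ring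
          _ ≤ _ := by
              gcongr
              exact nu ω m
      · have e0 : 0 ≤ z * x := mul_nonneg hz0 hx
        have f1 : Λ ^ 4 / κ ^ 2 ≤ Λ ^ 6 / κ ^ 4 :=
          div_le_div₀ (by positivity) hΛ6 (by positivity)
            (pow_le_pow_of_le_one hκ.le hκ1 (by norm_num))
        have f2 : Λ ^ 2 / κ ^ 2 ≤ Λ ^ 6 / κ ^ 4 :=
          (div_le_div_of_nonneg_right hΛ4 (by positivity)).trans f1
        have g1 : 2 * Λ ^ 4 * (2 / κ ^ 2 * (z * x + Λ ^ 2 * x * (4 / κ ^ 2 * z)))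
            + 2 * Λ ^ 2 * (x * (4 / κ ^ 2 * z))
            = (4 * (Λ ^ 4 / κ ^ 2) + 16 * (Λ ^ 6 / κ ^ 4) + 8 * (Λ ^ 2 / κ ^ 2)) * (z * x) := by
          field_simp
          ring
        have g2 : z * (2 * chainFactor Λ κ) * x = 32 * (Λ ^ 6 / κ ^ 4) * (z * x) := by
          rw [chainFactor]; ring
        calc _ ≤ 32 * (Λ ^ 6 / κ ^ 4) * (z * x) := by
              rw [g1]
              refine mul_le_mul_of_nonneg_right ?_ e0
              have : 0 ≤ Λ ^ 6 / κ ^ 4 := by positivity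
              linarith
          _ = _ := by rw [← g2, hzdef]; ring

end Chain

end DSMO

end

/-! ### The standing assumptions and the noise of the estimators -/

noncomputable section

namespace DSMO

/-- The assumptions on the problem, the oracle, the network and the parameters of the algorithm,
with two numbers `Λ`, `κ` that bound the constants. -/
structure Setup {M K : ℕ} {d : Fin (M + 1) → ℕ} {S Ω : Type*} [MeasurableSpace S]
    [MeasurableSpace Ω] (c : Constants M) (Λ κ ρ : ℝ) (θ : Params M)
    (W : Matrix (Fin K) (Fin K) ℝ) (p : Problem M K d) (O : Oracle M K d S) (P : Measure Ω)
    (ξ : ℕ → Fin K → Query M → Ω → S) : Prop where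
  valid : c.Valid
  uniform : c.Uniform d Λ κ
  K_pos : 1 ≤ K
  gossip : IsGossip W ρ
  prob : IsProbabilityMeasure P
  unbiased : O.Unbiased p
  sampling : IsSampling O P ξ
  outer : OuterAssumptions c p O
  inner : InnerAssumptions c p O
  init : InitialBounds c p
  L_eq : θ.L = c.Lg
  μ_eq : θ.μ = c.μ
  β_pos : 0 < θ.β
  β_le : θ.β ≤ 1
  γ_eq : θ.γ = θ.β
  α_nonneg : 0 ≤ θ.α

theorem continuous_of_lip {A B C : Type*} [NormedAddCommGroup A] [NormedAddCommGroup B]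
    [NormedAddCommGroup C] {φ : A → B → C} {l : ℝ}
    (h : ∀ a a' y y', ‖φ a y - φ a' y'‖ ≤ l * (‖a - a'‖ + ‖y - y'‖)) :
    Continuous fun q : A × B => φ q.1 q.2 := by
  refine continuous_iff_continuousAt.2 fun q => ?_
  rw [ContinuousAt, tendsto_iff_norm_sub_tendsto_zero]
  have h1 : Continuous fun q' : A × B => l * (‖q'.1 - q.1‖ + ‖q'.2 - q.2‖) := by fun_prop
  have h2 := h1.tendsto q
  simp only [sub_self, norm_zero, add_zero, mul_zero] at h2
  exact squeeze_zero (fun _ => norm_nonneg _) (fun q' => h _ _ _ _) h2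

theorem measurable_toEucl_sub {A E : Type*} [MeasurableSpace A] [NormedAddCommGroup E]
    [NormedSpace ℝ E] [FiniteDimensional ℝ E] [MeasurableSpace E] [BorelSpace E] {f g : A → E}
    (hf : Measurable f) (hg : Measurable g) : Measurable fun z => toEucl E (f z - g z) := by
  have := FiniteDimensional.proper ℝ E
  exact (toEucl E).continuous.measurable.comp (hf.sub hg)

section Dom

variable {K : ℕ} {Q Ω S 𝒳 : Type*} [mΩ : MeasurableSpace Ω] [MeasurableSpace S]
  [MeasurableSpace 𝒳] {P : Measure Ω} {H : Q → Type*}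
  [∀ q, NormedAddCommGroup (H q)] [∀ q, InnerProductSpace ℝ (H q)]
  [∀ q, MeasurableSpace (H q)] [∀ q, BorelSpace (H q)] [∀ q, SecondCountableTopology (H q)]
  {W : Matrix (Fin K) (Fin K) ℝ} {ρ β : ℝ}
  {ξ : ℕ × Fin K × Q → Ω → S} {η : (q : Q) → Fin K → 𝒳 → S → H q} {X : ℕ → Fin K → Ω → 𝒳}
  {σ : ℝ}

theorem IsNoise.measurable_norm_sq (h : IsNoise P ξ η X fun _ => σ) (B : ℝ) (t : ℕ) (k : Fin K)
    (q : Q) : Measurable fun ω => B * ‖noise β W ξ η X q t k ω‖ ^ 2 :=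
  (((h.measurable_noise β q t k).mono (info_le h.meas_ξ _) le_rfl).norm.pow_const 2).const_mul B

/-- The squared noises of a single agent behave like independent random variables with mean at most
`σ² (β / K + β² / (1 - ρ))`. -/
theorem IsNoise.dom_one [IsProbabilityMeasure P] [∀ q, CompleteSpace (H q)]
    (h : IsNoise P ξ η X fun _ => σ) (hW : IsGossip W ρ) (hβ0 : 0 ≤ β)
    (hβ1 : β ≤ 1) (hK : 1 ≤ K) {B : ℝ} (hB : 0 ≤ B) (t : ℕ) (k : Fin K) :
    Dom P (fun q ω => B * ‖noise β W ξ η X q t k ω‖ ^ 2)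
      (B * (σ ^ 2 * (β / K + β ^ 2 / (1 - ρ)))) ∅ (fun _ => 1) 1 where
  meas := measurable_const
  nonneg _ := zero_le_one
  bound F _ := by
    set w : (Fin K → ℝ) → ℝ := fun c =>
      (∑ j, c j) ^ 2 * (β / K) + (∑ j, (c j - avg c) ^ 2) * (β ^ 2 / (1 - ρ)) with hw
    have hρ := hW.one_sub_pos
    have hw0 : ∀ c, 0 ≤ w c := fun c => by
      have : 0 ≤ ∑ j, (c j - avg c) ^ 2 := Finset.sum_nonneg fun j _ => sq_nonneg _
      positivity
    -- The noise of the single agent `k` is the combination with the `k`-th unit vector, whose sum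
    -- is `1` and whose dispersion is at most its squared norm `1`.
    have hwk : w (Pi.single k 1) ≤ β / K + β ^ 2 / (1 - ρ) := by
      have h1 : (∑ j, ((Pi.single k 1 : Fin K → ℝ) j - avg (Pi.single k 1 : Fin K → ℝ)) ^ 2)
          ≤ 1 := by
        have h2 := disp_le (Pi.single k 1 : Fin K → ℝ)
        simp only [disp, avg, smul_eq_mul, Real.norm_eq_abs, sq_abs] at h2
        have hK' : (0 : ℝ) < (K : ℝ)⁻¹ := by positivity
        have h3 := le_of_mul_le_mul_left h2 hK'
        refine h3.trans (le_of_eq ?_)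
        simp [Pi.single_apply]
      have h4 := mul_le_mul_of_nonneg_right h1 (show 0 ≤ β ^ 2 / (1 - ρ) by positivity)
      simp only [hw, Finset.sum_pi_single', Finset.mem_univ, if_true, one_pow, one_mul] at h4 ⊢
      linarith
    have key := h.lintegral_prod_le hw0 (fun c => hW.noise_weight hβ0 hβ1 hK c) t F
      (a := fun _ => 0) (fun _ => le_rfl) (b := fun _ => B) (fun _ => hB) fun _ => Pi.single k 1
    have hsingle : ∀ q ω, ∑ j, (Pi.single k 1 : Fin K → ℝ) j • noise β W ξ η X q t j ω
        = noise β W ξ η X q t k ω := fun q ω => by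
      simp [Pi.single_apply]
    simp only [hsingle, zero_add] at key
    set n : Q → Ω → ℝ := fun q ω => B * ‖noise β W ξ η X q t k ω‖ ^ 2 with hn
    have hn0 : ∀ q ω, 0 ≤ n q ω := fun q ω => by positivity
    have hmeas : Measurable fun ω => ∏ q ∈ F, n q ω :=
      Finset.measurable_fun_prod _ fun q _ => h.measurable_norm_sq B t k q
    have hle : ∫⁻ ω, ENNReal.ofReal (∏ q ∈ F, n q ω) ∂P
        ≤ ENNReal.ofReal ((B * (σ ^ 2 * (β / K + β ^ 2 / (1 - ρ)))) ^ F.card) := by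
      simp only [ENNReal.ofReal_prod_of_nonneg fun q _ => hn0 q _]
      refine key.trans ?_
      rw [Finset.prod_const, ENNReal.ofReal_pow (by positivity)]
      gcongr
    have hp0 : ∀ ω, 0 ≤ ∏ q ∈ F, n q ω := fun ω => Finset.prod_nonneg fun q _ => hn0 q ω
    simp only [one_mul]
    refine ⟨⟨hmeas.aestronglyMeasurable, ?_⟩, ?_⟩
    · rw [hasFiniteIntegral_iff_ofReal (Filter.Eventually.of_forall hp0)]
      exact hle.trans_lt ENNReal.ofReal_lt_top
    · rw [integral_eq_lintegral_of_nonneg_ae (Filter.Eventually.of_forall hp0)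
        hmeas.aestronglyMeasurable]
      exact ENNReal.toReal_le_of_le_ofReal (by positivity) hle

end Dom

namespace Setup

variable {M K : ℕ} {d : Fin (M + 1) → ℕ} {S Ω : Type*} [MeasurableSpace S] [MeasurableSpace Ω]
  {c : Constants M} {Λ κ ρ : ℝ} {θ : Params M} {W : Matrix (Fin K) (Fin K) ℝ} {p : Problem M K d}
  {O : Oracle M K d S} {P : Measure Ω} {ξ : ℕ → Fin K → Query M → Ω → S}

theorem regular (h : Setup c Λ κ ρ θ W p O P ξ) : p.Regular Λ κ c.Lg :=
  h.uniform.regular h.valid h.K_pos h.unbiased h.outer h.inner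

theorem meas_flat (h : Setup c Λ κ ρ θ W p O P ξ) (i : ℕ × Fin K × Query M) :
    Measurable (flat ξ i) := h.sampling.meas _ _ _

theorem measurable_points_info (h : Setup c Λ κ ρ θ W p O P ξ) (t : ℕ) (k : Fin K) :
    Measurable[info (flat ξ) {i | i.1 < t}] (points θ W O ξ t k) := by
  refine @measurable_pi_lambda Ω _ _ (info (flat ξ) {i | i.1 < t}) _ _ fun i => ?_
  exact @MeasurableState.pt Ω (info (flat ξ) {i | i.1 < t}) _ _ _ _
    (@measurableState_run Ω (info (flat ξ) {i | i.1 < t}) M K d S _ p O h.unbiased θ W ξ t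
    fun s hs k q => measurable_info (ξ := flat ξ) (i := (s, k, q)) hs) k i

theorem measurableState (h : Setup c Λ κ ρ θ W p O P ξ) (t : ℕ) :
    MeasurableState fun ω => run θ W O (fun r k q => ξ r k q ω) t :=
  measurableState_run h.unbiased θ W ξ t fun _ _ _ _ => h.sampling.meas _ _ _

theorem measurable_grads (h : Setup c Λ κ ρ θ W p O P ξ) (k : Fin K) :
    (Measurable fun z : Vec (d 0) × Vec (d (Fin.last M)) => grad₁ (p.f k) z.1 z.2) ∧
    (Measurable fun z : Vec (d 0) × Vec (d (Fin.last M)) => grad₂ (p.f k) z.1 z.2) ∧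
    (∀ m, Measurable fun z : Vec (d (Fin.castSucc m)) × Vec (d m.succ) =>
      grad₂ (p.g k m) z.1 z.2) ∧
    (∀ m, Measurable fun z : Vec (d (Fin.castSucc m)) × Vec (d m.succ) =>
      hess₁₂ (p.g k m) z.1 z.2) ∧
    (∀ m, Measurable fun z : Vec (d (Fin.castSucc m)) × Vec (d m.succ) =>
      hess₂₂ (p.g k m) z.1 z.2) :=
  ⟨(continuous_of_lip (h.regular.f_lip₁ k)).measurable,
    (continuous_of_lip (h.regular.f_lip₂ k)).measurable,
    fun m => (continuous_of_lip (h.regular.g_lip k m)).measurable,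
    fun m => (continuous_of_lip (h.regular.lip₁₂ k m)).measurable,
    fun m => (continuous_of_lip (h.regular.lip₂₂ k m)).measurable⟩

theorem measurable_chainNoise (h : Setup c Λ κ ρ θ W p O P ξ) (q : Query M) (k : Fin K) :
    Measurable fun z : (∀ i, Vec (d i)) × S => chainNoise p O q k z.1 z.2 := by
  obtain ⟨-, m2, -, m4, m5⟩ := h.measurable_grads k
  have mx : ∀ i, Measurable fun z : (∀ i, Vec (d i)) × S => z.1 i := fun i =>
    (measurable_pi_apply i).comp measurable_fst
  have m2' : ∀ i j, Measurable fun z : (∀ i, Vec (d i)) × S => (z.1 i, z.1 j) := fun i j =>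
    (mx i).prodMk (mx j)
  have m3' : ∀ i j, Measurable fun z : (∀ i, Vec (d i)) × S => (z.1 i, z.1 j, z.2) := fun i j =>
    (mx i).prodMk ((mx j).prodMk measurable_snd)
  cases q with
  | outer =>
    have := measurable_toEucl_sub ((h.unbiased.meas_f₂ k).comp (m3' 0 (Fin.last M)))
      (m2.comp (m2' 0 (Fin.last M)))
    exact this
  | inner m =>
    have := measurable_toEucl_sub ((h.unbiased.meas_g₁₂ k m).comp (m3' m.castSucc m.succ))
      ((m4 m).comp (m2' m.castSucc m.succ))
    exact this
  | hess m i =>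
    have := measurable_toEucl_sub ((h.unbiased.meas_g₂₂ k m).comp (m3' m.castSucc m.succ))
      ((m5 m).comp (m2' m.castSucc m.succ))
    exact this

theorem isNoise_chain (h : Setup c Λ κ ρ θ W p O P ξ) :
    IsNoise P (flat ξ) (chainNoise p O) (points θ W O ξ) fun _ => Λ ^ 2 := by
  have probF := h.unbiased.probF
  have probG := h.unbiased.probG
  have key : ∀ q t k x, MemLp (chainNoise p O q k x) 2 (P.map (flat ξ (t, k, q))) ∧
      ∫ s, chainNoise p O q k x s ∂(P.map (flat ξ (t, k, q))) = 0 ∧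
      ∫ s, ‖chainNoise p O q k x s‖ ^ 2 ∂(P.map (flat ξ (t, k, q))) ≤ (Λ ^ 2) ^ 2 := by
    intro q t k x
    rw [show P.map (flat ξ (t, k, q)) = O.law k q from h.sampling.law t k q]
    cases q with
    | outer =>
      exact (h.outer.moment₂ k _ _).toEucl_sub_mean h.valid.Cf_pos.le h.uniform.Cf_le
        (h.uniform.eucl_vec _) (h.unbiased.int_f₂ k _ _).2
    | inner m =>
      exact (h.inner.moment₁₂ k m _ _).toEucl_sub_mean (h.valid.Lg_pos m).le
        (h.uniform.Lg_le m) (h.uniform.eucl_mixed m) (h.unbiased.int_g₁₂ k m _ _).2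
    | hess m i =>
      exact (h.inner.moment₂₂ k m _ _).toEucl_sub_mean (h.valid.Lg_pos m).le
        (h.uniform.Lg_le m) (h.uniform.eucl_end m) (h.unbiased.int_g₂₂ k m _ _).2
  exact ⟨h.meas_flat, h.sampling.indep, h.measurable_chainNoise, fun q t k x => (key q t k x).1,
    fun q t k x => (key q t k x).2.1, fun q t k x => (key q t k x).2.2, h.measurable_points_info⟩

/-- The gradients `∇₁f` and `∇₂f` share a sample, and a product of noises may contain only one noise
per sample. The noise of `s` therefore forms a separate family, which is harmless because `s` enters
the direction additively. -/
theorem isNoise_outer (h : Setup c Λ κ ρ θ W p O P ξ) :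
    IsNoise P (flat ξ) (outerNoise p O) (points θ W O ξ) fun _ => Λ ^ 2 := by
  have probF := h.unbiased.probF
  have hΛ := h.uniform.one_le
  have key : ∀ q t k x, MemLp (outerNoise p O q k x) 2 (P.map (flat ξ (t, k, q))) ∧
      ∫ s, outerNoise p O q k x s ∂(P.map (flat ξ (t, k, q))) = 0 ∧
      ∫ s, ‖outerNoise p O q k x s‖ ^ 2 ∂(P.map (flat ξ (t, k, q))) ≤ (Λ ^ 2) ^ 2 := by
    intro q t k x
    rw [show P.map (flat ξ (t, k, q)) = O.law k q from h.sampling.law t k q]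
    cases q with
    | outer =>
      exact (h.outer.moment₁ k _ _).toEucl_sub_mean h.valid.Cf_pos.le h.uniform.Cf_le
        (h.uniform.eucl_vec _) (h.unbiased.int_f₁ k _ _).2
    | inner m =>
      simp only [outerNoise, norm_zero, integral_zero, zero_pow two_ne_zero]
      exact ⟨MemLp.zero, trivial, by positivity⟩
    | hess m i =>
      simp only [outerNoise, norm_zero, integral_zero, zero_pow two_ne_zero]
      exact ⟨MemLp.zero, trivial, by positivity⟩
  refine ⟨h.meas_flat, h.sampling.indep, fun q k => ?_, fun q t k x => (key q t k x).1,
    fun q t k x => (key q t k x).2.1, fun q t k x => (key q t k x).2.2, h.measurable_points_info⟩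
  obtain ⟨m1, -⟩ := h.measurable_grads k
  have mx : ∀ i, Measurable fun z : (∀ i, Vec (d i)) × S => z.1 i := fun i =>
    (measurable_pi_apply i).comp measurable_fst
  cases q with
  | outer =>
    exact measurable_toEucl_sub ((h.unbiased.meas_f₁ k).comp
      ((mx 0).prodMk ((mx (Fin.last M)).prodMk measurable_snd)))
      (m1.comp ((mx 0).prodMk (mx (Fin.last M))))
  | inner m => exact measurable_const
  | hess m i => exact measurable_const

/-! ### The estimators without noise are bounded -/

variable (σ : ℕ → Fin K → Query M → S)

theorem smoothS_le (h : Setup c Λ κ ρ θ W p O P ξ) (t : ℕ) (k : Fin K) :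
    ‖smoothS θ W p O σ t k‖ ≤ Λ := by
  have := ema_mem h.gossip h.β_pos.le h.β_le (convex_closedBall (0 : Vec (d 0)) Λ)
    (init := 0) (inp := fun t k => grad₁ (p.f k) ((run θ W O σ t k).pt 0)
    ((run θ W O σ t k).pt (Fin.last M))) (by simpa using h.regular.Λ_pos.le)
    (fun t k => by simpa using h.regular.f_bound₁ k _ _) t k
  exact mem_closedBall_zero_iff.1 this

theorem smoothH_le (h : Setup c Λ κ ρ θ W p O P ξ) (t : ℕ) (k : Fin K) :
    ‖smoothH θ W p O σ t k‖ ≤ Λ := by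
  have := ema_mem h.gossip h.β_pos.le h.β_le (convex_closedBall (0 : Vec (d (Fin.last M))) Λ)
    (init := 0) (inp := fun t k => grad₂ (p.f k) ((run θ W O σ t k).pt 0)
    ((run θ W O σ t k).pt (Fin.last M))) (by simpa using h.regular.Λ_pos.le)
    (fun t k => by simpa using h.regular.f_bound₂ k _ _) t k
  exact mem_closedBall_zero_iff.1 this

theorem smoothU_le (h : Setup c Λ κ ρ θ W p O P ξ) (m : Fin M) (t : ℕ) (k : Fin K) :
    ‖smoothU θ W p O σ m t k‖ ≤ Λ := by
  have := ema_mem h.gossip h.β_pos.le h.β_le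
    (convex_closedBall (0 : Vec (d m.succ) →L[ℝ] Vec (d m.castSucc)) Λ)
    (init := 0) (inp := fun t k => hess₁₂ (p.g k m) ((run θ W O σ t k).pt m.castSucc)
    ((run θ W O σ t k).pt m.succ)) (by simpa using h.regular.Λ_pos.le)
    (fun t k => by simpa using h.regular.bound₁₂ k m _ _) t k
  exact mem_closedBall_zero_iff.1 this

/-- Here the constant of the level is kept, because `b m` is tuned to it; the uniform `κ` would not
give the truncation error `1 / T`. -/
theorem hess_contraction (h : Setup c Λ κ ρ θ W p O P ξ) (k : Fin K) (m : Fin M) (a y) :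
    ‖ContinuousLinearMap.id ℝ (Vec (d m.succ)) - (c.Lg m)⁻¹ • hess₂₂ (p.g k m) a y‖
      ≤ 1 - c.κ m := by
  have := h.unbiased.probG
  have h1 := (h.inner.contraction k m a y).norm_integral_le (sub_nonneg.2 (h.valid.κ_lt_one m).le)
  have hi : Integrable (fun s => (c.Lg m)⁻¹ • O.g₂₂ k m a y s) (O.lawG k m) :=
    Integrable.smul (f := O.g₂₂ k m a y) (c.Lg m)⁻¹ (h.unbiased.int_g₂₂ k m a y).1
  rw [integral_sub (integrable_const _) hi, integral_smul,
    (h.unbiased.int_g₂₂ k m a y).2] at h1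
  simpa only [integral_const, probReal_univ, one_smul] using h1

theorem smoothV_le_level (h : Setup c Λ κ ρ θ W p O P ξ) (m : Fin M) (t : ℕ) (k : Fin K) :
    ‖ContinuousLinearMap.id ℝ (Vec (d m.succ)) - (c.Lg m)⁻¹ • smoothV θ W p O σ m t k‖
      ≤ 1 - c.κ m := by
  have hL := h.valid.Lg_pos m
  have hconv : Convex ℝ {A : Vec (d m.succ) →L[ℝ] Vec (d m.succ) |
      ‖ContinuousLinearMap.id ℝ (Vec (d m.succ)) - (c.Lg m)⁻¹ • A‖ ≤ 1 - c.κ m} := by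
    intro A hA B hB a b ha hb hab
    have e : ContinuousLinearMap.id ℝ (Vec (d m.succ)) - (c.Lg m)⁻¹ • (a • A + b • B)
        = a • (ContinuousLinearMap.id ℝ (Vec (d m.succ)) - (c.Lg m)⁻¹ • A)
          + b • (ContinuousLinearMap.id ℝ (Vec (d m.succ)) - (c.Lg m)⁻¹ • B) := by
      obtain rfl : b = 1 - a := by linarith
      module
    simp only [Set.mem_ofPred_eq] at hA hB ⊢
    rw [e]
    refine (norm_add_le _ _).trans ?_
    rw [norm_smul, norm_smul, Real.norm_of_nonneg ha, Real.norm_of_nonneg hb]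
    calc _ ≤ a * (1 - c.κ m) + b * (1 - c.κ m) := by gcongr
      _ = _ := by rw [← add_mul, hab, one_mul]
  refine ema_mem h.gossip h.β_pos.le h.β_le hconv ?_ (fun t k => ?_) t k
  rotate_left
  · exact h.hess_contraction k m _ _
  -- The initial value `μ I` must lie in the convex set too; this is where `κ ≤ μ / L ≤ 1` is used.
  have e : ContinuousLinearMap.id ℝ (Vec (d m.succ))
      - (c.Lg m)⁻¹ • (θ.μ m • ContinuousLinearMap.id ℝ (Vec (d m.succ)))
      = (1 - c.μ m / c.Lg m) • ContinuousLinearMap.id ℝ (Vec (d m.succ)) := by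
    rw [h.μ_eq, div_eq_inv_mul]
    module
  simp only [Set.mem_ofPred_eq]
  rw [e, norm_smul, Real.norm_of_nonneg (sub_nonneg.2 (h.valid.μ_div_le m))]
  have h1 := h.valid.κ_le m
  have h3 := h.valid.μ_div_le m
  calc _ ≤ (1 - c.μ m / c.Lg m) * 1 :=
        mul_le_mul_of_nonneg_left ContinuousLinearMap.norm_id_le (by linarith)
    _ ≤ _ := by linarith

theorem smoothV_le (h : Setup c Λ κ ρ θ W p O P ξ) (m : Fin M) (t : ℕ) (k : Fin K) :
    ‖ContinuousLinearMap.id ℝ (Vec (d m.succ)) - (c.Lg m)⁻¹ • smoothV θ W p O σ m t k‖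
      ≤ 1 - κ :=
  (h.smoothV_le_level σ m t k).trans (sub_le_sub_left (h.uniform.κ_le m) 1)

end Setup

end DSMO

end

/-! ### Second moments of the directions and of their noise -/

noncomputable section

namespace DSMO

section Direction

variable {M K : ℕ} {d : Fin (M + 1) → ℕ} {S : Type*} [MeasurableSpace S]
  (θ : Params M) (W : Matrix (Fin K) (Fin K) ℝ) (p : Problem M K d) (O : Oracle M K d S)
  (σ : ℕ → Fin K → Query M → S)

/-- The direction in which an agent moves its outer variable. -/
def direction (t : ℕ) (k : Fin K) : Vec (d 0) :=
  (run θ W O σ t k).s + (-1 : ℝ) ^ M • (run θ W O σ t k).chain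

/-- The chain formed by the estimators without noise. -/
def smoothChain (t : ℕ) (k : Fin K) : Vec (d 0) :=
  chainAt θ.L θ.b (smoothH θ W p O σ t k) (fun m => smoothU θ W p O σ m t k)
    (fun m _ => smoothV θ W p O σ m t k) 0

/-- The direction formed by the estimators without noise. -/
def smoothDirection (t : ℕ) (k : Fin K) : Vec (d 0) :=
  smoothS θ W p O σ t k + (-1 : ℝ) ^ M • smoothChain θ W p O σ t k

end Direction

/-- The bound on the variance of the noise of a single agent. -/
def noiseLevel (K : ℕ) (β ρ : ℝ) : ℝ := β / K + β ^ 2 / (1 - ρ)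

namespace Setup

variable {M K : ℕ} {d : Fin (M + 1) → ℕ} {S Ω : Type*} [MeasurableSpace S] [MeasurableSpace Ω]
  {c : Constants M} {Λ κ ρ : ℝ} {θ : Params M} {W : Matrix (Fin K) (Fin K) ℝ} {p : Problem M K d}
  {O : Oracle M K d S} {P : Measure Ω} {ξ : ℕ → Fin K → Query M → Ω → S}

theorem noiseLevel_nonneg (h : Setup c Λ κ ρ θ W p O P ξ) : 0 ≤ noiseLevel K θ.β ρ := by
  have := h.gossip.one_sub_pos
  have := h.β_pos
  rw [noiseLevel]
  positivity

theorem measurable_ofEucl_noise (h : Setup c Λ κ ρ θ W p O P ξ) (q : Query M) (t : ℕ)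
    (k : Fin K) : Measurable fun ω =>
      noise θ.β W (flat ξ) (chainNoise p O) (points θ W O ξ) q t k ω :=
  (h.isNoise_chain.measurable_noise θ.β q t k).mono (info_le h.meas_flat _) le_rfl

/-- The smooth part is the estimator minus its noise, and both are measurable. -/
theorem measurable_smoothS (h : Setup c Λ κ ρ θ W p O P ξ) (t : ℕ) (k : Fin K) :
    Measurable fun ω => smoothS θ W p O (fun r k q => ξ r k q ω) t k := by
  have e := fun ω => eq_sub_of_add_eq (run_s_split θ W p O ξ t k ω).symm
  simp only [e]
  exact ((h.measurableState t).s k).sub ((ofEucl _).continuous.measurable.comp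
    ((h.isNoise_outer.measurable_noise θ.β Query.outer t k).mono (info_le h.meas_flat _) le_rfl))

theorem measurable_smoothH (h : Setup c Λ κ ρ θ W p O P ξ) (t : ℕ) (k : Fin K) :
    Measurable fun ω => smoothH θ W p O (fun r k q => ξ r k q ω) t k := by
  have e := fun ω => eq_sub_of_add_eq (run_h_split θ W p O ξ t k ω).symm
  simp only [e]
  exact ((h.measurableState t).h k).sub ((ofEucl _).continuous.measurable.comp
    (h.measurable_ofEucl_noise Query.outer t k))

theorem measurable_smoothU (h : Setup c Λ κ ρ θ W p O P ξ) (m : Fin M) (t : ℕ) (k : Fin K) :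
    Measurable fun ω => smoothU θ W p O (fun r k q => ξ r k q ω) m t k := by
  have e := fun ω => eq_sub_of_add_eq (run_u_split θ W p O ξ m t k ω).symm
  simp only [e]
  exact ((h.measurableState t).u k m).sub ((ofEucl _).continuous.measurable.comp
    (h.measurable_ofEucl_noise (Query.inner m) t k))

theorem measurable_smoothV (h : Setup c Λ κ ρ θ W p O P ξ) (m : Fin M) (t : ℕ) (k : Fin K) :
    Measurable fun ω => smoothV θ W p O (fun r k q => ξ r k q ω) m t k := by
  have e := fun ω => eq_sub_of_add_eq (run_v_split θ W p O ξ m 0 t k ω).symm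
  simp only [e]
  exact ((h.measurableState t).v k m 0).sub ((ofEucl _).continuous.measurable.comp
    (h.measurable_ofEucl_noise (Query.hess m 0) t k))

theorem norm_ofEucl_sq_le {E : Type*} [NormedAddCommGroup E] [NormedSpace ℝ E]
    [FiniteDimensional ℝ E] {l : ℝ} (h : EuclBound E l) (x) :
    ‖ofEucl E x‖ ^ 2 ≤ l ^ 2 * ‖x‖ ^ 2 := by
  rw [← mul_pow]
  exact pow_le_pow_left₀ (norm_nonneg _) (ContinuousLinearMap.le_of_opNorm_le _ h.of_le x) 2

/-- The mean squares of the chain and of its noise. -/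
theorem chain_moments (h : Setup c Λ κ ρ θ W p O P ξ)
    (h1 : Λ ^ 2 * ((Λ ^ 2) ^ 2 * noiseLevel K θ.β ρ) ≤ 1)
    (h2 : 2 / κ * (Λ ^ 2 * (Λ ^ 2 * ((Λ ^ 2) ^ 2 * noiseLevel K θ.β ρ))) ≤ κ / 2) (t : ℕ)
    (k : Fin K) :
    (Integrable (fun ω => ‖(run θ W O (fun r k q => ξ r k q ω) t k).chain‖ ^ 2) P ∧
      ∫ ω, ‖(run θ W O (fun r k q => ξ r k q ω) t k).chain‖ ^ 2 ∂P
        ≤ 4 * Λ ^ 2 * (2 * chainFactor Λ κ) ^ M) ∧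
    (Integrable (fun ω => ‖(run θ W O (fun r k q => ξ r k q ω) t k).chain
        - smoothChain θ W p O (fun r k q => ξ r k q ω) t k‖ ^ 2) P ∧
      ∫ ω, ‖(run θ W O (fun r k q => ξ r k q ω) t k).chain
        - smoothChain θ W p O (fun r k q => ξ r k q ω) t k‖ ^ 2 ∂P
        ≤ 4 * Λ ^ 2 * (2 * chainFactor Λ κ) ^ M
          * (Λ ^ 2 * ((Λ ^ 2) ^ 2 * noiseLevel K θ.β ρ))) := by
  have := h.prob
  have hν := h.noiseLevel_nonneg
  have hd := h.isNoise_chain.dom_one h.gossip h.β_pos.le h.β_le h.K_pos (sq_nonneg Λ) t k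
  have key := Dom.chainAt (L := c.Lg) (b := θ.b) (Λ := Λ) (κ := κ)
    (n := fun q ω => Λ ^ 2 * ‖noise θ.β W (flat ξ) (chainNoise p O) (points θ W O ξ) q t k ω‖ ^ 2)
    (fun q => h.isNoise_chain.measurable_norm_sq _ t k q) (fun q ω => by positivity)
    (show 0 ≤ Λ ^ 2 * ((Λ ^ 2) ^ 2 * noiseLevel K θ.β ρ) by positivity) h1 h.uniform.one_le
    h.uniform.κ_pos h.uniform.κ_le_one h.valid.Lg_pos h.uniform.Lg_inv_le h2 hd
    ((h.measurableState t).h k) (h.measurable_smoothH t k) ((h.measurableState t).u k)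
    (fun m => h.measurable_smoothU m t k) ((h.measurableState t).v k)
    (fun m => h.measurable_smoothV m t k) (fun ω => h.smoothH_le _ t k)
    (fun ω m => h.smoothU_le _ m t k) (fun ω m => h.smoothV_le _ m t k)
    (fun ω => by
      rw [run_h_split θ W p O ξ, add_sub_cancel_left]
      exact norm_ofEucl_sq_le (h.uniform.eucl_vec _) _)
    (fun ω m => by
      rw [run_u_split θ W p O ξ, add_sub_cancel_left]
      exact norm_ofEucl_sq_le (h.uniform.eucl_mixed m) _)
    (fun ω m i => by
      rw [run_v_split θ W p O ξ, add_sub_cancel_left]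
      exact norm_ofEucl_sq_le (h.uniform.eucl_end m) _) 0
  simp only [run_chain, h.L_eq, smoothChain]
  exact ⟨⟨key.1.integrable, key.1.integral_le⟩, key.2.integrable, key.2.integral_le⟩

/-- The mean square of the noise of the estimator of the outer gradient. -/
theorem s_moments (h : Setup c Λ κ ρ θ W p O P ξ) (t : ℕ) (k : Fin K) :
    Integrable (fun ω => ‖(run θ W O (fun r k q => ξ r k q ω) t k).s
        - smoothS θ W p O (fun r k q => ξ r k q ω) t k‖ ^ 2) P ∧
      ∫ ω, ‖(run θ W O (fun r k q => ξ r k q ω) t k).s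
        - smoothS θ W p O (fun r k q => ξ r k q ω) t k‖ ^ 2 ∂P
        ≤ Λ ^ 2 * ((Λ ^ 2) ^ 2 * noiseLevel K θ.β ρ) := by
  have := h.prob
  have hν := h.noiseLevel_nonneg
  have hd := h.isNoise_outer.dom_one h.gossip h.β_pos.le h.β_le h.K_pos (sq_nonneg Λ) t k
  have h1 := hd.mul_noise (q := Query.outer) (J' := {Query.outer}) (by simp) rfl (by simp)
    (h.isNoise_outer.measurable_norm_sq _ t k _) (fun ω => by positivity)
  have h2 := h1.mono (Z' := fun ω => ‖(run θ W O (fun r k q => ξ r k q ω) t k).s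
        - smoothS θ W p O (fun r k q => ξ r k q ω) t k‖ ^ 2)
    ((((h.measurableState t).s k).sub (h.measurable_smoothS t k)).norm.pow_const 2)
    (fun ω => by positivity) (fun ω => by
      rw [run_s_split θ W p O ξ, add_sub_cancel_left, mul_one]
      exact norm_ofEucl_sq_le (h.uniform.eucl_vec _) _) subset_rfl le_rfl
    (show 0 ≤ Λ ^ 2 * ((Λ ^ 2) ^ 2 * noiseLevel K θ.β ρ) by positivity)
    (fun q => h.isNoise_outer.measurable_norm_sq _ t k q) (fun q ω => by positivity)
  rw [mul_one] at h2
  exact ⟨h2.integrable, h2.integral_le⟩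

theorem measurable_direction (h : Setup c Λ κ ρ θ W p O P ξ) (t : ℕ) (k : Fin K) :
    Measurable fun ω => direction θ W O (fun r k q => ξ r k q ω) t k :=
  ((h.measurableState t).s k).add (((h.measurableState t).chain k).fun_const_smul _)

theorem measurable_smoothDirection (h : Setup c Λ κ ρ θ W p O P ξ) (t : ℕ) (k : Fin K) :
    Measurable fun ω => smoothDirection θ W p O (fun r k q => ξ r k q ω) t k :=
  (h.measurable_smoothS t k).add ((measurable_chainAt _ _ (h.measurable_smoothH t k)
    (fun m => h.measurable_smoothU m t k) (fun m _ => h.measurable_smoothV m t k)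
    0).fun_const_smul _)

end Setup

theorem norm_add_sq_le {E : Type*} [SeminormedAddCommGroup E] (a b : E) :
    ‖a + b‖ ^ 2 ≤ 2 * ‖a‖ ^ 2 + 2 * ‖b‖ ^ 2 := by
  have := pow_le_pow_left₀ (norm_nonneg _) (norm_add_le a b) 2
  nlinarith [sq_nonneg (‖a‖ - ‖b‖)]

theorem norm_add_neg_one_pow_smul_sq_le {E : Type*} [SeminormedAddCommGroup E] [NormedSpace ℝ E]
    (a b : E) (n : ℕ) : ‖a + (-1 : ℝ) ^ n • b‖ ^ 2 ≤ 2 * ‖a‖ ^ 2 + 2 * ‖b‖ ^ 2 := by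
  have h1 := norm_add_sq_le a ((-1 : ℝ) ^ n • b)
  rwa [norm_smul, norm_pow, norm_neg, norm_one, one_pow, one_mul] at h1

/-- `Z` is integrable and its mean is at most `z`. -/
structure MeanLE {Ω : Type*} [MeasurableSpace Ω] (P : Measure Ω) (Z : Ω → ℝ) (z : ℝ) : Prop where
  integrable : Integrable Z P
  le : ∫ ω, Z ω ∂P ≤ z

namespace MeanLE

variable {Ω : Type*} [MeasurableSpace Ω] {P : Measure Ω} {Z Z' : Ω → ℝ} {z z' : ℝ}

theorem const [IsProbabilityMeasure P] (a : ℝ) : MeanLE P (fun _ => a) a :=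
  ⟨integrable_const a, by simp⟩

theorem add (h : MeanLE P Z z) (h' : MeanLE P Z' z') :
    MeanLE P (fun ω => Z ω + Z' ω) (z + z') :=
  ⟨h.1.add h'.1, by rw [integral_add h.1 h'.1]; exact add_le_add h.2 h'.2⟩

theorem const_mul (h : MeanLE P Z z) {a : ℝ} (ha : 0 ≤ a) :
    MeanLE P (fun ω => a * Z ω) (a * z) :=
  ⟨h.1.const_mul a, by rw [integral_const_mul]; exact mul_le_mul_of_nonneg_left h.2 ha⟩

theorem sum {ι : Type*} (F : Finset ι) {Z : ι → Ω → ℝ} {z : ι → ℝ}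
    (h : ∀ i ∈ F, MeanLE P (Z i) (z i)) : MeanLE P (fun ω => ∑ i ∈ F, Z i ω) (∑ i ∈ F, z i) :=
  ⟨integrable_finsetSum _ fun i hi => (h i hi).1, by
    rw [integral_finsetSum _ fun i hi => (h i hi).1]
    exact Finset.sum_le_sum fun i hi => (h i hi).2⟩

theorem mono (h : MeanLE P Z z) (hz : z ≤ z') : MeanLE P Z z' := ⟨h.1, h.2.trans hz⟩

theorem of_le (h : MeanLE P Z z) (hZ' : Measurable Z') (h0 : ∀ ω, 0 ≤ Z' ω)
    (hle : ∀ ω, Z' ω ≤ Z ω) (hz : z ≤ z') : MeanLE P Z' z' := by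
  have hi : Integrable Z' P := h.1.mono' hZ'.aestronglyMeasurable
    (Filter.Eventually.of_forall fun ω => by rw [Real.norm_of_nonneg (h0 ω)]; exact hle ω)
  exact ⟨hi, (integral_mono hi h.1 hle).trans (h.2.trans hz)⟩

end MeanLE

/-- The mean squares of the directions and of their noises are bounded by `C` and by `C` times the
noise level. -/
theorem exists_direction_moments (M : ℕ) {Λ κ : ℝ} (hΛ : 1 ≤ Λ) (hκ : 0 < κ) :
    ∃ C, 1 ≤ C ∧ ∀ {K : ℕ} {d : Fin (M + 1) → ℕ} {S Ω : Type*} [MeasurableSpace S]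
      [MeasurableSpace Ω] {c : Constants M} {ρ : ℝ} {θ : Params M}
      {W : Matrix (Fin K) (Fin K) ℝ} {p : Problem M K d} {O : Oracle M K d S} {P : Measure Ω}
      {ξ : ℕ → Fin K → Query M → Ω → S}, Setup c Λ κ ρ θ W p O P ξ →
      C * noiseLevel K θ.β ρ ≤ 1 → ∀ t k,
      MeanLE P (fun ω => ‖direction θ W O (fun r k q => ξ r k q ω) t k‖ ^ 2) C ∧
      MeanLE P (fun ω => ‖direction θ W O (fun r k q => ξ r k q ω) t k
          - smoothDirection θ W p O (fun r k q => ξ r k q ω) t k‖ ^ 2)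
        (C * noiseLevel K θ.β ρ) := by
  set C₁ := 4 * Λ ^ 2 * (2 * chainFactor Λ κ) ^ M with hC₁
  have hC₁0 : 0 ≤ C₁ := by
    have : 0 ≤ chainFactor Λ κ := by rw [chainFactor]; positivity
    positivity
  have hΛ0 : 0 < Λ := one_pos.trans_le hΛ
  -- The first two summands turn `C * noiseLevel ≤ 1` into the two smallness conditions of
  -- `chain_moments`, the `1` gives `1 ≤ C`, the next three bound the second moment of the
  -- direction, and the last one bounds that of its noise.
  refine ⟨4 * Λ ^ 8 / κ ^ 2 + Λ ^ 6 + 1 + 4 * Λ ^ 2 + 4 + 2 * C₁ + 2 * Λ ^ 6 * (C₁ + 1), ?_, ?_⟩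
  · have : 0 ≤ 4 * Λ ^ 8 / κ ^ 2 + Λ ^ 6 + 4 * Λ ^ 2 + 4 + 2 * C₁ + 2 * Λ ^ 6 * (C₁ + 1) := by
      positivity
    linarith
  intro K d S Ω _ _ c ρ θ W p O P ξ h hsmall t k
  have := h.prob
  have hν := h.noiseLevel_nonneg
  set ν := noiseLevel K θ.β ρ
  have t1 : 0 ≤ 4 * Λ ^ 8 / κ ^ 2 := by positivity
  have t2 : 0 ≤ Λ ^ 6 := by positivity
  have t3 : 0 ≤ 4 * Λ ^ 2 := by positivity
  have t4 : 0 ≤ 2 * Λ ^ 6 * (C₁ + 1) := by positivity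
  have h1 : Λ ^ 2 * ((Λ ^ 2) ^ 2 * ν) ≤ 1 := by
    have : Λ ^ 2 * ((Λ ^ 2) ^ 2 * ν) = Λ ^ 6 * ν := by ring
    rw [this]
    refine le_trans (mul_le_mul_of_nonneg_right ?_ hν) hsmall
    linarith
  have h2 : 2 / κ * (Λ ^ 2 * (Λ ^ 2 * ((Λ ^ 2) ^ 2 * ν))) ≤ κ / 2 := by
    have e : 2 / κ * (Λ ^ 2 * (Λ ^ 2 * ((Λ ^ 2) ^ 2 * ν))) = 4 * Λ ^ 8 / κ ^ 2 * ν * (κ / 2) := by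
      field_simp
      ring
    rw [e]
    have : 4 * Λ ^ 8 / κ ^ 2 * ν ≤ 1 := by
      refine le_trans (mul_le_mul_of_nonneg_right ?_ hν) hsmall
      linarith
    calc _ ≤ 1 * (κ / 2) := by gcongr
      _ = _ := one_mul _
  obtain ⟨⟨i1, b1⟩, i2, b2⟩ := h.chain_moments h1 h2 t k
  obtain ⟨i3, b3⟩ := h.s_moments t k
  have m1 := MeanLE.mk i1 b1
  have m2 := MeanLE.mk i2 b2
  have m3 := MeanLE.mk i3 b3
  constructor
  · refine (((m3.const_mul zero_le_four).add (.const (4 * Λ ^ 2))).add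
      (m1.const_mul zero_le_two)).of_le ((h.measurable_direction t k).norm.pow_const 2)
      (fun ω => by positivity) (fun ω => ?_) (by linarith)
    refine (norm_add_neg_one_pow_smul_sq_le _ _ _).trans ?_
    have hs := norm_add_sq_le ((run θ W O (fun r k q => ξ r k q ω) t k).s
      - smoothS θ W p O (fun r k q => ξ r k q ω) t k)
      (smoothS θ W p O (fun r k q => ξ r k q ω) t k)
    rw [sub_add_cancel] at hs
    have hs2 := pow_le_pow_left₀ (norm_nonneg _)
      (h.smoothS_le (fun r k q => ξ r k q ω) t k) 2
    linarith
  · refine ((m3.const_mul zero_le_two).add (m2.const_mul zero_le_two)).of_le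
      (((h.measurable_direction t k).sub (h.measurable_smoothDirection t k)).norm.pow_const 2)
      (fun ω => by positivity) (fun ω => ?_) ?_
    · have e : direction θ W O (fun r k q => ξ r k q ω) t k
            - smoothDirection θ W p O (fun r k q => ξ r k q ω) t k
            = ((run θ W O (fun r k q => ξ r k q ω) t k).s
              - smoothS θ W p O (fun r k q => ξ r k q ω) t k)
              + (-1 : ℝ) ^ M • ((run θ W O (fun r k q => ξ r k q ω) t k).chain
                - smoothChain θ W p O (fun r k q => ξ r k q ω) t k) := by
        rw [direction, smoothDirection, smul_sub]
        abel
      simp only [e]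
      exact norm_add_neg_one_pow_smul_sq_le _ _ _
    · have e : 2 * Λ ^ 6 * (C₁ + 1) * ν = 2 * (Λ ^ 2 * ((Λ ^ 2) ^ 2 * ν))
        + 2 * (C₁ * (Λ ^ 2 * ((Λ ^ 2) ^ 2 * ν))) := by ring
      have : 0 ≤ (4 * Λ ^ 8 / κ ^ 2 + Λ ^ 6 + 1 + 4 * Λ ^ 2 + 4 + 2 * C₁) * ν := by positivity
      linarith

end DSMO

end

noncomputable section

namespace DSMO

/-! ### The chain without noise approximates the exact chain -/

/-- The truncated Neumann series with an inexact operator and an inexact argument. -/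
theorem norm_neumann_sub_le {n : ℕ} {L κ : ℝ} (hL : 0 < L) (hκ : 0 < κ)
    {V H : Vec n →L[ℝ] Vec n} (hV : ‖ContinuousLinearMap.id ℝ (Vec n) - L⁻¹ • V‖ ≤ 1 - κ)
    {w a y : Vec n} (hy : H y = a) (i : ℕ) :
    ‖neumann L (fun _ => V) i w - L • y‖ ≤
      ‖ContinuousLinearMap.id ℝ (Vec n) - L⁻¹ • V‖ ^ i * ‖w - L • y‖
        + (‖w - a‖ + ‖V - H‖ * ‖y‖) / κ := by
  -- The geometric decay keeps the actual norm `r`, so that the sharper constant of the level can be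
  -- inserted later. Only the stationary error uses `κ`.
  set r := ‖ContinuousLinearMap.id ℝ (Vec n) - L⁻¹ • V‖ with hr
  set g := ‖w - a‖ + ‖V - H‖ * ‖y‖ with hg
  have hg0 : 0 ≤ g := by positivity
  induction i with
  | zero =>
    have : 0 ≤ g / κ := by positivity
    simpa [neumann] using this
  | succ i ih =>
    set N := neumann L (fun _ => V) i w with hN
    -- The vector `L • y` is the fixed point of the recursion with `H` and `a` in place of `V` and
    -- `w`.
    have e : neumann L (fun _ => V) (i + 1) w - L • y
        = (w - a) + (ContinuousLinearMap.id ℝ (Vec n) - L⁻¹ • V) (N - L • y) - (V - H) y := by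
      have hLL : L • L⁻¹ • V y = V y := by rw [smul_smul, mul_inv_cancel₀ hL.ne', one_smul]
      simp only [neumann, add_apply, sub_apply, smul_apply, ContinuousLinearMap.comp_apply,
        ContinuousLinearMap.id_apply, map_sub, map_smul, smul_sub, hLL, hy, ← hN]
      abel
    have h1 : ‖neumann L (fun _ => V) (i + 1) w - L • y‖ ≤ g + r * ‖N - L • y‖ := by
      rw [e]
      have h2 := norm_sub_le ((w - a) + (ContinuousLinearMap.id ℝ (Vec n) - L⁻¹ • V) (N - L • y))
        ((V - H) y)
      have h3 := norm_add_le (w - a) ((ContinuousLinearMap.id ℝ (Vec n) - L⁻¹ • V) (N - L • y))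
      have h4 := (ContinuousLinearMap.id ℝ (Vec n) - L⁻¹ • V).le_opNorm (N - L • y)
      have h5 := (V - H).le_opNorm y
      linarith
    have hr0 : 0 ≤ r := norm_nonneg _
    have h6 : r * ‖N - L • y‖ ≤ r * (r ^ i * ‖w - L • y‖ + g / κ) := by gcongr
    have h7 : r * (g / κ) ≤ (1 - κ) * (g / κ) := by gcongr
    have h8 : (1 - κ) * (g / κ) = g / κ - g := by field_simp
    rw [pow_succ']
    linarith

/-- The sum of the errors of the estimators that enter the chain. -/
def chainError {M K : ℕ} {d : Fin (M + 1) → ℕ} (p : Problem M K d) (x : Vec (d 0))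
    (h : Vec (d (Fin.last M))) (u : (m : Fin M) → (Vec (d m.succ) →L[ℝ] Vec (d m.castSucc)))
    (v : (m : Fin M) → (Vec (d m.succ) →L[ℝ] Vec (d m.succ))) : ℝ :=
  ‖h - p.f₂ x (p.best (Fin.last M) x)‖
    + ∑ m, (‖u m - p.U m (p.best m.castSucc x) (p.best m.succ x)‖
      + ‖v m - p.H m (p.best m.castSucc x) (p.best m.succ x)‖)

/-- At each level the truncated Neumann series approximates `L H⁻¹ a`, where `a` is the exact vector
of the level above; the errors of the operators and of the incoming vector enter linearly with
factors depending only on `Λ` and `κ`. -/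
theorem exists_chainAt_sub_adj {M : ℕ} (d : Fin (M + 1) → ℕ) {Λ κ : ℝ} (hΛ : 1 ≤ Λ) (hκ : 0 < κ)
    (i : Fin (M + 1)) :
    ∃ C, 0 ≤ C ∧ ∀ {K : ℕ} {p : Problem M K d} {L : Fin M → ℝ}, p.Regular Λ κ L →
      ∀ (x : Vec (d 0)) (b : Fin M → ℕ) (h : Vec (d (Fin.last M)))
        (u : (m : Fin M) → (Vec (d m.succ) →L[ℝ] Vec (d m.castSucc)))
        (v : (m : Fin M) → (Vec (d m.succ) →L[ℝ] Vec (d m.succ))) (τ : ℝ), 0 ≤ τ → τ ≤ 1 →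
        (∀ m, ‖u m‖ ≤ Λ) →
        (∀ m, ‖ContinuousLinearMap.id ℝ (Vec (d m.succ)) - (L m)⁻¹ • v m‖ ≤ 1 - κ) →
        (∀ m, ‖ContinuousLinearMap.id ℝ (Vec (d m.succ)) - (L m)⁻¹ • v m‖ ^ b m ≤ τ) →
        ‖chainAt L b h u (fun m _ => v m) i - p.adj x i‖ ≤ C * (chainError p x h u v + τ) := by
  have nonneg_term : ∀ {K : ℕ} (p : Problem M K d) (x : Vec (d 0))
      (u : (m : Fin M) → (Vec (d m.succ) →L[ℝ] Vec (d m.castSucc)))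
      (v : (m : Fin M) → (Vec (d m.succ) →L[ℝ] Vec (d m.succ))) (m : Fin M),
      0 ≤ ‖u m - p.U m (p.best m.castSucc x) (p.best m.succ x)‖
      + ‖v m - p.H m (p.best m.castSucc x) (p.best m.succ x)‖ := fun p x u v m => by positivity
  induction i using Fin.reverseInduction with
  | last =>
    refine ⟨1, zero_le_one, fun {K p L} hp x b h u v τ hτ _ _ _ _ => ?_⟩
    simp only [Problem.adj, Fin.reverseInduction_last, chainAt_last, one_mul, chainError]
    have := Finset.sum_nonneg fun m (_ : m ∈ Finset.univ) => nonneg_term p x u v m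
    linarith
  | cast m ih =>
    obtain ⟨C, hC, hl⟩ := ih
    obtain ⟨B, hB, hb⟩ := exists_adj_bound d hΛ hκ m.succ
    refine ⟨Λ * (Λ * ((C + B + Λ ^ 2 / κ * B) + (C + Λ / κ * B) / κ)) + Λ / κ * B, by positivity,
      fun {K p L} hp x b h u v τ hτ hτ1 hu hv hvb => ?_⟩
    have hlm := hl hp x b h u v τ hτ hτ1 hu hv hvb
    have hbm := hb hp x
    set E := chainError p x h u v + τ with hE
    set A := chainAt L b h u (fun m _ => v m) m.succ with hA
    set a := p.adj x m.succ with ha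
    set Hm := p.H m (p.best m.castSucc x) (p.best m.succ x) with hHm
    set Um := p.U m (p.best m.castSucc x) (p.best m.succ x) with hUm
    set y := Ring.inverse Hm a with hy
    have hHy : Hm y = a := apply_inverse (hp.L_pos m) hκ (hp.H_contraction m _ _) a
    have e1 : p.adj x m.castSucc = Um y := by
      simp only [Problem.adj, Fin.reverseInduction_castSucc, hUm, hy, ha, hHm]
    have hsum := Finset.single_le_sum (fun m (_ : m ∈ Finset.univ) => nonneg_term p x u v m)
      (Finset.mem_univ m)
    have hE0 : 0 ≤ chainError p x h u v :=
      add_nonneg (norm_nonneg _) (Finset.sum_nonneg fun m _ => nonneg_term p x u v m)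
    have hE1 : ‖u m - Um‖ + ‖v m - Hm‖ ≤ E := by
      have := norm_nonneg (h - p.f₂ x (p.best (Fin.last M) x))
      rw [hE, chainError]
      linarith
    have hE2 : ‖u m - Um‖ ≤ E := le_trans (le_add_of_nonneg_right (norm_nonneg _)) hE1
    have hE3 : ‖v m - Hm‖ ≤ E := le_trans (le_add_of_nonneg_left (norm_nonneg _)) hE1
    have hE4 : τ ≤ E := by linarith
    have hEE : 0 ≤ E := by linarith
    have hyb : ‖y‖ ≤ Λ / κ * B :=
      (hp.inverse_bound m _ _ a).trans (mul_le_mul_of_nonneg_left hbm (by positivity))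
    have hL := hp.L_pos m
    have hLy : ‖L m • y‖ ≤ Λ ^ 2 / κ * B := by
      rw [norm_smul, Real.norm_of_nonneg hL.le]
      calc _ ≤ Λ * (Λ / κ * B) := by gcongr; exact hp.L_le m
        _ = _ := by ring
    -- This distance is bounded but not small. It is multiplied by the truncation error `τ`, and `τ
    -- ≤ 1` together with `τ ≤ E` makes the product linear in `E`.
    have hAy : ‖A - L m • y‖ ≤ C * E + (B + Λ ^ 2 / κ * B) := by
      have := norm_sub_le_norm_sub_add_norm_sub A a (L m • y)
      have := norm_sub_le a (L m • y)
      linarith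
    have hN := norm_neumann_sub_le (w := A) hL hκ (hv m) hHy (b m)
    set N := neumann (L m) (fun _ => v m) (b m) A with hNdef
    have hN2 : ‖N - L m • y‖ ≤ ((C + B + Λ ^ 2 / κ * B) + (C + Λ / κ * B) / κ) * E := by
      refine hN.trans ?_
      have h1 : ‖ContinuousLinearMap.id ℝ (Vec (d m.succ)) - (L m)⁻¹ • v m‖ ^ b m
          * ‖A - L m • y‖ ≤ τ * (C * E + (B + Λ ^ 2 / κ * B)) := by
        gcongr
        exact hvb m
      have h2 : τ * (C * E) ≤ 1 * (C * E) := by gcongr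
      have h3 : τ * (B + Λ ^ 2 / κ * B) ≤ E * (B + Λ ^ 2 / κ * B) := by gcongr
      have h4 : (‖A - a‖ + ‖v m - Hm‖ * ‖y‖) / κ ≤ (C * E + E * (Λ / κ * B)) / κ := by gcongr
      have h5 : (C * E + E * (Λ / κ * B)) / κ = (C + Λ / κ * B) / κ * E := by ring
      linarith
    have hLN : ‖(L m)⁻¹ • N - y‖
        ≤ Λ * (((C + B + Λ ^ 2 / κ * B) + (C + Λ / κ * B) / κ) * E) := by
      have e : (L m)⁻¹ • N - y = (L m)⁻¹ • (N - L m • y) := by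
        rw [smul_sub, smul_smul, inv_mul_cancel₀ hL.ne', one_smul]
      rw [e, norm_smul, Real.norm_of_nonneg (inv_nonneg.2 hL.le)]
      gcongr
      exact hp.L_inv_le m
    rw [chainAt_castSucc, e1]
    have e2 : u m ((L m)⁻¹ • N) - Um y = u m ((L m)⁻¹ • N - y) + (u m - Um) y := by
      simp only [map_sub, sub_apply]
      abel
    rw [e2]
    have h1 := (ContinuousLinearMap.le_of_opNorm_le _ (hu m) ((L m)⁻¹ • N - y))
    have h2 := (u m - Um).le_opNorm y
    have h3 : Λ * ‖(L m)⁻¹ • N - y‖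
        ≤ Λ * (Λ * (((C + B + Λ ^ 2 / κ * B) + (C + Λ / κ * B) / κ) * E)) := by gcongr
    have h4 : ‖u m - Um‖ * ‖y‖ ≤ E * (Λ / κ * B) := by gcongr
    have h5 := norm_add_le (u m ((L m)⁻¹ • N - y)) ((u m - Um) y)
    linarith

end DSMO

end

noncomputable section

namespace DSMO

/-! ### The bias of the direction -/

/-- The error of an agent is its distance from the average of the agents plus the error of that
average. Gossip controls the former; the latter obeys the recursion without `W` and tracks `τ`. -/
theorem sum_avg_ema_sub_sq_le {K : ℕ} {W : Matrix (Fin K) (Fin K) ℝ} {ρ β : ℝ}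
    (hW : IsGossip W ρ) (hβ0 : 0 < β) (hβ1 : β ≤ 1) (hK : 1 ≤ K) {E : Type*}
    [NormedAddCommGroup E] [NormedSpace ℝ E] [FiniteDimensional ℝ E] {init : E}
    {inp : ℕ → Fin K → E} {B : ℝ} (hB : ∀ t k, ‖inp t k‖ ≤ B) {τ : ℕ → E} {A : ℝ}
    (hA : ‖init - τ 0‖ ≤ A) {l : ℝ} {e s : ℕ → ℝ}
    (he : ∀ t, ‖avg (inp t) - τ t‖ ^ 2 ≤ l * e t)
    (hs : ∀ t, ‖τ t - τ (t + 1)‖ ^ 2 ≤ l * s t) (T : ℕ) :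
    ∑ t ∈ Finset.range T, avg (fun k => ‖ema β W init inp t k - τ t‖ ^ 2) ≤
      8 * euclConst E * B ^ 2 * (T * (β / (1 - ρ)) ^ 2) + 2 * A ^ 2 / β
        + 4 * l * ∑ t ∈ Finset.range T, e t + 4 * l / β ^ 2 * ∑ t ∈ Finset.range T, s t := by
  have h0 : avg (ema β W init inp 0) = init := avg_const hK init
  have h1 : ∀ t, avg (fun k => ‖ema β W init inp t k - τ t‖ ^ 2) ≤
      2 * (euclConst E * (4 * (β / (1 - ρ)) ^ 2 * B ^ 2))
        + 2 * ‖avg (ema β W init inp t) - τ t‖ ^ 2 := by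
    intro t
    have h2 : ∀ k, ‖ema β W init inp t k - τ t‖ ^ 2 ≤
        2 * ‖ema β W init inp t k - avg (ema β W init inp t)‖ ^ 2
          + 2 * ‖avg (ema β W init inp t) - τ t‖ ^ 2 := fun k => by
      have := norm_add_sq_le (ema β W init inp t k - avg (ema β W init inp t))
        (avg (ema β W init inp t) - τ t)
      rwa [sub_add_sub_cancel] at this
    refine (avg_mono h2).trans ?_
    rw [avg_add, avg_mul, avg_const hK]
    have := disp_ema_le hW hβ0.le hβ1 hK (init := init) hB t
    rw [disp] at this
    linarith
  have h3 := sum_norm_sub_sq_le (a := fun t => avg (ema β W init inp t)) (b := fun t => avg (inp t))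
    (τ := τ) hβ0 hβ1 (avg_ema_succ hW init inp) T
  simp only [h0] at h3
  have h4 : ‖init - τ 0‖ ^ 2 / β ≤ A ^ 2 / β := by gcongr
  have h5 : ∑ t ∈ Finset.range T, (2 * ‖avg (inp t) - τ t‖ ^ 2
      + 2 / β ^ 2 * ‖τ t - τ (t + 1)‖ ^ 2) ≤
      ∑ t ∈ Finset.range T, (2 * (l * e t) + 2 / β ^ 2 * (l * s t)) := by
    refine Finset.sum_le_sum fun t _ => ?_
    have := he t
    have := hs t
    gcongr
  simp only [Finset.sum_add_distrib, ← Finset.mul_sum] at h3 h5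
  refine (Finset.sum_le_sum fun t _ => h1 t).trans ?_
  rw [Finset.sum_add_distrib, Finset.sum_const, Finset.card_range, nsmul_eq_mul,
    ← Finset.mul_sum]
  have e1 : 2 * A ^ 2 / β = 2 * (A ^ 2 / β) := by ring
  have e2 : 4 * l / β ^ 2 * ∑ t ∈ Finset.range T, s t
    = 2 * (2 / β ^ 2 * (l * ∑ t ∈ Finset.range T, s t)) := by ring
  rw [e1, e2]
  linarith

theorem avg_sub_avg_sq_le_of_lip {K : ℕ} {A B E : Type*} [NormedAddCommGroup A]
    [NormedAddCommGroup B] [NormedAddCommGroup E] [NormedSpace ℝ E] {φ : Fin K → A → B → E}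
    {l : ℝ} (hφ : ∀ k a a' y y', ‖φ k a y - φ k a' y'‖ ≤ l * (‖a - a'‖ + ‖y - y'‖))
    (a : Fin K → A) (y : Fin K → B) (a' : A) (y' : B) :
    ‖avg (fun k => φ k (a k) (y k)) - avg (fun k => φ k a' y')‖ ^ 2 ≤
      2 * l ^ 2 * (avg (fun k => ‖a k - a'‖ ^ 2) + avg (fun k => ‖y k - y'‖ ^ 2)) := by
  rw [← avg_sub]
  refine (norm_avg_sq_le _).trans ((avg_mono
    (Y := fun k => 2 * l ^ 2 * (‖a k - a'‖ ^ 2 + ‖y k - y'‖ ^ 2)) fun k => ?_).trans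
    (le_of_eq ?_))
  · refine (pow_le_pow_left₀ (norm_nonneg _) (hφ k _ _ _ _) 2).trans ?_
    nlinarith [mul_nonneg (sq_nonneg l) (sq_nonneg (‖a k - a'‖ - ‖y k - y'‖))]
  · rw [avg_mul, avg_add]

section Path

variable {M K : ℕ} {d : Fin (M + 1) → ℕ} {S : Type*} [MeasurableSpace S]
  (θ : Params M) (W : Matrix (Fin K) (Fin K) ℝ) (p : Problem M K d) (O : Oracle M K d S)
  (σ : ℕ → Fin K → Query M → S)

/-- The mean squared distance of the points of the agents from the best responses to the averaged
iterate. -/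
def pointError (t : ℕ) : ℝ :=
  ∑ i, avg fun k => ‖(run θ W O σ t k).pt i - p.best i (xBar θ W O σ t)‖ ^ 2

theorem le_pointError (t : ℕ) (i : Fin (M + 1)) :
    avg (fun k => ‖(run θ W O σ t k).pt i - p.best i (xBar θ W O σ t)‖ ^ 2)
      ≤ pointError θ W p O σ t :=
  Finset.single_le_sum (f := fun i => avg fun k =>
    ‖(run θ W O σ t k).pt i - p.best i (xBar θ W O σ t)‖ ^ 2)
    (fun i _ => avg_nonneg fun k => by positivity) (Finset.mem_univ i)

/-- The bound on the accumulated squared errors of the estimators without noise. -/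
def smoothBound (Λ κ ρ : ℝ) (T : ℕ) : ℝ :=
  32 * Λ ^ 6 * (T * (θ.β / (1 - ρ)) ^ 2) + 18 * Λ ^ 2 / θ.β
    + 16 * Λ ^ 2 * (κ⁻¹ ^ M) ^ 2 * ∑ t ∈ Finset.range T, pointError θ W p O σ t
    + 16 * Λ ^ 2 * (κ⁻¹ ^ M) ^ 2 / θ.β ^ 2
      * ∑ t ∈ Finset.range T, ‖xBar θ W O σ t - xBar θ W O σ (t + 1)‖ ^ 2

variable {θ W p O σ} {Λ κ ρ : ℝ} {L : Fin M → ℝ}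

/-- The target is the averaged derivative at the best responses to `x̄`. The Lipschitz property of
`φ` bounds the input errors by `pointError`, and that of the best responses bounds the drift of the
target by the movement of `x̄`. The bound `2 * Λ` leaves room for the Hessians. -/
theorem sum_avg_smooth_sub_sq_le (hp : p.Regular Λ κ L) (hW : IsGossip W ρ) (hβ0 : 0 < θ.β)
    (hβ1 : θ.β ≤ 1) {E : Type*} [NormedAddCommGroup E] [NormedSpace ℝ E] [FiniteDimensional ℝ E]
    (hE : EuclBound E Λ) {i j : Fin (M + 1)} {φ : Fin K → Vec (d i) → Vec (d j) → E}
    (hφ : ∀ k a a' y y', ‖φ k a y - φ k a' y'‖ ≤ Λ * (‖a - a'‖ + ‖y - y'‖))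
    (hb : ∀ k a y, ‖φ k a y‖ ≤ 2 * Λ) {init : E} (h0 : ‖init‖ ≤ Λ) (T : ℕ) :
    ∑ t ∈ Finset.range T, avg (fun k => ‖ema θ.β W init (fun t k =>
      φ k ((run θ W O σ t k).pt i) ((run θ W O σ t k).pt j)) t k
        - avg (fun k => φ k (p.best i (xBar θ W O σ t)) (p.best j (xBar θ W O σ t)))‖ ^ 2)
      ≤ smoothBound θ W p O σ Λ κ ρ T := by
  have hΛ := hp.Λ_pos
  have hκ := hp.κ_pos
  have hq : 1 ≤ κ⁻¹ ^ M := one_le_pow₀ ((one_le_inv₀ hκ).2 hp.κ_le_one)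
  have hq2 : 1 ≤ (κ⁻¹ ^ M) ^ 2 := one_le_pow₀ hq
  have key := sum_avg_ema_sub_sq_le hW hβ0 hβ1 hp.K_pos (init := init)
    (inp := fun t k => φ k ((run θ W O σ t k).pt i) ((run θ W O σ t k).pt j))
    (fun t k => hb k _ _)
    (τ := fun t => avg (fun k => φ k (p.best i (xBar θ W O σ t)) (p.best j (xBar θ W O σ t))))
    (A := 3 * Λ) ?_ (l := 4 * Λ ^ 2 * (κ⁻¹ ^ M) ^ 2) (e := pointError θ W p O σ)
    (s := fun t => ‖xBar θ W O σ t - xBar θ W O σ (t + 1)‖ ^ 2) ?_ ?_ T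
  · refine key.trans ?_
    rw [smoothBound]
    have h1 : 8 * euclConst E * (2 * Λ) ^ 2 * (T * (θ.β / (1 - ρ)) ^ 2)
        ≤ 32 * Λ ^ 6 * (T * (θ.β / (1 - ρ)) ^ 2) := by
      have := hE.const_le
      calc _ ≤ 8 * Λ ^ 4 * (2 * Λ) ^ 2 * (T * (θ.β / (1 - ρ)) ^ 2) := by gcongr
        _ = _ := by ring
    have e1 : 2 * (3 * Λ) ^ 2 / θ.β = 18 * Λ ^ 2 / θ.β := by ring
    have e2 : 4 * (4 * Λ ^ 2 * (κ⁻¹ ^ M) ^ 2) = 16 * Λ ^ 2 * (κ⁻¹ ^ M) ^ 2 := by ring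
    rw [e1, e2]
    linarith
  · refine (norm_sub_le _ _).trans ?_
    have := norm_avg_le_of_le hp.K_pos fun k =>
      hb k (p.best i (xBar θ W O σ 0)) (p.best j (xBar θ W O σ 0))
    linarith
  · intro t
    refine (avg_sub_avg_sq_le_of_lip hφ _ _ _ _).trans ?_
    have h1 := le_pointError θ W p O σ t i
    have h2 := le_pointError θ W p O σ t j
    have h3 : 0 ≤ pointError θ W p O σ t :=
      Finset.sum_nonneg fun i _ => avg_nonneg fun k => by positivity
    calc _ ≤ 2 * Λ ^ 2 * (pointError θ W p O σ t + pointError θ W p O σ t) := by gcongr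
      _ = 4 * Λ ^ 2 * 1 * pointError θ W p O σ t := by ring
      _ ≤ _ := by gcongr
  · intro t
    have h1 : ‖avg (fun k => φ k (p.best i (xBar θ W O σ t)) (p.best j (xBar θ W O σ t)))
        - avg (fun k => φ k (p.best i (xBar θ W O σ (t + 1)))
          (p.best j (xBar θ W O σ (t + 1))))‖
        ≤ 2 * Λ * κ⁻¹ ^ M * ‖xBar θ W O σ t - xBar θ W O σ (t + 1)‖ := by
      refine norm_avg_sub_avg_le hp.K_pos fun k => (hφ k _ _ _ _).trans ?_
      have a1 := hp.best_lip i (xBar θ W O σ t) (xBar θ W O σ (t + 1))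
      have a2 := hp.best_lip j (xBar θ W O σ t) (xBar θ W O σ (t + 1))
      calc _ ≤ Λ * (κ⁻¹ ^ M * ‖xBar θ W O σ t - xBar θ W O σ (t + 1)‖
            + κ⁻¹ ^ M * ‖xBar θ W O σ t - xBar θ W O σ (t + 1)‖) := by gcongr
        _ = _ := by ring
    refine (pow_le_pow_left₀ (norm_nonneg _) h1 2).trans (le_of_eq ?_)
    ring

end Path

/-- The Hessian is `L` times the difference of the identity and a contraction. -/
theorem norm_hess₂₂_le {M K : ℕ} {d : Fin (M + 1) → ℕ} {p : Problem M K d} {Λ κ : ℝ}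
    {L : Fin M → ℝ} (hp : p.Regular Λ κ L) (k m a y) : ‖hess₂₂ (p.g k m) a y‖ ≤ 2 * Λ := by
  have h1 := hp.contraction k m a y
  have hL := hp.L_pos m
  have e : hess₂₂ (p.g k m) a y = L m • (ContinuousLinearMap.id ℝ (Vec (d m.succ))
      - (ContinuousLinearMap.id ℝ (Vec (d m.succ)) - (L m)⁻¹ • hess₂₂ (p.g k m) a y)) := by
    rw [sub_sub_cancel, smul_smul, mul_inv_cancel₀ hL.ne', one_smul]
  rw [e, norm_smul, Real.norm_of_nonneg hL.le, mul_comm 2 Λ]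
  refine mul_le_mul (hp.L_le m) ?_ (norm_nonneg _) hp.Λ_pos.le
  have h2 := norm_sub_le (ContinuousLinearMap.id ℝ (Vec (d m.succ)))
    (ContinuousLinearMap.id ℝ (Vec (d m.succ)) - (L m)⁻¹ • hess₂₂ (p.g k m) a y)
  have h3 : ‖ContinuousLinearMap.id ℝ (Vec (d m.succ))‖ ≤ 1 := ContinuousLinearMap.norm_id_le
  linarith [hp.κ_pos]

theorem chainError_add_sq_le {M K : ℕ} {d : Fin (M + 1) → ℕ} (p : Problem M K d) (x : Vec (d 0))
    (h : Vec (d (Fin.last M))) (u : (m : Fin M) → (Vec (d m.succ) →L[ℝ] Vec (d m.castSucc)))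
    (v : (m : Fin M) → (Vec (d m.succ) →L[ℝ] Vec (d m.succ))) (τ : ℝ) :
    (chainError p x h u v + τ) ^ 2 ≤ 3 * ‖h - p.f₂ x (p.best (Fin.last M) x)‖ ^ 2
      + 6 * M * ∑ m, (‖u m - p.U m (p.best m.castSucc x) (p.best m.succ x)‖ ^ 2
        + ‖v m - p.H m (p.best m.castSucc x) (p.best m.succ x)‖ ^ 2) + 3 * τ ^ 2 := by
  set A := ‖h - p.f₂ x (p.best (Fin.last M) x)‖ with hA
  set a : Fin M → ℝ := fun m => ‖u m - p.U m (p.best m.castSucc x) (p.best m.succ x)‖ with ha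
  set b : Fin M → ℝ := fun m => ‖v m - p.H m (p.best m.castSucc x) (p.best m.succ x)‖ with hb
  have h1 : (∑ m, (a m + b m)) ^ 2 ≤ M * ∑ m, (a m + b m) ^ 2 := by
    have := sq_sum_le_card_mul_sum_sq (s := Finset.univ) (f := fun m => a m + b m)
    simpa using this
  have h2 : ∑ m, (a m + b m) ^ 2 ≤ 2 * ∑ m, (a m ^ 2 + b m ^ 2) := by
    rw [Finset.mul_sum]
    exact Finset.sum_le_sum fun m _ => by nlinarith [sq_nonneg (a m - b m)]
  have h3 : (M : ℝ) * ∑ m, (a m + b m) ^ 2 ≤ M * (2 * ∑ m, (a m ^ 2 + b m ^ 2)) := by gcongr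
  have e : chainError p x h u v = A + ∑ m, (a m + b m) := rfl
  rw [e]
  nlinarith [sq_nonneg (A - ∑ m, (a m + b m)), sq_nonneg (A - τ),
    sq_nonneg (∑ m, (a m + b m) - τ)]

/-- The accumulated squared bias of the averaged direction. -/
theorem exists_sum_bias_le {M : ℕ} (d : Fin (M + 1) → ℕ) {Λ κ : ℝ} (hΛ : 1 ≤ Λ) (hκ : 0 < κ) :
    ∃ C, 0 ≤ C ∧ ∀ {K : ℕ} {S Ω : Type*} [MeasurableSpace S]
      [MeasurableSpace Ω] {c : Constants M} {ρ : ℝ} {θ : Params M}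
      {W : Matrix (Fin K) (Fin K) ℝ} {p : Problem M K d} {O : Oracle M K d S} {P : Measure Ω}
      {ξ : ℕ → Fin K → Query M → Ω → S}, Setup c Λ κ ρ θ W p O P ξ →
      ∀ (τ : ℝ), 0 ≤ τ → τ ≤ 1 → (∀ m, (1 - c.κ m) ^ θ.b m ≤ τ) →
      ∀ (σ : ℕ → Fin K → Query M → S) (T : ℕ),
        ∑ t ∈ Finset.range T, ‖avg (smoothDirection θ W p O σ t)
            - gradient p.F (xBar θ W O σ t)‖ ^ 2
          ≤ C * (smoothBound θ W p O σ Λ κ ρ T + T * τ ^ 2) := by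
  obtain ⟨C, hC, hc⟩ := exists_chainAt_sub_adj d hΛ hκ 0
  refine ⟨2 + 2 * C ^ 2 * (3 + 6 * M * (M * 2)), by positivity,
    fun {K S Ω} _ _ {c ρ θ W p O P ξ} h τ hτ hτ1 hb σ T => ?_⟩
  have hp := h.regular
  set R := smoothBound θ W p O σ Λ κ ρ T with hR
  set x := fun t => xBar θ W O σ t with hx
  have hbest : ∀ y, p.best 0 y = y := fun y => by simp [Problem.best]
  have hS : ∑ t ∈ Finset.range T, avg (fun k => ‖smoothS θ W p O σ t k
      - p.f₁ (x t) (p.best (Fin.last M) (x t))‖ ^ 2) ≤ R := by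
    have := sum_avg_smooth_sub_sq_le (O := O) (σ := σ) hp h.gossip h.β_pos h.β_le (h.uniform.eucl_vec 0)
      (i := 0) (j := Fin.last M) hp.f_lip₁ (fun k a y => (hp.f_bound₁ k a y).trans
        (by linarith [hp.Λ_pos])) (init := 0) (by simpa using hp.Λ_pos.le) T
    simp only [hbest] at this
    exact this
  have hH : ∑ t ∈ Finset.range T, avg (fun k => ‖smoothH θ W p O σ t k
      - p.f₂ (x t) (p.best (Fin.last M) (x t))‖ ^ 2) ≤ R := by
    have := sum_avg_smooth_sub_sq_le (O := O) (σ := σ) hp h.gossip h.β_pos h.β_le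
      (h.uniform.eucl_vec (Fin.last M))
      (i := 0) (j := Fin.last M) hp.f_lip₂ (fun k a y => (hp.f_bound₂ k a y).trans
        (by linarith [hp.Λ_pos])) (init := 0) (by simpa using hp.Λ_pos.le) T
    simp only [hbest] at this
    exact this
  have hU : ∀ m : Fin M, ∑ t ∈ Finset.range T, avg (fun k => ‖smoothU θ W p O σ m t k
      - p.U m (p.best m.castSucc (x t)) (p.best m.succ (x t))‖ ^ 2) ≤ R := fun m =>
    sum_avg_smooth_sub_sq_le (O := O) (σ := σ) hp h.gossip h.β_pos h.β_le (h.uniform.eucl_mixed m)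
      (φ := fun k => hess₁₂ (p.g k m)) (fun k => hp.lip₁₂ k m)
      (fun k a y => (hp.bound₁₂ k m a y).trans (by linarith [hp.Λ_pos])) (init := 0)
      (by simpa using hp.Λ_pos.le) T
  have hV : ∀ m : Fin M, ∑ t ∈ Finset.range T, avg (fun k => ‖smoothV θ W p O σ m t k
      - p.H m (p.best m.castSucc (x t)) (p.best m.succ (x t))‖ ^ 2) ≤ R := fun m =>
    sum_avg_smooth_sub_sq_le (O := O) (σ := σ) hp h.gossip h.β_pos h.β_le (h.uniform.eucl_end m)
      (φ := fun k => hess₂₂ (p.g k m)) (fun k => hp.lip₂₂ k m)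
      (fun k a y => norm_hess₂₂_le hp k m a y)
      (init := θ.μ m • ContinuousLinearMap.id ℝ (Vec (d m.succ))) (by
        have h1 : ‖ContinuousLinearMap.id ℝ (Vec (d m.succ))‖ ≤ 1 :=
          ContinuousLinearMap.norm_id_le
        have h2 := h.valid.μ_pos m
        rw [h.μ_eq, norm_smul, Real.norm_of_nonneg h2.le]
        have h3 := h.uniform.μ_le m
        nlinarith) T
  have key : ∀ t, ‖avg (smoothDirection θ W p O σ t) - gradient p.F (x t)‖ ^ 2 ≤
      2 * avg (fun k => ‖smoothS θ W p O σ t k - p.f₁ (x t) (p.best (Fin.last M) (x t))‖ ^ 2)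
      + 2 * C ^ 2 * (3 * avg (fun k => ‖smoothH θ W p O σ t k
            - p.f₂ (x t) (p.best (Fin.last M) (x t))‖ ^ 2)
          + 6 * M * ∑ m, (avg (fun k => ‖smoothU θ W p O σ m t k
              - p.U m (p.best m.castSucc (x t)) (p.best m.succ (x t))‖ ^ 2)
            + avg (fun k => ‖smoothV θ W p O σ m t k
              - p.H m (p.best m.castSucc (x t)) (p.best m.succ (x t))‖ ^ 2))
          + 3 * τ ^ 2) := by
    intro t
    -- The bias is estimated for each agent separately and then averaged by convexity of the squared
    -- norm.
    have hpt : ∀ k, ‖smoothDirection θ W p O σ t k - gradient p.F (x t)‖ ^ 2 ≤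
        2 * ‖smoothS θ W p O σ t k - p.f₁ (x t) (p.best (Fin.last M) (x t))‖ ^ 2
        + 2 * C ^ 2 * (3 * ‖smoothH θ W p O σ t k
              - p.f₂ (x t) (p.best (Fin.last M) (x t))‖ ^ 2
            + 6 * M * ∑ m, (‖smoothU θ W p O σ m t k
                - p.U m (p.best m.castSucc (x t)) (p.best m.succ (x t))‖ ^ 2
              + ‖smoothV θ W p O σ m t k
                - p.H m (p.best m.castSucc (x t)) (p.best m.succ (x t))‖ ^ 2)
            + 3 * τ ^ 2) := by
      intro k
      have hch := hc hp (x t) θ.b (smoothH θ W p O σ t k) (fun m => smoothU θ W p O σ m t k)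
        (fun m => smoothV θ W p O σ m t k) τ hτ hτ1 (fun m => h.smoothU_le σ m t k)
        (fun m => h.smoothV_le σ m t k) (fun m =>
          (pow_le_pow_left₀ (norm_nonneg _) (h.smoothV_le_level σ m t k) _).trans (hb m))
      have h1 := pow_le_pow_left₀ (norm_nonneg _) hch 2
      rw [mul_pow] at h1
      have h2 := mul_le_mul_of_nonneg_left (chainError_add_sq_le p (x t) (smoothH θ W p O σ t k)
        (fun m => smoothU θ W p O σ m t k) (fun m => smoothV θ W p O σ m t k) τ) (sq_nonneg C)
      have e : smoothDirection θ W p O σ t k - gradient p.F (x t)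
          = (smoothS θ W p O σ t k - p.f₁ (x t) (p.best (Fin.last M) (x t)))
            + (-1 : ℝ) ^ M • (smoothChain θ W p O σ t k - p.adj (x t) 0) := by
        rw [hp.gradient_F, smoothDirection, smul_sub]
        abel
      rw [e]
      refine (norm_add_neg_one_pow_smul_sq_le _ _ _).trans ?_
      rw [smoothChain, h.L_eq]
      linarith
    have hgr : gradient p.F (x t) = avg (fun _ : Fin K => gradient p.F (x t)) :=
      (avg_const h.K_pos _).symm
    rw [hgr, ← avg_sub]
    refine (norm_avg_sq_le _).trans ((avg_mono hpt).trans (le_of_eq ?_))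
    rw [avg_add, avg_mul, avg_mul, avg_add, avg_add, avg_mul, avg_mul, avg_const h.K_pos]
    congr 6
    simp only [avg, smul_eq_mul]
    rw [Finset.sum_comm, Finset.mul_sum]
    refine Finset.sum_congr rfl fun m _ => ?_
    rw [Finset.sum_add_distrib, mul_add]
  refine (Finset.sum_le_sum fun t _ => key t).trans ?_
  have hUV : ∑ t ∈ Finset.range T, ∑ m, (avg (fun k => ‖smoothU θ W p O σ m t k
              - p.U m (p.best m.castSucc (x t)) (p.best m.succ (x t))‖ ^ 2)
            + avg (fun k => ‖smoothV θ W p O σ m t k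
              - p.H m (p.best m.castSucc (x t)) (p.best m.succ (x t))‖ ^ 2)) ≤ M * (2 * R) := by
    rw [Finset.sum_comm]
    refine (Finset.sum_le_sum fun m _ => ?_).trans (b := ∑ m : Fin M, 2 * R) (le_of_eq ?_)
    · rw [Finset.sum_add_distrib]
      linarith [hU m, hV m]
    · simp
  simp only [Finset.sum_add_distrib, ← Finset.mul_sum, Finset.sum_const, Finset.card_range,
    nsmul_eq_mul] at hUV ⊢
  have hT : 0 ≤ (T : ℝ) * τ ^ 2 := by positivity
  have b1 : 2 * C ^ 2 * (3 * ∑ t ∈ Finset.range T, avg (fun k => ‖smoothH θ W p O σ t k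
      - p.f₂ (x t) (p.best (Fin.last M) (x t))‖ ^ 2)) ≤ 2 * C ^ 2 * (3 * R) := by gcongr
  have b2 := mul_le_mul_of_nonneg_left hUV (show 0 ≤ 2 * C ^ 2 * (6 * M) by positivity)
  have b3 : 0 ≤ 2 * C ^ 2 * (6 * M * (M * 2)) * (T * τ ^ 2) := by positivity
  nlinarith [hS, b1, b2, b3, hT]

end DSMO

end

noncomputable section

namespace DSMO

/-! ### Consensus and tracking errors -/

theorem avg_norm_sub_sq {K : ℕ} {E : Type*} [NormedAddCommGroup E] [InnerProductSpace ℝ E]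
    (hK : 1 ≤ K) (X : Fin K → E) (a : E) :
    avg (fun k => ‖X k - a‖ ^ 2) = disp X + ‖avg X - a‖ ^ 2 := by
  have h := avg_norm_sub_avg_sq fun k => X k - a
  have e : avg (fun k => X k - a) = avg X - a := by rw [avg_sub, avg_const hK]
  simp only [e, sub_sub_sub_cancel_right] at h
  rw [disp, h]
  ring

theorem measurable_avg {Ω E : Type*} {m : MeasurableSpace Ω} [NormedAddCommGroup E]
    [NormedSpace ℝ E] [SecondCountableTopology E] [MeasurableSpace E] [BorelSpace E] {K : ℕ}
    {X : Fin K → Ω → E} (hX : ∀ k, Measurable (X k)) :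
    Measurable fun ω => avg fun k => X k ω :=
  Measurable.fun_const_smul (Finset.measurable_fun_sum _ fun k _ => hX k) _

theorem MeanLE.avg {K : ℕ} (hK : 1 ≤ K) {Ω : Type*} [MeasurableSpace Ω] {P : Measure Ω}
    {Z : Fin K → Ω → ℝ} {z : ℝ} (h : ∀ k, MeanLE P (Z k) z) :
    MeanLE P (fun ω => DSMO.avg fun k => Z k ω) z := by
  have h1 := (MeanLE.sum Finset.univ fun k _ => h k).const_mul
    (inv_nonneg.2 (Nat.cast_nonneg (α := ℝ) K))
  refine ⟨h1.1, h1.2.trans (le_of_eq ?_)⟩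
  have : (K : ℝ) ≠ 0 := by positivity
  simp [this]

section Errors

variable {M K : ℕ} {d : Fin (M + 1) → ℕ} {S : Type*} [MeasurableSpace S]
  (θ : Params M) (W : Matrix (Fin K) (Fin K) ℝ) (p : Problem M K d) (O : Oracle M K d S)
  (σ : ℕ → Fin K → Query M → S)

/-- The dispersion of the points of the agents. -/
def consensusError (t : ℕ) (i : Fin (M + 1)) : ℝ := disp fun k => (run θ W O σ t k).pt i

/-- The squared distance of the averaged point from the best response to the averaged iterate. -/
def trackingError (t : ℕ) (i : Fin (M + 1)) : ℝ :=
  ‖avg (fun k => (run θ W O σ t k).pt i) - p.best i (xBar θ W O σ t)‖ ^ 2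

/-- The noise of the sampled gradient of an inner level. -/
def gradNoise (m : Fin M) (k : Fin K) (x : ∀ i, Vec (d i)) (s : S) : Vec (d m.succ) :=
  O.g₂ k m (x m.castSucc) (x m.succ) s - grad₂ (p.g k m) (x m.castSucc) (x m.succ)

theorem pointError_eq (hK : 1 ≤ K) (t : ℕ) : pointError θ W p O σ t =
    ∑ i, (consensusError θ W O σ t i + trackingError θ W p O σ t i) :=
  Finset.sum_congr rfl fun _ _ => avg_norm_sub_sq hK _ _

theorem run_pt_succ (m : Fin M) (t : ℕ) (k : Fin K) : (run θ W O σ (t + 1) k).pt m.succ =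
    ∑ j, W k j • (run θ W O σ t j).pt m.succ
      - θ.γ • O.g₂ k m ((run θ W O σ t k).pt m.castSucc) ((run θ W O σ t k).pt m.succ)
        (σ t k (Query.inner m)) := rfl

theorem xBar_succ {ρ : ℝ} (hW : IsGossip W ρ) (t : ℕ) : xBar θ W O σ (t + 1) =
    xBar θ W O σ t - θ.α • avg (direction θ W O σ t) := by
  have h : xBar θ W O σ (t + 1) = avg fun k => ∑ j, W k j • (run θ W O σ t j).pt 0
    - θ.α • direction θ W O σ t k := rfl
  rw [h, avg_sub, avg_smul, hW.avg_mix]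
  rfl

end Errors

namespace Setup

variable {M K : ℕ} {d : Fin (M + 1) → ℕ} {S Ω : Type*} [MeasurableSpace S] [MeasurableSpace Ω]
  {c : Constants M} {Λ κ ρ : ℝ} {θ : Params M} {W : Matrix (Fin K) (Fin K) ℝ} {p : Problem M K d}
  {O : Oracle M K d S} {P : Measure Ω} {ξ : ℕ → Fin K → Query M → Ω → S}

theorem measurable_pt_info (h : Setup c Λ κ ρ θ W p O P ξ) (t : ℕ) (k : Fin K)
    (i : Fin (M + 1)) : Measurable[info (flat ξ) {i | i.1 < t}]
      fun ω => (run θ W O (fun r k q => ξ r k q ω) t k).pt i :=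
  (measurable_pi_apply i).comp (h.measurable_points_info t k)

theorem measurable_best (h : Setup c Λ κ ρ θ W p O P ξ) (i : Fin (M + 1)) :
    Measurable (p.best i) := by
  have : LipschitzWith (Real.toNNReal (κ⁻¹ ^ M)) (p.best i) :=
    LipschitzWith.of_dist_le_mul fun x y => by
      have := h.uniform.κ_pos
      rw [dist_eq_norm, dist_eq_norm, Real.coe_toNNReal _ (by positivity)]
      exact h.regular.best_lip i x y
  exact this.continuous.measurable

theorem measurable_xBar_info (h : Setup c Λ κ ρ θ W p O P ξ) (t : ℕ) :
    Measurable[info (flat ξ) {i | i.1 < t}] fun ω => xBar θ W O (fun r k q => ξ r k q ω) t :=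
  measurable_avg fun k => h.measurable_pt_info t k 0

theorem measurable_xBar (h : Setup c Λ κ ρ θ W p O P ξ) (t : ℕ) :
    Measurable fun ω => xBar θ W O (fun r k q => ξ r k q ω) t :=
  measurable_avg fun k => (h.measurableState t).pt k 0

theorem measurable_consensusError (h : Setup c Λ κ ρ θ W p O P ξ) (t : ℕ) (i : Fin (M + 1)) :
    Measurable fun ω => consensusError θ W O (fun r k q => ξ r k q ω) t i :=
  measurable_avg fun k => (((h.measurableState t).pt k i).sub
    (measurable_avg fun k => (h.measurableState t).pt k i)).norm.pow_const 2

theorem measurable_trackingError (h : Setup c Λ κ ρ θ W p O P ξ) (t : ℕ) (i : Fin (M + 1)) :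
    Measurable fun ω => trackingError θ W p O (fun r k q => ξ r k q ω) t i :=
  ((measurable_avg fun k => (h.measurableState t).pt k i).sub
    ((h.measurable_best i).comp (h.measurable_xBar t))).norm.pow_const 2

/-- The noises of the sampled gradients of one iteration are orthogonal to each other and to the
past. -/
theorem meanLE_sq_add_gradNoise (h : Setup c Λ κ ρ θ W p O P ξ) (m : Fin M) (t : ℕ)
    {B : Ω → Vec (d m.succ)} (hB : Measurable[info (flat ξ) {i | i.1 < t}] B) (a : Fin K → ℝ)
    {b : ℝ} (hb : MeanLE P (fun ω => ‖B ω‖ ^ 2) b) :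
    MeanLE P (fun ω => ‖B ω + ∑ k, a k • gradNoise p O m k (points θ W O ξ t k ω)
      (ξ t k (Query.inner m) ω)‖ ^ 2) ((∑ k, a k ^ 2) * Λ ^ 2 + b) := by
  have := h.prob
  have probG := h.unbiased.probG
  have hΛ := h.regular.Λ_pos
  have mη : ∀ k, Measurable fun z : (∀ i, Vec (d i)) × S => gradNoise p O m k z.1 z.2 := fun k => by
    obtain ⟨-, -, m3, -⟩ := h.measurable_grads k
    have mx : ∀ i, Measurable fun z : (∀ i, Vec (d i)) × S => z.1 i := fun i =>
      (measurable_pi_apply i).comp measurable_fst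
    exact ((h.unbiased.meas_g₂ k m).comp
      ((mx m.castSucc).prodMk ((mx m.succ).prodMk measurable_snd))).sub
      ((m3 m).comp ((mx m.castSucc).prodMk (mx m.succ)))
  have hlaw : ∀ k, P.map (flat ξ (t, k, Query.inner m)) = O.lawG k m := fun k =>
    h.sampling.law t k (Query.inner m)
  have hmem : ∀ k (x : ∀ i, Vec (d i)), MemLp (O.g₂ k m (x m.castSucc) (x m.succ)) 2 (O.lawG k m) := by
    intro k x
    have := (h.inner.moment₂ k m (x m.castSucc) (x m.succ)).1.add
      (memLp_const (grad₂ (p.gAvg m) (x m.castSucc) (x m.succ)))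
    refine this.ae_eq (Filter.Eventually.of_forall fun s => ?_)
    simp
  have key := lintegral_sq_add_sum_fresh_le (P := P) (ξ := flat ξ) h.meas_flat h.sampling.indep
    (A := {i | i.1 < t}) (Z := 1) measurable_const (e := fun k : Fin K => (t, k, Query.inner m))
    (fun i j hij => by simpa using hij) (η := gradNoise p O m) mη (σ := Λ)
    (fun k x => by rw [hlaw]; exact (hmem k x).sub (memLp_const _))
    (fun k x => by
      rw [hlaw]
      simp only [gradNoise]
      rw [integral_sub (h.unbiased.int_g₂ k m _ _).1 (integrable_const _),
        (h.unbiased.int_g₂ k m _ _).2]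
      simp)
    (fun k x => by
      rw [hlaw]
      -- The hypothesis measures deviations from the averaged gradient; those from the agent's own
      -- gradient are no larger in mean square.
      have h1 := integral_norm_sub_mean_sq_le (hmem k x)
        (grad₂ (p.gAvg m) (x m.castSucc) (x m.succ))
      rw [(h.unbiased.int_g₂ k m _ _).2] at h1
      refine h1.trans ((h.inner.moment₂ k m _ _).2.trans ?_)
      exact pow_le_pow_left₀ (h.valid.Cg_pos m).le (h.uniform.Cg_le m) 2)
    (X := fun k => points θ W O ξ t k) (h.measurable_points_info t) a Finset.univ (by simp) hB
    (a := 0) le_rfl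
  simp only [Pi.one_apply, one_mul, zero_add] at key
  have hB' : Measurable B := hB.mono (info_le h.meas_flat _) le_rfl
  have hX : ∀ k, Measurable (points θ W O ξ t k) := fun k =>
    (h.measurable_points_info t k).mono (info_le h.meas_flat _) le_rfl
  have hsum : Measurable fun ω => B ω + ∑ k, a k • gradNoise p O m k (points θ W O ξ t k ω)
      (ξ t k (Query.inner m) ω) :=
    hB'.add (Finset.measurable_fun_sum _ fun k _ => Measurable.fun_const_smul
      (g := fun ω => gradNoise p O m k (points θ W O ξ t k ω) (ξ t k (Query.inner m) ω))
      ((mη k).comp ((hX k).prodMk (h.sampling.meas t k (Query.inner m)))) _)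
  have hm2 := (MeanLE.const (P := P) ((∑ k, a k ^ 2) * Λ ^ 2)).add hb
  have h0 : ∀ ω, 0 ≤ (∑ k, a k ^ 2) * Λ ^ 2 + ‖B ω‖ ^ 2 := fun ω => by
    have : 0 ≤ ∑ k, a k ^ 2 := Finset.sum_nonneg fun k _ => sq_nonneg _
    positivity
  have hfin : ∫⁻ ω, ENNReal.ofReal ((∑ k, a k ^ 2) * Λ ^ 2 + ‖B ω‖ ^ 2) ∂P
      = ENNReal.ofReal (∫ ω, ((∑ k, a k ^ 2) * Λ ^ 2 + ‖B ω‖ ^ 2) ∂P) :=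
    (ofReal_integral_eq_lintegral_ofReal hm2.1 (Filter.Eventually.of_forall h0)).symm
  rw [hfin] at key
  have hle := key.trans (ENNReal.ofReal_le_ofReal hm2.2)
  have hn : ∀ ω, 0 ≤ ‖B ω + ∑ k, a k • gradNoise p O m k (points θ W O ξ t k ω)
      (ξ t k (Query.inner m) ω)‖ ^ 2 := fun ω => by positivity
  refine ⟨⟨(hsum.norm.pow_const 2).aestronglyMeasurable, ?_⟩, ?_⟩
  · rw [hasFiniteIntegral_iff_ofReal (Filter.Eventually.of_forall hn)]
    exact hle.trans_lt ENNReal.ofReal_lt_top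
  · rw [integral_eq_lintegral_of_nonneg_ae (Filter.Eventually.of_forall hn)
      (hsum.norm.pow_const 2).aestronglyMeasurable]
    exact ENNReal.toReal_le_of_le_ofReal ((integral_nonneg h0).trans hm2.2) hle

end Setup

end DSMO

end

noncomputable section

namespace DSMO

namespace Setup

variable {M K : ℕ} {d : Fin (M + 1) → ℕ} {S Ω : Type*} [MeasurableSpace S] [MeasurableSpace Ω]
  {c : Constants M} {Λ κ ρ : ℝ} {θ : Params M} {W : Matrix (Fin K) (Fin K) ℝ} {p : Problem M K d}
  {O : Oracle M K d S} {P : Measure Ω} {ξ : ℕ → Fin K → Query M → Ω → S}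

/-! ### One step of the consensus errors -/

theorem meanLE_consensusError_zero (h : Setup c Λ κ ρ θ W p O P ξ) {t : ℕ} {a z : ℝ}
    (ha : MeanLE P (fun ω => consensusError θ W O (fun r k q => ξ r k q ω) t 0) a)
    (hz : ∀ k, MeanLE P (fun ω => ‖direction θ W O (fun r k q => ξ r k q ω) t k‖ ^ 2) z) :
    MeanLE P (fun ω => consensusError θ W O (fun r k q => ξ r k q ω) (t + 1) 0)
      ((1 - (1 - ρ) / 2) * a + 2 / (1 - ρ) * (θ.α ^ 2 * z)) := by
  have hρ := h.gossip.one_sub_pos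
  have hρ0 := h.gossip.rho_nonneg
  have hz' := MeanLE.avg h.K_pos hz
  refine ((ha.const_mul (a := 1 - (1 - ρ) / 2) (by linarith)).add
    ((hz'.const_mul (sq_nonneg θ.α)).const_mul (a := 2 / (1 - ρ)) (by positivity))).of_le
    (h.measurable_consensusError (t + 1) 0) (fun ω => disp_nonneg _) (fun ω => ?_) le_rfl
  set σ := fun r k q => ξ r k q ω
  have := h.gossip.disp_step_le (fun k => (run θ W O σ t k).pt 0)
    (fun k => -(θ.α • direction θ W O σ t k)) zero_le_one le_rfl
  simp only [one_smul, ← sub_eq_add_neg, norm_neg, norm_smul, mul_pow, Real.norm_eq_abs, sq_abs,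
    avg_mul] at this
  exact this

/-- The mean square of the sampled gradients of an inner level. -/
theorem meanLE_sampled_gradient (h : Setup c Λ κ ρ θ W p O P ξ) {t : ℕ} {m : Fin M}
    {a e a' e' : ℝ}
    (ha : MeanLE P (fun ω => consensusError θ W O (fun r k q => ξ r k q ω) t m.castSucc) a)
    (he : MeanLE P (fun ω => trackingError θ W p O (fun r k q => ξ r k q ω) t m.castSucc) e)
    (ha' : MeanLE P (fun ω => consensusError θ W O (fun r k q => ξ r k q ω) t m.succ) a')
    (he' : MeanLE P (fun ω => trackingError θ W p O (fun r k q => ξ r k q ω) t m.succ) e') :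
    MeanLE P (fun ω => avg fun k => ‖O.g₂ k m
        ((run θ W O (fun r k q => ξ r k q ω) t k).pt m.castSucc)
        ((run θ W O (fun r k q => ξ r k q ω) t k).pt m.succ) (ξ t k (Query.inner m) ω)‖ ^ 2)
      (6 * Λ ^ 2 + 8 * Λ ^ 2 * (a + e + a' + e')) := by
  have := h.prob
  have probG := h.unbiased.probG
  have hp := h.regular
  have hΛ := hp.Λ_pos
  -- The moment hypothesis also bounds the heterogeneity of the agents: each exact gradient lies
  -- within `Λ` of the averaged one, which vanishes at the best responses.
  have hmean : ∀ k (x : Vec (d m.castSucc)) (y : Vec (d m.succ)),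
      ‖grad₂ (p.g k m) x y‖ ≤ Λ + ‖p.G m x y‖ := by
    intro k x y
    have h1 := (h.inner.moment₂ k m x y).norm_integral_le (h.valid.Cg_pos m).le
    rw [integral_sub (h.unbiased.int_g₂ k m x y).1 (integrable_const _),
      (h.unbiased.int_g₂ k m x y).2] at h1
    have hG : grad₂ (p.gAvg m) x y = p.G m x y := (hp.hasGradientAt_gAvg m x y).gradient
    simp only [integral_const, probReal_univ, one_smul, hG] at h1
    have h2 := norm_add_le (grad₂ (p.g k m) x y - p.G m x y) (p.G m x y)
    rw [sub_add_cancel] at h2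
    linarith [h.uniform.Cg_le m]
  have hG : ∀ (x : Vec (d m.castSucc)) (y : Vec (d m.succ)) (z : Vec (d 0)),
      ‖p.G m x y‖ ≤ Λ * (‖x - p.best m.castSucc z‖ + ‖y - p.best m.succ z‖) := by
    intro x y z
    have h1 := hp.G_lip m x (p.best m.castSucc z) y (p.best m.succ z)
    rw [hp.G_best, sub_zero] at h1
    exact h1.trans (by gcongr; exact hp.L_le m)
  have hsq : ∀ k (x : Vec (d m.castSucc)) (y : Vec (d m.succ)) (z : Vec (d 0)),
      ‖grad₂ (p.g k m) x y‖ ^ 2 ≤ 2 * Λ ^ 2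
        + 4 * Λ ^ 2 * (‖x - p.best m.castSucc z‖ ^ 2 + ‖y - p.best m.succ z‖ ^ 2) := by
    intro k x y z
    have h1 := (hmean k x y).trans (add_le_add_right (hG x y z) Λ)
    refine (pow_le_pow_left₀ (norm_nonneg _) h1 2).trans ?_
    set u := ‖x - p.best m.castSucc z‖
    set v := ‖y - p.best m.succ z‖
    nlinarith [sq_nonneg (Λ - Λ * (u + v)), mul_nonneg (sq_nonneg Λ) (sq_nonneg (u - v))]
  have hnoise : ∀ k, MeanLE P (fun ω => ‖gradNoise p O m k (points θ W O ξ t k ω)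
      (ξ t k (Query.inner m) ω)‖ ^ 2) (Λ ^ 2) := by
    intro k
    -- The unit vector as coefficients and `B = 0` single out the noise of the agent `k`.
    have := h.meanLE_sq_add_gradNoise m t (B := fun _ => 0) measurable_const (Pi.single k 1)
      (b := 0) (by simpa using MeanLE.const (P := P) 0)
    simpa [Pi.single_apply] using this
  have hn := (MeanLE.avg h.K_pos hnoise).const_mul zero_le_two
  have hsum := ((ha.add he).add (ha'.add he')).const_mul (a := 8 * Λ ^ 2) (by positivity)
  refine ((hn.add (.const (4 * Λ ^ 2))).add hsum).of_le ?_ (fun ω => avg_nonneg fun k => by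
    positivity) (fun ω => ?_) (by linarith)
  · exact measurable_avg fun k => ((h.unbiased.meas_g₂ k m).comp
      (((h.measurableState t).pt k m.castSucc).prodMk (((h.measurableState t).pt k m.succ).prodMk
        (h.sampling.meas t k (Query.inner m))))).norm.pow_const 2
  · set σ := fun r k q => ξ r k q ω with hσ
    set x := xBar θ W O σ t with hx
    have hk : ∀ k, ‖O.g₂ k m ((run θ W O σ t k).pt m.castSucc) ((run θ W O σ t k).pt m.succ)
        (ξ t k (Query.inner m) ω)‖ ^ 2 ≤
        2 * ‖gradNoise p O m k (points θ W O ξ t k ω) (ξ t k (Query.inner m) ω)‖ ^ 2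
          + (4 * Λ ^ 2 + 8 * Λ ^ 2 * (‖(run θ W O σ t k).pt m.castSucc - p.best m.castSucc x‖ ^ 2
            + ‖(run θ W O σ t k).pt m.succ - p.best m.succ x‖ ^ 2)) := by
      intro k
      have h1 := norm_add_sq_le (gradNoise p O m k (points θ W O ξ t k ω)
        (ξ t k (Query.inner m) ω)) (grad₂ (p.g k m) ((run θ W O σ t k).pt m.castSucc)
          ((run θ W O σ t k).pt m.succ))
      have e : gradNoise p O m k (points θ W O ξ t k ω) (ξ t k (Query.inner m) ω)
          + grad₂ (p.g k m) ((run θ W O σ t k).pt m.castSucc) ((run θ W O σ t k).pt m.succ)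
          = O.g₂ k m ((run θ W O σ t k).pt m.castSucc) ((run θ W O σ t k).pt m.succ)
            (ξ t k (Query.inner m) ω) := sub_add_cancel _ _
      rw [e] at h1
      have h2 := hsq k ((run θ W O σ t k).pt m.castSucc) ((run θ W O σ t k).pt m.succ) x
      linarith
    refine (avg_mono hk).trans (le_of_eq ?_)
    rw [avg_add, avg_add, avg_mul, avg_const h.K_pos, avg_mul, avg_add,
      avg_norm_sub_sq h.K_pos, avg_norm_sub_sq h.K_pos]
    simp only [consensusError, trackingError]
    ring

theorem meanLE_consensusError_succ (h : Setup c Λ κ ρ θ W p O P ξ) {t : ℕ} {m : Fin M}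
    {a e a' e' : ℝ}
    (ha : MeanLE P (fun ω => consensusError θ W O (fun r k q => ξ r k q ω) t m.castSucc) a)
    (he : MeanLE P (fun ω => trackingError θ W p O (fun r k q => ξ r k q ω) t m.castSucc) e)
    (ha' : MeanLE P (fun ω => consensusError θ W O (fun r k q => ξ r k q ω) t m.succ) a')
    (he' : MeanLE P (fun ω => trackingError θ W p O (fun r k q => ξ r k q ω) t m.succ) e') :
    MeanLE P (fun ω => consensusError θ W O (fun r k q => ξ r k q ω) (t + 1) m.succ)
      ((1 - (1 - ρ) / 2) * a'
        + 2 / (1 - ρ) * (θ.γ ^ 2 * (6 * Λ ^ 2 + 8 * Λ ^ 2 * (a + e + a' + e')))) := by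
  have hρ := h.gossip.one_sub_pos
  have hρ0 := h.gossip.rho_nonneg
  have hz := h.meanLE_sampled_gradient ha he ha' he'
  refine ((ha'.const_mul (a := 1 - (1 - ρ) / 2) (by linarith)).add
    ((hz.const_mul (sq_nonneg θ.γ)).const_mul (a := 2 / (1 - ρ)) (by positivity))).of_le
    (h.measurable_consensusError (t + 1) m.succ) (fun ω => disp_nonneg _) (fun ω => ?_) le_rfl
  set σ := fun r k q => ξ r k q ω
  have := h.gossip.disp_step_le (fun k => (run θ W O σ t k).pt m.succ)
    (fun k => -(θ.γ • O.g₂ k m ((run θ W O σ t k).pt m.castSucc) ((run θ W O σ t k).pt m.succ)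
        (σ t k (Query.inner m)))) zero_le_one le_rfl
  simp only [one_smul, ← sub_eq_add_neg, norm_neg, norm_smul, mul_pow, Real.norm_eq_abs, sq_abs,
    avg_mul] at this
  exact this

/-! ### One step of the tracking errors -/

theorem trackingError_zero (t : ℕ) (σ : ℕ → Fin K → Query M → S) :
    trackingError θ W p O σ t 0 = 0 := by
  have : p.best 0 (xBar θ W O σ t) = avg (fun k => (run θ W O σ t k).pt 0) := by
    simp [Problem.best, xBar, avg]
  simp [trackingError, this]

/-- A damped gradient step with an inexact gradient. -/
theorem inexact_step_le (h : Setup c Λ κ ρ θ W p O P ξ) (hγ : θ.γ * Λ ≤ 1) (m : Fin M)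
    (X : Fin K → Vec (d m.castSucc)) (Y : Fin K → Vec (d m.succ)) (x : Vec (d 0)) :
    ‖avg Y - θ.γ • avg (fun k => grad₂ (p.g k m) (X k) (Y k)) - p.best m.succ x‖ ^ 2 ≤
      (1 - θ.γ * κ / Λ) * ‖avg Y - p.best m.succ x‖ ^ 2
        + θ.γ * Λ / κ * (2 * Λ ^ 2 * (avg (fun k => ‖X k - p.best m.castSucc x‖ ^ 2)
          + disp Y)) := by
  have hp := h.regular
  have hΛ := hp.Λ_pos
  have hκ := hp.κ_pos
  have hκ1 := hp.κ_le_one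
  have hγ0 : 0 < θ.γ := h.γ_eq ▸ h.β_pos
  have hL := hp.L_pos m
  set l := c.Lg m with hl
  have hlΛ : l ≤ Λ := hp.L_le m
  have hli : l⁻¹ ≤ Λ := hp.L_inv_le m
  have hγl : θ.γ * l ≤ 1 := le_trans (by gcongr) hγ
  set y := avg Y with hy
  set y' := p.best m.succ x with hy'
  set a := p.best m.castSucc x with ha
  -- A rate common to all levels; it is at most `γ L κ` because `1 / Λ ≤ L`.
  set s := θ.γ * κ / Λ with hs
  have hs0 : 0 < s := by positivity
  have hinv : Λ⁻¹ ≤ l := by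
    rw [inv_le_comm₀ hΛ hL]; exact hli
  have hsl : s ≤ θ.γ * l * κ := by
    rw [hs, div_eq_mul_inv]
    calc θ.γ * κ * Λ⁻¹ ≤ θ.γ * κ * l := by gcongr
      _ = _ := by ring
  have hs1 : s ≤ 1 := hsl.trans (by nlinarith [mul_pos hγ0 hL])
  -- A step of size `γ` is the convex combination, with weights `1 - γ L` and `γ L`, of standing
  -- still and of the contracting step of size `1 / L`.
  have hcontr : ‖y - θ.γ • p.G m a y - y'‖ ≤ (1 - s) * ‖y - y'‖ := by
    have h1 := hp.gradient_step m a y y'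
    rw [hp.G_best, smul_zero, sub_zero] at h1
    have e : y - θ.γ • p.G m a y - y' = (1 - θ.γ * l) • (y - y')
        + (θ.γ * l) • (y - l⁻¹ • p.G m a y - y') := by
      have h2 : (θ.γ * l) • l⁻¹ • p.G m a y = θ.γ • p.G m a y := by
        rw [smul_smul, mul_assoc, mul_inv_cancel₀ hL.ne', mul_one]
      have e3 : (θ.γ * l) • (y - l⁻¹ • p.G m a y - y')
          = (θ.γ * l) • (y - y') - (θ.γ * l) • l⁻¹ • p.G m a y := by
        rw [← smul_sub]; congr 1; abel
      rw [e3, h2]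
      module
    rw [e]
    refine (norm_add_le _ _).trans ?_
    rw [norm_smul, norm_smul, Real.norm_of_nonneg (by linarith),
      Real.norm_of_nonneg (by positivity)]
    calc _ ≤ (1 - θ.γ * l) * ‖y - y'‖ + θ.γ * l * ((1 - κ) * ‖y - y'‖) := by gcongr
      _ = (1 - θ.γ * l * κ) * ‖y - y'‖ := by ring
      _ ≤ _ := by gcongr
  set E := ‖avg (fun k => grad₂ (p.g k m) (X k) (Y k)) - p.G m a y‖ with hE
  have hE2 : E ^ 2 ≤ 2 * Λ ^ 2 * (avg (fun k => ‖X k - a‖ ^ 2) + disp Y) :=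
    avg_sub_avg_sq_le_of_lip (φ := fun k => grad₂ (p.g k m)) (l := Λ)
      (fun k x x' z z' => (hp.g_lip k m x x' z z').trans (by gcongr)) X Y a y
  have htri : ‖y - θ.γ • avg (fun k => grad₂ (p.g k m) (X k) (Y k)) - y'‖
      ≤ (1 - s) * ‖y - y'‖ + θ.γ * E := by
    have e : y - θ.γ • avg (fun k => grad₂ (p.g k m) (X k) (Y k)) - y'
        = (y - θ.γ • p.G m a y - y')
          - θ.γ • (avg (fun k => grad₂ (p.g k m) (X k) (Y k)) - p.G m a y) := by
      rw [smul_sub]; abel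
    rw [e]
    refine (norm_sub_le _ _).trans (add_le_add hcontr ?_)
    rw [norm_smul, Real.norm_of_nonneg hγ0.le]
  refine (pow_le_pow_left₀ (norm_nonneg _) htri 2).trans ?_
  set D := ‖y - y'‖
  have hconv : ((1 - s) * D + θ.γ * E) ^ 2 ≤ (1 - s) * D ^ 2 + θ.γ * Λ / κ * E ^ 2 := by
    -- Written in this way, the estimate is convexity of the square with weights `1 - s` and `s`.
    obtain ⟨b, hb⟩ : ∃ b, θ.γ * E = s * b := ⟨θ.γ * E / s, by field_simp⟩
    have e1 : θ.γ * Λ / κ * E ^ 2 = s * b ^ 2 := by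
      have : E = s * b / θ.γ := by rw [← hb]; field_simp
      rw [this, hs]
      field_simp
    rw [hb, e1]
    nlinarith [mul_nonneg (mul_nonneg hs0.le (sub_nonneg.2 hs1)) (sq_nonneg (D - b))]
  refine hconv.trans ?_
  have : 0 ≤ θ.γ * Λ / κ := by positivity
  gcongr

/-- The new error is the sum of a part `B` determined by the past (the inexact gradient step), the
averaged fresh noise, and the drift of the best response. The noise is orthogonal to `B`. The drift
is separated with the Young weights `1 + s/2` and `1 + 2/s`, which cost half of the contraction. -/
theorem meanLE_trackingError_succ (h : Setup c Λ κ ρ θ W p O P ξ) (hγ : θ.γ * Λ ≤ 1) {t : ℕ}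
    {m : Fin M} {a e a' e' z : ℝ}
    (ha : MeanLE P (fun ω => consensusError θ W O (fun r k q => ξ r k q ω) t m.castSucc) a)
    (he : MeanLE P (fun ω => trackingError θ W p O (fun r k q => ξ r k q ω) t m.castSucc) e)
    (ha' : MeanLE P (fun ω => consensusError θ W O (fun r k q => ξ r k q ω) t m.succ) a')
    (he' : MeanLE P (fun ω => trackingError θ W p O (fun r k q => ξ r k q ω) t m.succ) e')
    (hz : MeanLE P (fun ω => ‖avg (direction θ W O (fun r k q => ξ r k q ω) t)‖ ^ 2) z) :
    MeanLE P (fun ω => trackingError θ W p O (fun r k q => ξ r k q ω) (t + 1) m.succ)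
      ((1 - θ.γ * κ / (2 * Λ)) * e'
        + 3 / 2 * (θ.γ * Λ / κ * (2 * Λ ^ 2 * (a + e + a')) + θ.γ ^ 2 * Λ ^ 2 / K)
        + 3 * Λ / (θ.γ * κ) * ((κ⁻¹ ^ M) ^ 2 * (θ.α ^ 2 * z))) := by
  have hp := h.regular
  have hΛ := hp.Λ_pos
  have hκ := hp.κ_pos
  have hκ1 := hp.κ_le_one
  have hγ0 : 0 < θ.γ := h.γ_eq ▸ h.β_pos
  have hK : (0 : ℝ) < K := by exact_mod_cast h.K_pos
  set s := θ.γ * κ / Λ with hs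
  have hs0 : 0 < s := by positivity
  have hs1 : s ≤ 1 := by
    rw [hs, div_le_one hΛ]
    have := h.uniform.one_le
    nlinarith
  set B : Ω → Vec (d m.succ) := fun ω =>
    avg (fun k => (run θ W O (fun r k q => ξ r k q ω) t k).pt m.succ)
      - θ.γ • avg (fun k => grad₂ (p.g k m)
        ((run θ W O (fun r k q => ξ r k q ω) t k).pt m.castSucc)
        ((run θ W O (fun r k q => ξ r k q ω) t k).pt m.succ))
      - p.best m.succ (xBar θ W O (fun r k q => ξ r k q ω) t) with hB
  have mB : Measurable[info (flat ξ) {i | i.1 < t}] B := by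
    refine ((measurable_avg fun k => h.measurable_pt_info t k m.succ).sub
      (Measurable.fun_const_smul (measurable_avg fun k => ?_) _)).sub
      ((h.measurable_best m.succ).comp (h.measurable_xBar_info t))
    exact ((h.measurable_grads k).2.2.1 m).comp
      ((h.measurable_pt_info t k m.castSucc).prodMk (h.measurable_pt_info t k m.succ))
  have hBm : MeanLE P (fun ω => ‖B ω‖ ^ 2)
      ((1 - s) * e' + θ.γ * Λ / κ * (2 * Λ ^ 2 * (a + e + a'))) := by
    refine ((he'.const_mul (sub_nonneg.2 hs1)).add ((((ha.add he).add ha').const_mul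
      (a := 2 * Λ ^ 2) (by positivity)).const_mul (a := θ.γ * Λ / κ) (by positivity))).of_le
      ((mB.mono (info_le h.meas_flat _) le_rfl).norm.pow_const 2) (fun ω => by positivity)
      (fun ω => ?_) le_rfl
    refine (h.inexact_step_le hγ m _ _ _).trans ?_
    rw [avg_norm_sub_sq h.K_pos]
    rfl
  -- Each of the `K` independent noises has the coefficient `-γ / K`, so the variance is of order
  -- `γ² / K`: the second place where the speed-up originates.
  have hfresh := h.meanLE_sq_add_gradNoise m t mB (fun _ => -(θ.γ / K)) hBm
  have hsum : ∑ _k : Fin K, (-(θ.γ / K)) ^ 2 = θ.γ ^ 2 / K := by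
    simp only [Finset.sum_const, Finset.card_univ, Fintype.card_fin, nsmul_eq_mul]
    field_simp
  rw [hsum] at hfresh
  refine ((hfresh.const_mul (a := 1 + s / 2) (by positivity)).add
    (((hz.const_mul (sq_nonneg θ.α)).const_mul (sq_nonneg (κ⁻¹ ^ M))).const_mul
      (a := 1 + 2 / s) (by positivity))).of_le (h.measurable_trackingError (t + 1) m.succ)
    (fun ω => sq_nonneg _) (fun ω => ?_) ?_
  · set σ := fun r k q => ξ r k q ω
    set N := B ω + ∑ k, -(θ.γ / K) • gradNoise p O m k (points θ W O ξ t k ω)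
      (ξ t k (Query.inner m) ω) with hN
    have e1 : avg (fun k => (run θ W O σ (t + 1) k).pt m.succ)
        - p.best m.succ (xBar θ W O σ (t + 1))
        = N + (p.best m.succ (xBar θ W O σ t) - p.best m.succ (xBar θ W O σ (t + 1))) := by
      have e2 : ∑ k, -(θ.γ / K) • gradNoise p O m k (points θ W O ξ t k ω)
          (ξ t k (Query.inner m) ω) = -(θ.γ • (avg (fun k => O.g₂ k m
            ((run θ W O σ t k).pt m.castSucc) ((run θ W O σ t k).pt m.succ)
            (σ t k (Query.inner m))) - avg (fun k => grad₂ (p.g k m)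
            ((run θ W O σ t k).pt m.castSucc) ((run θ W O σ t k).pt m.succ)))) := by
        rw [← avg_sub, ← Finset.smul_sum, avg, neg_smul, smul_smul, div_eq_mul_inv]
        rfl
      rw [hN, e2]
      simp only [run_pt_succ, avg_sub, avg_smul, h.gossip.avg_mix, hB, smul_sub]
      abel
    have e3 : ‖p.best m.succ (xBar θ W O σ t) - p.best m.succ (xBar θ W O σ (t + 1))‖ ^ 2
        ≤ (κ⁻¹ ^ M) ^ 2 * (θ.α ^ 2 * ‖avg (direction θ W O σ t)‖ ^ 2) := by
      have h1 := hp.best_lip m.succ (xBar θ W O σ t) (xBar θ W O σ (t + 1))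
      rw [xBar_succ θ W O σ h.gossip, sub_sub_cancel, norm_smul,
        Real.norm_of_nonneg h.α_nonneg] at h1
      rw [xBar_succ θ W O σ h.gossip]
      refine (pow_le_pow_left₀ (norm_nonneg _) h1 2).trans (le_of_eq (by ring))
    have e4 : ∀ u v : Vec (d m.succ),
        ‖u + v‖ ^ 2 ≤ (1 + s / 2) * ‖u‖ ^ 2 + (1 + 2 / s) * ‖v‖ ^ 2 := by
      intro u v
      refine (pow_le_pow_left₀ (norm_nonneg _) (norm_add_le u v) 2).trans ?_
      obtain ⟨w, hw⟩ : ∃ w, ‖v‖ = s / 2 * w := ⟨2 / s * ‖v‖, by field_simp⟩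
      have e5 : 2 / s * ‖v‖ ^ 2 = s / 2 * w ^ 2 := by rw [hw]; field_simp
      have e6 : ‖u‖ * ‖v‖ = s / 2 * (‖u‖ * w) := by rw [hw]; ring
      have e7 := mul_nonneg hs0.le (sq_nonneg (‖u‖ - w))
      rw [add_mul _ _ (‖v‖ ^ 2), e5]
      linarith
    rw [trackingError, e1]
    refine (e4 _ _).trans ?_
    gcongr
  · have hz0 : 0 ≤ z := (integral_nonneg fun ω => sq_nonneg _).trans hz.2
    have he0 : 0 ≤ e' := (integral_nonneg fun ω => sq_nonneg _).trans he'.2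
    have ha0 : 0 ≤ a := (integral_nonneg fun ω => disp_nonneg _).trans ha.2
    have ha0' : 0 ≤ a' := (integral_nonneg fun ω => disp_nonneg _).trans ha'.2
    have he1 : 0 ≤ e := (integral_nonneg fun ω => sq_nonneg _).trans he.2
    set b := θ.γ * Λ / κ * (2 * Λ ^ 2 * (a + e + a')) with hb
    have hb0 : 0 ≤ b := by positivity
    set n := θ.γ ^ 2 / K * Λ ^ 2 with hn
    have hn0 : 0 ≤ n := by positivity
    set w := (κ⁻¹ ^ M) ^ 2 * (θ.α ^ 2 * z) with hw
    have hw0 : 0 ≤ w := by positivity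
    have e1 : θ.γ * κ / (2 * Λ) = s / 2 := by rw [hs]; field_simp
    have e2 : 3 * Λ / (θ.γ * κ) = 3 / s := by rw [hs]; field_simp
    have e3 : θ.γ ^ 2 * Λ ^ 2 / K = n := by rw [hn]; ring
    rw [e1, e2, e3]
    have f1 : (1 + s / 2) * ((1 - s) * e') ≤ (1 - s / 2) * e' := by
      nlinarith [mul_nonneg (sq_nonneg s) he0]
    have f2 : (1 + s / 2) * (n + b) ≤ 3 / 2 * (b + n) := by nlinarith
    have f3 : (1 + 2 / s) * w ≤ 3 / s * w := by
      have : 1 ≤ 1 / s := by rw [le_div_iff₀ hs0]; linarith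
      have e4 : 3 / s = 1 / s + 2 / s := by ring
      rw [e4]
      gcongr
    linarith

end Setup

end DSMO

end

/-! ### Accumulated consensus and tracking errors -/

noncomputable section

namespace DSMO

section Means

variable {M K : ℕ} {d : Fin (M + 1) → ℕ} {S Ω : Type*} [MeasurableSpace S] [MeasurableSpace Ω]
  (θ : Params M) (W : Matrix (Fin K) (Fin K) ℝ) (p : Problem M K d) (O : Oracle M K d S)
  (P : Measure Ω) (ξ : ℕ → Fin K → Query M → Ω → S)

/-- The mean of the consensus error. -/
def meanConsensus (t : ℕ) (i : Fin (M + 1)) : ℝ :=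
  ∫ ω, consensusError θ W O (fun r k q => ξ r k q ω) t i ∂P

/-- The mean of the tracking error. -/
def meanTracking (t : ℕ) (i : Fin (M + 1)) : ℝ :=
  ∫ ω, trackingError θ W p O (fun r k q => ξ r k q ω) t i ∂P

/-- The mean square of the averaged direction. -/
def meanDirection (t : ℕ) : ℝ :=
  ∫ ω, ‖avg (direction θ W O (fun r k q => ξ r k q ω) t)‖ ^ 2 ∂P

/-- The order of the accumulated errors of `T` iterations. -/
def errorScale (ρ : ℝ) (T : ℕ) : ℝ :=
  1 / θ.β + T * (θ.β / K) + T * (θ.β / (1 - ρ)) ^ 2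
    + (θ.α / θ.β) ^ 2 * ∑ t ∈ Finset.range T, meanDirection θ W O P ξ t

theorem meanConsensus_nonneg (t : ℕ) (i : Fin (M + 1)) : 0 ≤ meanConsensus θ W O P ξ t i :=
  integral_nonneg fun _ => disp_nonneg _

theorem meanTracking_nonneg (t : ℕ) (i : Fin (M + 1)) : 0 ≤ meanTracking θ W p O P ξ t i :=
  integral_nonneg fun _ => sq_nonneg _

theorem meanDirection_nonneg (t : ℕ) : 0 ≤ meanDirection θ W O P ξ t :=
  integral_nonneg fun _ => sq_nonneg _

end Means

namespace Setup

variable {M K : ℕ} {d : Fin (M + 1) → ℕ} {S Ω : Type*} [MeasurableSpace S] [MeasurableSpace Ω]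
  {c : Constants M} {Λ κ ρ : ℝ} {θ : Params M} {W : Matrix (Fin K) (Fin K) ℝ} {p : Problem M K d}
  {O : Oracle M K d S} {P : Measure Ω} {ξ : ℕ → Fin K → Query M → Ω → S}

theorem consensusError_init (h : Setup c Λ κ ρ θ W p O P ξ) (σ : ℕ → Fin K → Query M → S)
    (i : Fin (M + 1)) : consensusError θ W O σ 0 i = 0 := by
  have : (fun k => (run θ W O σ 0 k).pt i) = fun _ => 0 := rfl
  rw [consensusError, this, disp, avg_const h.K_pos]
  simp [avg]

theorem trackingError_init (h : Setup c Λ κ ρ θ W p O P ξ) (σ : ℕ → Fin K → Query M → S)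
    (i : Fin (M + 1)) : trackingError θ W p O σ 0 i = ‖p.best i 0‖ ^ 2 := by
  have h1 : (fun k => (run θ W O σ 0 k).pt i) = fun _ => 0 := rfl
  have h2 : xBar θ W O σ 0 = 0 := avg_const h.K_pos 0
  rw [trackingError, h1, avg_const h.K_pos, h2, zero_sub, norm_neg]

theorem meanLE_avg_direction (h : Setup c Λ κ ρ θ W p O P ξ) {B : ℝ} {t : ℕ}
    (hB : ∀ k, MeanLE P (fun ω => ‖direction θ W O (fun r k q => ξ r k q ω) t k‖ ^ 2) B) :
    MeanLE P (fun ω => ‖avg (direction θ W O (fun r k q => ξ r k q ω) t)‖ ^ 2) B :=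
  (MeanLE.avg h.K_pos hB).of_le
    ((measurable_avg fun k => h.measurable_direction t k).norm.pow_const 2)
    (fun ω => by positivity) (fun ω => norm_avg_sq_le _) le_rfl

/-- The one-step estimates take bounds on means as input; fed with the means themselves they
propagate integrability in `t`. -/
theorem integrable_errors (h : Setup c Λ κ ρ θ W p O P ξ) (hγ : θ.γ * Λ ≤ 1) {B : ℝ}
    (hB : ∀ t k, MeanLE P (fun ω => ‖direction θ W O (fun r k q => ξ r k q ω) t k‖ ^ 2) B)
    (t : ℕ) (i : Fin (M + 1)) :
    Integrable (fun ω => consensusError θ W O (fun r k q => ξ r k q ω) t i) P ∧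
      Integrable (fun ω => trackingError θ W p O (fun r k q => ξ r k q ω) t i) P := by
  have := h.prob
  induction t generalizing i with
  | zero =>
    simp only [h.consensusError_init, h.trackingError_init]
    exact ⟨integrable_const _, integrable_const _⟩
  | succ t ih =>
    have m1 := fun i => MeanLE.mk (ih i).1 le_rfl
    have m2 := fun i => MeanLE.mk (ih i).2 le_rfl
    cases i using Fin.cases with
    | zero =>
      refine ⟨(h.meanLE_consensusError_zero (m1 0) (hB t)).1, ?_⟩
      simp only [trackingError_zero]
      exact integrable_const _
    | succ m =>
      exact ⟨(h.meanLE_consensusError_succ (m1 _) (m2 _) (m1 _) (m2 _)).1,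
        (h.meanLE_trackingError_succ hγ (m1 _) (m2 _) (m1 _) (m2 _)
          (h.meanLE_avg_direction (hB t))).1⟩

end Setup

/-- The inverse of an admissible `β / (1 - ρ)`. -/
def smallConst (Λ κ : ℝ) : ℝ := 64 * Λ ^ 2 * (1 + 6 * Λ ^ 4 / κ ^ 2)

theorem smallConst_ge {Λ : ℝ} (hΛ : 1 ≤ Λ) (κ : ℝ) : Λ ≤ smallConst Λ κ := by
  have : 0 ≤ 6 * Λ ^ 4 / κ ^ 2 := by positivity
  rw [smallConst]
  nlinarith [mul_nonneg (sq_nonneg Λ) this]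

theorem Setup.gamma_mul_le {M K : ℕ} {d : Fin (M + 1) → ℕ} {S Ω : Type*} [MeasurableSpace S]
    [MeasurableSpace Ω] {c : Constants M} {Λ κ ρ : ℝ} {θ : Params M}
    {W : Matrix (Fin K) (Fin K) ℝ} {p : Problem M K d} {O : Oracle M K d S} {P : Measure Ω}
    {ξ : ℕ → Fin K → Query M → Ω → S} (h : Setup c Λ κ ρ θ W p O P ξ) (hΛ : 1 ≤ Λ)
    (hsmall : smallConst Λ κ * (θ.β / (1 - ρ)) ≤ 1) : θ.γ * Λ ≤ 1 := by
  have hρ := h.gossip.one_sub_pos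
  have hβ := h.β_pos
  rw [h.γ_eq]
  refine le_trans ?_ hsmall
  have hρ1 : 1 - ρ ≤ 1 := by linarith [h.gossip.rho_nonneg]
  have h1 : θ.β ≤ θ.β / (1 - ρ) := by rw [le_div_iff₀ hρ]; nlinarith
  have h2 := smallConst_ge hΛ κ
  rw [mul_comm]
  exact mul_le_mul h2 h1 hβ.le (by linarith)

/-- Solving the coupled inequalities of one level. -/
theorem level_bound {A E A' E' R s C₁ C₂ c D : ℝ} (hA' : 0 ≤ A') (hR : 0 ≤ R)
    (hC₁ : 0 ≤ C₁) (hC₂ : 0 ≤ C₂) (hc : 0 ≤ c) (hs : 0 ≤ s) (hη : s * (1 + C₁) ≤ 1 / 2)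
    (hA : A ≤ c * R) (hE : E ≤ c * R) (h1 : A' ≤ D * R + s * (A + E + A' + E'))
    (h2 : E' ≤ C₁ * (A + E + A') + C₂ * R) :
    A' ≤ (2 * D + 2 * c + C₂) * R ∧
      E' ≤ (C₁ * (2 * c + (2 * D + 2 * c + C₂)) + C₂) * R := by
  -- Inserting `h2` into `h1` leaves `A'` on both sides; `hη` makes its coefficient on the right at
  -- most `1 / 2`.
  have h3 : A + E + A' + E' ≤ (1 + C₁) * (2 * c * R + A') + C₂ * R := by
    nlinarith [mul_nonneg hC₁ hA']
  have hs2 : s ≤ 1 / 2 := by nlinarith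
  have h4 : s * (A + E + A' + E') ≤ 1 / 2 * (2 * c * R + A') + 1 / 2 * (C₂ * R) := by
    refine (mul_le_mul_of_nonneg_left h3 hs).trans ?_
    have h5 : 0 ≤ 2 * c * R + A' := by positivity
    have h6 := mul_le_mul_of_nonneg_right hη h5
    have h7 := mul_le_mul_of_nonneg_right hs2 (mul_nonneg hC₂ hR)
    linarith
  have h8 : A' ≤ (2 * D + 2 * c + C₂) * R := by linarith
  refine ⟨h8, h2.trans ?_⟩
  have : C₁ * (A + E + A') ≤ C₁ * (c * R + c * R + (2 * D + 2 * c + C₂) * R) := by gcongr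
  linarith

/-- Summing the one-step recursions gives two coupled inequalities: the consensus error of a level
contains its tracking error only with the small factor `(β / (1 - ρ))²`, while its tracking error is
driven by the level below and by its own consensus error. At level zero there is no tracking error.
-/
theorem exists_sum_level_errors (M : ℕ) {Λ κ : ℝ} (hΛ : 1 ≤ Λ) (hκ : 0 < κ) {B : ℝ} (hB : 1 ≤ B)
    (i : Fin (M + 1)) :
    ∃ C, 0 ≤ C ∧ ∀ {K : ℕ} {d : Fin (M + 1) → ℕ} {S Ω : Type*} [MeasurableSpace S]
      [MeasurableSpace Ω] {c : Constants M} {ρ : ℝ} {θ : Params M}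
      {W : Matrix (Fin K) (Fin K) ℝ} {p : Problem M K d} {O : Oracle M K d S} {P : Measure Ω}
      {ξ : ℕ → Fin K → Query M → Ω → S}, Setup c Λ κ ρ θ W p O P ξ →
      (∀ t k, MeanLE P (fun ω => ‖direction θ W O (fun r k q => ξ r k q ω) t k‖ ^ 2) B) →
      θ.α ≤ θ.β → smallConst Λ κ * (θ.β / (1 - ρ)) ≤ 1 → ∀ T,
      ∑ t ∈ Finset.range T, meanConsensus θ W O P ξ t i ≤ C * errorScale θ W O P ξ ρ T ∧
      ∑ t ∈ Finset.range T, meanTracking θ W p O P ξ t i ≤ C * errorScale θ W O P ξ ρ T := by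
  induction i using Fin.induction with
  | zero =>
    refine ⟨4 * B, by positivity,
      fun {K d S Ω} _ _ {c ρ θ W p O P ξ} h hd hαβ hsmall T => ?_⟩
    have hρ := h.gossip.one_sub_pos
    have hβ := h.β_pos
    have hα := h.α_nonneg
    have hK : (0 : ℝ) < K := by exact_mod_cast h.K_pos
    have hz : 0 ≤ ∑ t ∈ Finset.range T, meanDirection θ W O P ξ t :=
      Finset.sum_nonneg fun t _ => meanDirection_nonneg _ _ _ _ _ _
    have hR : T * (θ.β / (1 - ρ)) ^ 2 ≤ errorScale θ W O P ξ ρ T := by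
      rw [errorScale]
      have : 0 ≤ 1 / θ.β + T * (θ.β / K) := by positivity
      have : 0 ≤ (θ.α / θ.β) ^ 2 * ∑ t ∈ Finset.range T, meanDirection θ W O P ξ t := by
        positivity
      linarith
    have hR0 : 0 ≤ errorScale θ W O P ξ ρ T := le_trans (by positivity) hR
    have hγΛ := h.gamma_mul_le hΛ hsmall
    constructor
    · have key := sum_le_of_recursion (a := fun t => meanConsensus θ W O P ξ t 0)
        (b := fun _ => 4 * B * (θ.β / (1 - ρ)) ^ 2) (r := (1 - ρ) / 2) (by linarith)
        (fun t => meanConsensus_nonneg _ _ _ _ _ _ _) (fun t => ?_) T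
      · have h0 : meanConsensus θ W O P ξ 0 0 = 0 := by
          simp only [meanConsensus, h.consensusError_init, integral_zero]
        rw [h0, zero_div, zero_add, Finset.sum_const, Finset.card_range, nsmul_eq_mul] at key
        refine key.trans ?_
        calc (T : ℝ) * (4 * B * (θ.β / (1 - ρ)) ^ 2) = 4 * B * (T * (θ.β / (1 - ρ)) ^ 2) := by ring
          _ ≤ _ := by gcongr
      · refine (h.meanLE_consensusError_zero ⟨(h.integrable_errors hγΛ hd t 0).1, le_rfl⟩
          (hd t)).2.trans ?_
        have e : 2 / (1 - ρ) * (θ.β ^ 2 * B)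
            = (1 - ρ) / 2 * (4 * B * (θ.β / (1 - ρ)) ^ 2) := by field_simp; ring
        rw [← e]
        have : 2 / (1 - ρ) * (θ.α ^ 2 * B) ≤ 2 / (1 - ρ) * (θ.β ^ 2 * B) := by gcongr
        exact add_le_add_right this _
    · simp only [meanTracking, Setup.trackingError_zero, integral_zero, Finset.sum_const_zero]
      positivity
  | succ m ih =>
    obtain ⟨C, hC, ih⟩ := ih
    set C₁ := 6 * Λ ^ 4 / κ ^ 2 with hC₁
    set C₂ := 5 * Λ ^ 3 / κ + 6 * Λ ^ 2 / κ ^ 2 * (κ⁻¹ ^ M) ^ 2 with hC₂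
    have hC₁0 : 0 ≤ C₁ := by positivity
    have hC₂0 : 0 ≤ C₂ := by positivity
    refine ⟨(2 * (24 * Λ ^ 2) + 2 * C + C₂)
      + (C₁ * (2 * C + (2 * (24 * Λ ^ 2) + 2 * C + C₂)) + C₂), by positivity,
      fun {K d S Ω} _ _ {c ρ θ W p O P ξ} h hd hαβ hsmall T => ?_⟩
    obtain ⟨ihA, ihE⟩ := ih h hd hαβ hsmall T
    have hρ := h.gossip.one_sub_pos
    have hβ := h.β_pos
    have hα := h.α_nonneg
    have hK : (0 : ℝ) < K := by exact_mod_cast h.K_pos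
    have hz : 0 ≤ ∑ t ∈ Finset.range T, meanDirection θ W O P ξ t :=
      Finset.sum_nonneg fun t _ => meanDirection_nonneg _ _ _ _ _ _
    set η := θ.β / (1 - ρ) with hη
    have hη0 : 0 < η := by positivity
    have hsc := hΛ.trans (smallConst_ge hΛ κ)
    have hη1 : η ≤ 1 := by nlinarith
    have hγΛ := h.gamma_mul_le hΛ hsmall
    have hint := h.integrable_errors hγΛ hd
    have m1 := fun t i => MeanLE.mk (hint t i).1 le_rfl
    have m2 := fun t i => MeanLE.mk (hint t i).2 le_rfl
    set R := errorScale θ W O P ξ ρ T with hR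
    set Z := ∑ t ∈ Finset.range T, meanDirection θ W O P ξ t with hZ
    have hRe : R = 1 / θ.β + T * (θ.β / K) + T * η ^ 2 + (θ.α / θ.β) ^ 2 * Z := rfl
    have t1 : 0 ≤ 1 / θ.β := by positivity
    have t2 : 0 ≤ T * (θ.β / K) := by positivity
    have t3 : 0 ≤ T * η ^ 2 := by positivity
    have t4 : 0 ≤ (θ.α / θ.β) ^ 2 * Z := by positivity
    have hR0 : 0 ≤ R := by rw [hRe]; positivity
    set A := ∑ t ∈ Finset.range T, meanConsensus θ W O P ξ t m.castSucc with hA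
    set E := ∑ t ∈ Finset.range T, meanTracking θ W p O P ξ t m.castSucc with hE
    set A' := ∑ t ∈ Finset.range T, meanConsensus θ W O P ξ t m.succ with hA'
    set E' := ∑ t ∈ Finset.range T, meanTracking θ W p O P ξ t m.succ with hE'
    have hA'0 : 0 ≤ A' := Finset.sum_nonneg fun t _ => meanConsensus_nonneg _ _ _ _ _ _ _
    have k1 : A' ≤ 24 * Λ ^ 2 * R + 32 * Λ ^ 2 * η ^ 2 * (A + E + A' + E') := by
      have key := sum_le_of_recursion (a := fun t => meanConsensus θ W O P ξ t m.succ)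
        (b := fun t => 24 * Λ ^ 2 * η ^ 2 + 32 * Λ ^ 2 * η ^ 2 *
          (meanConsensus θ W O P ξ t m.castSucc + meanTracking θ W p O P ξ t m.castSucc
            + meanConsensus θ W O P ξ t m.succ + meanTracking θ W p O P ξ t m.succ))
        (r := (1 - ρ) / 2) (by linarith)
        (fun t => meanConsensus_nonneg _ _ _ _ _ _ _) (fun t => ?_) T
      · have h0 : meanConsensus θ W O P ξ 0 m.succ = 0 := by
          simp only [meanConsensus, h.consensusError_init, integral_zero]
        simp only [h0, zero_div, zero_add, Finset.sum_add_distrib, ← Finset.mul_sum,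
          Finset.sum_const, Finset.card_range, nsmul_eq_mul] at key
        refine key.trans ?_
        have : 24 * Λ ^ 2 * (T * η ^ 2) ≤ 24 * Λ ^ 2 * R := by gcongr; rw [hRe]; linarith
        exact add_le_add this le_rfl
      · refine (h.meanLE_consensusError_succ (m1 _ _) (m2 _ _) (m1 _ _) (m2 _ _)).2.trans
          (le_of_eq ?_)
        rw [h.γ_eq, hη]
        simp only [meanConsensus, meanTracking]
        field_simp
        ring
    have k2 : E' ≤ C₁ * (A + E + A') + C₂ * R := by
      have key := sum_le_of_recursion (a := fun t => meanTracking θ W p O P ξ t m.succ)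
        (b := fun t => 6 * Λ ^ 4 / κ ^ 2 * (meanConsensus θ W O P ξ t m.castSucc
            + meanTracking θ W p O P ξ t m.castSucc + meanConsensus θ W O P ξ t m.succ)
          + 3 * Λ ^ 3 / κ * (θ.β / K)
          + 6 * Λ ^ 2 / κ ^ 2 * (κ⁻¹ ^ M) ^ 2 * (θ.α / θ.β) ^ 2 * meanDirection θ W O P ξ t)
        (r := θ.β * κ / (2 * Λ)) (by positivity)
        (fun t => meanTracking_nonneg _ _ _ _ _ _ _ _) (fun t => ?_) T
      · have h0 : meanTracking θ W p O P ξ 0 m.succ ≤ Λ ^ 2 := by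
          have := h.prob
          simp only [meanTracking, h.trackingError_init, integral_const, probReal_univ, one_smul]
          exact pow_le_pow_left₀ (norm_nonneg _) ((h.init.dist _).trans h.uniform.D_le) 2
        simp only [Finset.sum_add_distrib, ← Finset.mul_sum,
          Finset.sum_const, Finset.card_range, nsmul_eq_mul] at key
        refine key.trans ?_
        have b1 : meanTracking θ W p O P ξ 0 m.succ / (θ.β * κ / (2 * Λ))
            ≤ 2 * Λ ^ 3 / κ * (1 / θ.β) := by
          calc _ ≤ Λ ^ 2 / (θ.β * κ / (2 * Λ)) := by gcongr
            _ = _ := by field_simp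
        rw [← hZ, ← hA, ← hE, ← hA', mul_assoc _ ((θ.α / θ.β) ^ 2) Z]
        have q1 : 2 * Λ ^ 3 / κ * (1 / θ.β) ≤ 2 * Λ ^ 3 / κ * R := by
          gcongr; rw [hRe]; linarith
        have q2 : 3 * Λ ^ 3 / κ * (T * (θ.β / K)) ≤ 3 * Λ ^ 3 / κ * R := by
          gcongr; rw [hRe]; linarith
        have q3 : 6 * Λ ^ 2 / κ ^ 2 * (κ⁻¹ ^ M) ^ 2 * ((θ.α / θ.β) ^ 2 * Z)
            ≤ 6 * Λ ^ 2 / κ ^ 2 * (κ⁻¹ ^ M) ^ 2 * R := by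
          gcongr; rw [hRe]; linarith
        have q4 : C₂ * R = 2 * Λ ^ 3 / κ * R + 3 * Λ ^ 3 / κ * R
            + 6 * Λ ^ 2 / κ ^ 2 * (κ⁻¹ ^ M) ^ 2 * R := by rw [hC₂]; ring
        rw [q4]
        linarith
      · have hz := (h.meanLE_avg_direction (hd t)).1
        refine (h.meanLE_trackingError_succ hγΛ (m1 _ _) (m2 _ _) (m1 _ _) (m2 _ _)
          ⟨hz, le_rfl⟩).2.trans (le_of_eq ?_)
        rw [h.γ_eq]
        simp only [meanConsensus, meanTracking, meanDirection]
        field_simp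
        ring
    -- This requirement determines `smallConst`.
    have hs : 32 * Λ ^ 2 * η ^ 2 * (1 + C₁) ≤ 1 / 2 := by
      have e : 32 * Λ ^ 2 * η ^ 2 * (1 + C₁) = 1 / 2 * (smallConst Λ κ * η) * η := by
        rw [smallConst, hC₁]; ring
      rw [e]
      have : smallConst Λ κ * η * η ≤ 1 * 1 := by gcongr
      linarith
    obtain ⟨r1, r2⟩ := level_bound hA'0 hR0 hC₁0 hC₂0 hC (by positivity) hs ihA ihE k1 k2
    have u1 : 0 ≤ (2 * (24 * Λ ^ 2) + 2 * C + C₂) * R := by positivity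
    have u2 : 0 ≤ (C₁ * (2 * C + (2 * (24 * Λ ^ 2) + 2 * C + C₂)) + C₂) * R := by positivity
    constructor
    · linarith
    · linarith

end DSMO

end

/-! ### From the errors of the direction to the sum of the squared gradients -/

noncomputable section

namespace DSMO

/-- The linear bound yields the smallness conditions; the second one shows the order of the noise in
the rate. -/
theorem Setup.noiseLevel_le {M K : ℕ} {d : Fin (M + 1) → ℕ} {S Ω : Type*} [MeasurableSpace S]
    [MeasurableSpace Ω] {c : Constants M} {Λ κ ρ : ℝ} {θ : Params M}
    {W : Matrix (Fin K) (Fin K) ℝ} {p : Problem M K d} {O : Oracle M K d S} {P : Measure Ω}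
    {ξ : ℕ → Fin K → Query M → Ω → S} (h : Setup c Λ κ ρ θ W p O P ξ) :
    noiseLevel K θ.β ρ ≤ 2 * (θ.β / (1 - ρ)) ∧
      noiseLevel K θ.β ρ ≤ θ.β / K + (θ.β / (1 - ρ)) ^ 2 := by
  have hρ := h.gossip.one_sub_pos
  have hρ0 := h.gossip.rho_nonneg
  have hβ := h.β_pos
  have hβ1 := h.β_le
  have hK : (1 : ℝ) ≤ K := by exact_mod_cast h.K_pos
  have h1 : θ.β / K ≤ θ.β / (1 - ρ) := by gcongr; linarith
  have h2 : θ.β ^ 2 / (1 - ρ) ≤ θ.β / (1 - ρ) := by gcongr; nlinarith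
  have h3 : θ.β ^ 2 / (1 - ρ) ≤ (θ.β / (1 - ρ)) ^ 2 := by
    rw [div_pow]; gcongr; nlinarith
  rw [noiseLevel]
  constructor <;> linarith

theorem Problem.Regular.continuous_gradient {M K : ℕ} {d : Fin (M + 1) → ℕ} {p : Problem M K d}
    {Λ κ : ℝ} {L : Fin M → ℝ} (h : p.Regular Λ κ L) (hΛ : 1 ≤ Λ) (hκ : 0 < κ) :
    Continuous (gradient p.F) := by
  obtain ⟨G, hG, hgrad⟩ := exists_gradient_bound d hΛ hκ
  refine (LipschitzWith.of_dist_le_mul (K := G.toNNReal) fun x y => ?_).continuous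
  rw [Real.coe_toNNReal _ (by linarith), dist_eq_norm, dist_eq_norm]
  exact (hgrad h).2 x y

theorem Setup.meanLE_sqGrad {M K : ℕ} {d : Fin (M + 1) → ℕ} {S Ω : Type*} [MeasurableSpace S]
    [MeasurableSpace Ω] {c : Constants M} {Λ κ ρ : ℝ} {θ : Params M}
    {W : Matrix (Fin K) (Fin K) ℝ} {p : Problem M K d} {O : Oracle M K d S} {P : Measure Ω}
    {ξ : ℕ → Fin K → Query M → Ω → S} (h : Setup c Λ κ ρ θ W p O P ξ) (hΛ : 1 ≤ Λ) (hκ : 0 < κ)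
    {G : ℝ} (hG : ∀ x, ‖gradient p.F x‖ ≤ G) (t : ℕ) :
    MeanLE P (fun ω => sqGrad θ W p O ξ t ω) (G ^ 2) :=
  have := h.prob
  (MeanLE.const (G ^ 2)).of_le
    (((h.regular.continuous_gradient hΛ hκ).measurable.comp (h.measurable_xBar t)).norm.pow_const 2)
    (fun _ => sq_nonneg _) (fun _ => pow_le_pow_left₀ (norm_nonneg _) (hG _) 2) le_rfl

/-- The noise is bounded in mean and the bias along each path, both in terms of `errorScale`. The
scale still contains the squared directions, because the targets drift with `x̄`; the step size `α`
is small enough to absorb them only in the descent argument. -/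
theorem exists_sum_gradient_error {M : ℕ} (d : Fin (M + 1) → ℕ) {Λ κ : ℝ} (hΛ : 1 ≤ Λ)
    (hκ : 0 < κ) :
    ∃ C, 1 ≤ C ∧ ∀ {K : ℕ} {S Ω : Type*} [MeasurableSpace S] [MeasurableSpace Ω]
      {c : Constants M} {ρ : ℝ} {θ : Params M} {W : Matrix (Fin K) (Fin K) ℝ}
      {p : Problem M K d} {O : Oracle M K d S} {P : Measure Ω}
      {ξ : ℕ → Fin K → Query M → Ω → S}, Setup c Λ κ ρ θ W p O P ξ →
      θ.α ≤ θ.β → C * (θ.β / (1 - ρ)) ≤ 1 → ∀ (T : ℕ) (τ : ℝ), 0 ≤ τ → τ ≤ 1 →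
      (∀ m, (1 - c.κ m) ^ θ.b m ≤ τ) → T * τ ^ 2 ≤ 1 →
      (∀ t, Integrable (fun ω => ‖avg (direction θ W O (fun r k q => ξ r k q ω) t)‖ ^ 2) P) ∧
      MeanLE P (fun ω => ∑ t ∈ Finset.range T,
        ‖gradient p.F (xBar θ W O (fun r k q => ξ r k q ω) t)
          - avg (direction θ W O (fun r k q => ξ r k q ω) t)‖ ^ 2)
        (C * errorScale θ W O P ξ ρ T) := by
  obtain ⟨B, hB, hmom⟩ := exists_direction_moments M hΛ hκ
  obtain ⟨Cb, hCb, hbias⟩ := exists_sum_bias_le d hΛ hκ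
  choose Cl hCl hlev using fun i => exists_sum_level_errors M hΛ hκ hB i
  set Cp := ∑ i, (Cl i + Cl i) with hCp
  have hCp0 : 0 ≤ Cp := Finset.sum_nonneg fun i _ => add_nonneg (hCl i) (hCl i)
  set Q := 16 * Λ ^ 2 * (κ⁻¹ ^ M) ^ 2 with hQ
  have hQ0 : 0 ≤ Q := by positivity
  set Cs := 32 * Λ ^ 6 + 18 * Λ ^ 2 + Q * Cp + Q with hCs
  have hCs0 : 0 ≤ Cs := by positivity
  have hsc := hΛ.trans (smallConst_ge hΛ κ)
  -- The first summand makes the error recursions solvable, the second makes the noise level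
  -- admissible for the moment bounds, and the rest is the constant of the estimate.
  refine ⟨smallConst Λ κ + 2 * B + 2 * (B + Cb * (Cs + 1)), ?_,
    fun {K S Ω} _ _ {c ρ θ W p O P ξ} h hαβ hsmall T τ hτ hτ1 hb hTτ => ?_⟩
  · have : 0 ≤ 2 * B + 2 * (B + Cb * (Cs + 1)) := by positivity
    linarith
  have := h.prob
  have hρ := h.gossip.one_sub_pos
  have hβ := h.β_pos
  have hα := h.α_nonneg
  have hK : (0 : ℝ) < K := by exact_mod_cast h.K_pos
  set η := θ.β / (1 - ρ) with hη
  have hη0 : 0 < η := by positivity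
  have hη1 : smallConst Λ κ * η ≤ 1 := by
    refine le_trans ?_ hsmall
    gcongr
    have : 0 ≤ 2 * B + 2 * (B + Cb * (Cs + 1)) := by positivity
    linarith
  have hη2 : 2 * B * η ≤ 1 := by
    refine le_trans ?_ hsmall
    gcongr
    have : 0 ≤ smallConst Λ κ + 2 * (B + Cb * (Cs + 1)) := by positivity
    linarith
  obtain ⟨hn1, hn2⟩ := h.noiseLevel_le
  have hdir := hmom h (by nlinarith)
  have hz := fun t => (h.meanLE_avg_direction fun k => (hdir t k).1).1
  refine ⟨hz, ?_⟩
  set R := errorScale θ W O P ξ ρ T with hR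
  set Z := ∑ t ∈ Finset.range T, meanDirection θ W O P ξ t with hZ
  have hZ0 : 0 ≤ Z := Finset.sum_nonneg fun t _ => meanDirection_nonneg _ _ _ _ _ _
  have hRe : R = 1 / θ.β + T * (θ.β / K) + T * η ^ 2 + (θ.α / θ.β) ^ 2 * Z := rfl
  have t1 : 0 ≤ 1 / θ.β := by positivity
  have t2 : 0 ≤ T * (θ.β / K) := by positivity
  have t3 : 0 ≤ T * η ^ 2 := by positivity
  have t4 : 0 ≤ (θ.α / θ.β) ^ 2 * Z := by positivity
  -- Since `R ≥ 1`, the truncation contribution `T * τ ^ 2 ≤ 1` is absorbed into `R`.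
  have hR1 : 1 ≤ 1 / θ.β := by rw [le_div_iff₀ hβ]; linarith [h.β_le]
  have hR0 : 0 ≤ R := by rw [hRe]; positivity
  have hint := h.integrable_errors (h.gamma_mul_le hΛ hη1) fun t k => (hdir t k).1
  have hpe : ∀ t, MeanLE P (fun ω => pointError θ W p O (fun r k q => ξ r k q ω) t)
      (∑ i, (meanConsensus θ W O P ξ t i + meanTracking θ W p O P ξ t i)) := fun t => by
    simp only [pointError_eq θ W p O _ h.K_pos]
    exact MeanLE.sum _ fun i _ => (MeanLE.mk (hint t i).1 le_rfl).add ⟨(hint t i).2, le_rfl⟩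
  have hpe' : MeanLE P (fun ω => ∑ t ∈ Finset.range T,
      pointError θ W p O (fun r k q => ξ r k q ω) t) (Cp * R) := by
    refine (MeanLE.sum _ fun t _ => hpe t).mono ?_
    rw [Finset.sum_comm, hCp, Finset.sum_mul]
    refine Finset.sum_le_sum fun i _ => ?_
    obtain ⟨l1, l2⟩ := hlev i h (fun t k => (hdir t k).1) hαβ hη1 T
    rw [Finset.sum_add_distrib, add_mul]
    exact add_le_add l1 l2
  have hmove : MeanLE P (fun ω => ∑ t ∈ Finset.range T,
      ‖xBar θ W O (fun r k q => ξ r k q ω) t - xBar θ W O (fun r k q => ξ r k q ω) (t + 1)‖ ^ 2)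
      (θ.α ^ 2 * Z) := by
    have e : ∀ t ω, ‖xBar θ W O (fun r k q => ξ r k q ω) t
        - xBar θ W O (fun r k q => ξ r k q ω) (t + 1)‖ ^ 2
        = θ.α ^ 2 * ‖avg (direction θ W O (fun r k q => ξ r k q ω) t)‖ ^ 2 := fun t ω => by
      rw [xBar_succ θ W O _ h.gossip, sub_sub_cancel, norm_smul, mul_pow, Real.norm_eq_abs, sq_abs]
    simp only [e]
    rw [hZ, Finset.mul_sum]
    exact MeanLE.sum _ fun t _ => (MeanLE.mk (hz t) le_rfl).const_mul (sq_nonneg _)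
  have hsm : MeanLE P (fun ω => smoothBound θ W p O (fun r k q => ξ r k q ω) Λ κ ρ T)
      (Cs * R) := by
    have := ((MeanLE.const (P := P) (32 * Λ ^ 6 * (T * η ^ 2) + 18 * Λ ^ 2 / θ.β)).add
      (hpe'.const_mul hQ0)).add (hmove.const_mul (a := Q / θ.β ^ 2) (by positivity))
    refine this.mono ?_
    have q1 : 32 * Λ ^ 6 * (T * η ^ 2) ≤ 32 * Λ ^ 6 * R := by gcongr; linarith
    have q2 : 18 * Λ ^ 2 * (1 / θ.β) ≤ 18 * Λ ^ 2 * R := by gcongr; linarith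
    have q3 : Q * ((θ.α / θ.β) ^ 2 * Z) ≤ Q * R := by gcongr; linarith
    have e1 : 18 * Λ ^ 2 / θ.β = 18 * Λ ^ 2 * (1 / θ.β) := by ring
    have e2 : Q / θ.β ^ 2 * (θ.α ^ 2 * Z) = Q * ((θ.α / θ.β) ^ 2 * Z) := by field_simp
    rw [e1, e2, hCs]
    linarith
  have hnoise : MeanLE P (fun ω => ∑ t ∈ Finset.range T, avg fun k =>
      ‖direction θ W O (fun r k q => ξ r k q ω) t k
        - smoothDirection θ W p O (fun r k q => ξ r k q ω) t k‖ ^ 2) (B * R) := by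
    refine (MeanLE.sum _ fun t _ => MeanLE.avg h.K_pos fun k => (hdir t k).2).mono ?_
    rw [Finset.sum_const, Finset.card_range, nsmul_eq_mul]
    calc (T : ℝ) * (B * noiseLevel K θ.β ρ) = B * (T * noiseLevel K θ.β ρ) := by ring
      _ ≤ B * (T * (θ.β / K + η ^ 2)) := by gcongr
      _ ≤ B * R := by gcongr; linarith
  refine ((hnoise.add ((hsm.add (MeanLE.const (T * τ ^ 2))).const_mul hCb)).const_mul
    (zero_le_two (α := ℝ))).of_le ?_ (fun ω => by positivity) (fun ω => ?_) ?_
  · exact Finset.measurable_fun_sum _ fun t _ =>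
      (((h.regular.continuous_gradient hΛ hκ).measurable.comp (h.measurable_xBar t)).sub
        (measurable_avg fun k => h.measurable_direction t k)).norm.pow_const 2
  · have key := hbias h τ hτ hτ1 hb (fun r k q => ξ r k q ω) T
    refine le_trans ?_ (mul_le_mul_of_nonneg_left (add_le_add le_rfl key) zero_le_two)
    rw [← Finset.sum_add_distrib, Finset.mul_sum]
    refine Finset.sum_le_sum fun t _ => ?_
    set D := direction θ W O (fun r k q => ξ r k q ω) t
    set D' := smoothDirection θ W p O (fun r k q => ξ r k q ω) t
    set g := gradient p.F (xBar θ W O (fun r k q => ξ r k q ω) t)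
    have e : avg D - g = avg (fun k => D k - D' k) + (avg D' - g) := by
      rw [avg_sub]; abel
    rw [norm_sub_rev, e]
    have h1 := norm_add_sq_le (avg fun k => D k - D' k) (avg D' - g)
    have h2 := norm_avg_sq_le fun k => D k - D' k
    linarith
  · have : Cb * (Cs * R + T * τ ^ 2) ≤ Cb * (Cs * R + R) := by gcongr; linarith
    have : 0 ≤ (smallConst Λ κ + 2 * B) * R := by positivity
    linarith

/-- Polarization turns the inner product in the descent inequality into `‖g‖² + ‖z‖² - ‖g - z‖²`,
where `z` is the averaged direction. Half of `‖z‖²` pays for the second-order term. The other half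
absorbs the squared directions in `errorScale`, where they carry only the factor `C₀²`. -/
theorem exists_sum_gradient_le {M : ℕ} (d : Fin (M + 1) → ℕ) {Λ κ : ℝ} (hΛ : 1 ≤ Λ)
    (hκ : 0 < κ) :
    ∃ C, 1 ≤ C ∧ ∀ {K : ℕ} {S Ω : Type*} [MeasurableSpace S] [MeasurableSpace Ω]
      {c : Constants M} {ρ : ℝ} {θ : Params M} {W : Matrix (Fin K) (Fin K) ℝ}
      {p : Problem M K d} {O : Oracle M K d S} {P : Measure Ω}
      {ξ : ℕ → Fin K → Query M → Ω → S}, Setup c Λ κ ρ θ W p O P ξ →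
      ∀ C₀, 0 < C₀ → C * C₀ ≤ 1 → θ.α = C₀ * θ.β → C * (θ.β / (1 - ρ)) ≤ 1 →
      ∀ (T : ℕ) (τ : ℝ), 0 ≤ τ → τ ≤ 1 → (∀ m, (1 - c.κ m) ^ θ.b m ≤ τ) → T * τ ^ 2 ≤ 1 →
      ∑ t ∈ Finset.range T, ∫ ω, sqGrad θ W p O ξ t ω ∂P
        ≤ C / C₀ * (1 / θ.β + T * (θ.β / K) + T * (θ.β / (1 - ρ)) ^ 2) := by
  obtain ⟨G, hG, hgrad⟩ := exists_gradient_bound d hΛ hκ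
  obtain ⟨A, hA, herr⟩ := exists_sum_gradient_error d hΛ hκ
  refine ⟨2 * Λ + 2 * A + 4 * G, by linarith,
    fun {K S Ω} _ _ {c ρ θ W p O P ξ} h C₀ hC₀ hCC hα hsmall T τ hτ hτ1 hb hTτ => ?_⟩
  have := h.prob
  have hρ := h.gossip.one_sub_pos
  have hβ := h.β_pos
  have hβ1 := h.β_le
  have hK : (0 : ℝ) < K := by exact_mod_cast h.K_pos
  have hC₀1 : C₀ ≤ 1 := by nlinarith
  have hint := fun t => (h.meanLE_sqGrad hΛ hκ (hgrad h.regular).1 t).integrable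
  have hA0 : 2 * A * C₀ ≤ 1 := by nlinarith
  have hG0 : 4 * G * C₀ ≤ 1 := by nlinarith
  have hη0 : 0 < θ.β / (1 - ρ) := by positivity
  obtain ⟨hz, herr⟩ := herr h (by rw [hα]; nlinarith) (by nlinarith) T τ hτ hτ1 hb hTτ
  have hα0 : 0 < θ.α := by rw [hα]; positivity
  have hGα : 4 * (G * θ.α) ≤ 1 := by rw [hα]; nlinarith
  have hpath : ∀ ω, ∑ t ∈ Finset.range T, sqGrad θ W p O ξ t ω
      + 1 / 2 * ∑ t ∈ Finset.range T, ‖avg (direction θ W O (fun r k q => ξ r k q ω) t)‖ ^ 2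
      ≤ 2 * Λ / θ.α + ∑ t ∈ Finset.range T,
        ‖gradient p.F (xBar θ W O (fun r k q => ξ r k q ω) t)
          - avg (direction θ W O (fun r k q => ξ r k q ω) t)‖ ^ 2 := fun ω => by
    have step : ∀ t, sqGrad θ W p O ξ t ω
        + 1 / 2 * ‖avg (direction θ W O (fun r k q => ξ r k q ω) t)‖ ^ 2
        ≤ 2 / θ.α * (p.F (xBar θ W O (fun r k q => ξ r k q ω) t)
            - p.F (xBar θ W O (fun r k q => ξ r k q ω) (t + 1)))
          + ‖gradient p.F (xBar θ W O (fun r k q => ξ r k q ω) t)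
          - avg (direction θ W O (fun r k q => ξ r k q ω) t)‖ ^ 2 := fun t => by
      have hd := h.regular.descent (hgrad h.regular).2
        (xBar θ W O (fun r k q => ξ r k q ω) t) (xBar θ W O (fun r k q => ξ r k q ω) (t + 1))
      rw [sqGrad]
      set z := avg (direction θ W O (fun r k q => ξ r k q ω) t)
      set g := gradient p.F (xBar θ W O (fun r k q => ξ r k q ω) t)
      have e : xBar θ W O (fun r k q => ξ r k q ω) (t + 1)
          - xBar θ W O (fun r k q => ξ r k q ω) t = -(θ.α • z) := by
        rw [xBar_succ θ W O _ h.gossip]; abel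
      rw [e, inner_neg_right, inner_smul_right, norm_neg, norm_smul, Real.norm_of_nonneg hα0.le,
        mul_pow] at hd
      have hp := norm_sub_sq_real g z
      rw [hp, ← sub_le_iff_le_add, div_mul_eq_mul_div 2 θ.α, le_div_iff₀ hα0]
      have : 4 * (G * θ.α) * (θ.α * ‖z‖ ^ 2) ≤ 1 * (θ.α * ‖z‖ ^ 2) := by gcongr
      nlinarith
    have hs := Finset.sum_le_sum fun t (_ : t ∈ Finset.range T) => step t
    rw [Finset.sum_add_distrib, Finset.sum_add_distrib, ← Finset.mul_sum, ← Finset.mul_sum,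
      Finset.sum_range_sub'] at hs
    refine hs.trans (add_le_add ?_ le_rfl)
    have h0 : xBar θ W O (fun r k q => ξ r k q ω) 0 = 0 := avg_const h.K_pos 0
    rw [h0, div_mul_eq_mul_div]
    have := (h.init.gap (xBar θ W O (fun r k q => ξ r k q ω) T)).trans h.uniform.Δ_le
    gcongr
  have i1 : Integrable (fun ω => ∑ t ∈ Finset.range T, sqGrad θ W p O ξ t ω) P :=
    integrable_finsetSum _ fun t _ => hint t
  have i2 : Integrable (fun ω => 1 / 2 * ∑ t ∈ Finset.range T,
      ‖avg (direction θ W O (fun r k q => ξ r k q ω) t)‖ ^ 2) P :=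
    (integrable_finsetSum _ fun t _ => hz t).const_mul _
  have hm := integral_mono (i1.add i2) ((integrable_const _).add herr.1) hpath
  simp only [Pi.add_apply] at hm
  rw [integral_add i1 i2, integral_add (integrable_const _) herr.1, integral_const_mul,
    integral_finsetSum _ fun t _ => hint t, integral_finsetSum _ fun t _ => hz t, integral_const,
    probReal_univ, one_smul] at hm
  have he := herr.2
  set Z := ∑ t ∈ Finset.range T, meanDirection θ W O P ξ t with hZ
  have hZ0 : 0 ≤ Z := Finset.sum_nonneg fun t _ => meanDirection_nonneg _ _ _ _ _ _
  change _ + 1 / 2 * Z ≤ _ at hm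
  set X := 1 / θ.β + T * (θ.β / K) + T * (θ.β / (1 - ρ)) ^ 2 with hX
  have hRe : errorScale θ W O P ξ ρ T = X + C₀ ^ 2 * Z := by
    rw [errorScale, hα, mul_div_cancel_right₀ _ hβ.ne']
  rw [hRe] at he
  have hX1 : 1 / θ.β ≤ X := by
    have : 0 ≤ T * (θ.β / K) + T * (θ.β / (1 - ρ)) ^ 2 := by positivity
    linarith
  have hX0 : 0 ≤ X := le_trans (by positivity) hX1
  -- The absorption: `2 * A * C₀ ≤ 1` and `C₀ ≤ 1`. This is the reason for the upper bound on `C₀`.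
  have h1 : A * (C₀ ^ 2 * Z) ≤ 1 / 2 * Z := by
    have : A * C₀ * C₀ * Z ≤ 1 / 2 * 1 * Z := by gcongr; linarith
    linarith
  have h2 : 2 * Λ / θ.α ≤ 2 * Λ / C₀ * X := by
    calc 2 * Λ / θ.α = 2 * Λ / C₀ * (1 / θ.β) := by rw [hα]; field_simp
      _ ≤ _ := by gcongr
  have h3 : A * X ≤ 2 * A / C₀ * X := by
    gcongr
    rw [le_div_iff₀ hC₀]
    nlinarith
  have h4 : 0 ≤ 4 * G / C₀ * X := by positivity
  have e : (2 * Λ + 2 * A + 4 * G) / C₀ * X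
      = 2 * Λ / C₀ * X + 2 * A / C₀ * X + 4 * G / C₀ * X := by ring
  rw [e]
  linarith

end DSMO

end

/-! ### The parameters of the algorithm and the rate -/

noncomputable section

namespace DSMO

theorem pow_params_le {M : ℕ} {c : Constants M} (hc : c.Valid) (C₀ : ℝ) (K : ℕ) {T : ℕ}
    (hT : 1 ≤ T) (m : Fin M) : (1 - c.κ m) ^ (params c C₀ K T).b m ≤ 1 / (T : ℝ) := by
  have h0 : 0 < 1 - c.κ m := by linarith [hc.κ_lt_one m]
  have h1 : 1 - c.κ m < 1 := by linarith [hc.κ_pos m]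
  have hT0 : (0 : ℝ) < T := by exact_mod_cast hT
  have hinv : 1 < 1 / (1 - c.κ m) := by rwa [lt_div_iff₀ h0, one_mul]
  set n := ⌈Real.logb (1 / (1 - c.κ m)) (T : ℝ)⌉₊ with hn
  have h2 : (1 - c.κ m) ^ n ≤ 1 / (T : ℝ) := by
    have h3 := (Real.logb_le_iff_le_rpow hinv hT0).1
      (Nat.le_ceil (Real.logb (1 / (1 - c.κ m)) (T : ℝ)))
    rw [← hn, Real.rpow_natCast, div_pow, one_pow] at h3
    rw [le_div_iff₀ hT0]
    rwa [le_div_iff₀ (by positivity), mul_comm] at h3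
  refine le_trans ?_ h2
  -- A third of the exponent `b m` already gives `1 / T`, and this accuracy suffices.
  exact pow_le_pow_of_le_one h0.le h1.le (Nat.le_mul_of_pos_left n (by norm_num))

/-- The assumptions of the theorem give a setup with the parameters of the algorithm. -/
theorem setup_params {M K T : ℕ} {d : Fin (M + 1) → ℕ} {S Ω : Type*} [MeasurableSpace S]
    [MeasurableSpace Ω] {c : Constants M} (hc : c.Valid) {Λ κ ρ C₀ : ℝ}
    (hu : c.Uniform d Λ κ) (hC₀ : 0 ≤ C₀) (hK : 1 ≤ K) (hKT : K ≤ T)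
    {W : Matrix (Fin K) (Fin K) ℝ} (hW : IsGossip W ρ) {p : Problem M K d} {O : Oracle M K d S}
    {P : Measure Ω} (hP : IsProbabilityMeasure P) {ξ : ℕ → Fin K → Query M → Ω → S}
    (hO : O.Unbiased p) (hξ : IsSampling O P ξ) (h1 : OuterAssumptions c p O)
    (h2 : InnerAssumptions c p O) (h3 : InitialBounds c p) :
    Setup c Λ κ ρ (params c C₀ K T) W p O P ξ where
  valid := hc
  uniform := hu
  K_pos := hK
  gossip := hW
  prob := hP
  unbiased := hO
  sampling := hξ
  outer := h1
  inner := h2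
  init := h3
  L_eq := rfl
  μ_eq := rfl
  β_pos := Real.sqrt_pos.2 (div_pos (by exact_mod_cast hK) (by exact_mod_cast hK.trans hKT))
  β_le := Real.sqrt_le_one.2 (div_le_one_of_le₀ (by exact_mod_cast hKT) (Nat.cast_nonneg _))
  γ_eq := rfl
  α_nonneg := mul_nonneg hC₀ (Real.sqrt_nonneg _)

theorem rate_identities {K T : ℕ} (hK : 1 ≤ K) (hT : 1 ≤ T) (r : ℝ) :
    1 / (T : ℝ) * (1 / √((K : ℝ) / T)) = 1 / √((K : ℝ) * T) ∧
      √((K : ℝ) / T) / K = 1 / √((K : ℝ) * T) ∧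
      (√((K : ℝ) / T) / r) ^ 2 = (K : ℝ) / (T * r ^ 2) := by
  have hK0 : (0 : ℝ) < K := by exact_mod_cast hK
  have hT0 : (0 : ℝ) < T := by exact_mod_cast hT
  have e1 : √((K : ℝ) / T) = K / √((K : ℝ) * T) := by
    rw [eq_div_iff (by positivity), ← Real.sqrt_mul (by positivity)]
    rw [show (K : ℝ) / T * (K * T) = K ^ 2 by field_simp, Real.sqrt_sq hK0.le]
  have e2 : √((T : ℝ) * K) ^ 2 = T * K := Real.sq_sqrt (by positivity)
  have hs : 0 < √((K : ℝ) * T) := by positivity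
  refine ⟨?_, ?_, ?_⟩
  · rw [e1]
    field_simp
    linarith
  · rw [e1]
    field_simp
  · rw [div_pow, Real.sq_sqrt (by positivity), div_div]

/-- The rate of convergence: the bound for all numbers of iterations. -/
theorem exists_avgSqGrad_le {M : ℕ} (d : Fin (M + 1) → ℕ) {c : Constants M} (hc : c.Valid) :
    ∃ C₀max : ℝ, 0 < C₀max ∧ ∀ C₀, 0 < C₀ → C₀ ≤ C₀max → ∃ C, 0 < C ∧
      ∀ {K : ℕ}, 1 ≤ K → ∀ {W : Matrix (Fin K) (Fin K) ℝ} {ρ : ℝ}, IsGossip W ρ →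
      ∀ {S Ω : Type*} [MeasurableSpace S] [MeasurableSpace Ω] {P : Measure Ω},
        IsProbabilityMeasure P → ∀ {p : Problem M K d} {O : Oracle M K d S}
        {ξ : ℕ → Fin K → Query M → Ω → S}, O.Unbiased p → IsSampling O P ξ →
        OuterAssumptions c p O → InnerAssumptions c p O → InitialBounds c p →
        Differentiable ℝ p.F ∧ ∀ T : ℕ, K ≤ T →
          (∀ t, Integrable (sqGrad (params c C₀ K T) W p O ξ t) P) ∧
          avgSqGrad (params c C₀ K T) W p O P ξ T
            ≤ C * (1 / √((K : ℝ) * T)) + C * ((K : ℝ) / (T * (1 - ρ) ^ 2)) := by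
  obtain ⟨Λ, κ, hu⟩ := hc.exists_uniform d
  have hΛ := hu.one_le
  have hκ := hu.κ_pos
  obtain ⟨G, hG, hgrad⟩ := exists_gradient_bound d hΛ hκ
  obtain ⟨A, hA, hsum⟩ := exists_sum_gradient_le d hΛ hκ
  -- The factor `2` is due to `1 / (T β)` and `β / K` both being equal to `1 / √(K T)`; the summand
  -- `G ^ 2 * A ^ 2` serves the case of large `β / (1 - ρ)`.
  refine ⟨1 / A, by positivity, fun C₀ hC₀ hC₀A => ⟨2 * (A / C₀) + G ^ 2 * A ^ 2, by positivity,
    fun {K} hK {W ρ} hW {S Ω} _ _ {P} hP {p O ξ} hO hξ h1 h2 h3 => ?_⟩⟩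
  have hset := fun T (hKT : K ≤ T) => setup_params hc hu hC₀.le hK hKT hW hP hO hξ h1 h2 h3
  refine ⟨(hset K le_rfl).regular.differentiable_F, fun T hKT => ?_⟩
  have h := hset T hKT
  have hT := hK.trans hKT
  have hT0 : (0 : ℝ) < T := by exact_mod_cast hT
  have hK0 : (0 : ℝ) < K := by exact_mod_cast hK
  have hm := h.meanLE_sqGrad hΛ hκ (hgrad h.regular).1
  refine ⟨fun t => (hm t).integrable, ?_⟩
  obtain ⟨e1, e2, e3⟩ := rate_identities hK hT (1 - ρ)
  have hρ := hW.one_sub_pos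
  set s := 1 / √((K : ℝ) * T) with hs
  set r := (K : ℝ) / (T * (1 - ρ) ^ 2) with hr
  have hs0 : 0 ≤ s := by positivity
  have hr0 : 0 ≤ r := by positivity
  rw [avgSqGrad]
  by_cases hsmall : A * ((params c C₀ K T).β / (1 - ρ)) ≤ 1
  · have key := hsum h C₀ hC₀ (by rwa [le_div_iff₀ (by linarith), mul_comm] at hC₀A) rfl hsmall T
      (1 / T) (by positivity) ((div_le_one hT0).2 (by exact_mod_cast hT))
      (pow_params_le hc C₀ K hT) (by
        rw [div_pow, one_pow, mul_one_div, sq, div_mul_cancel_left₀ hT0.ne']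
        exact inv_le_one_of_one_le₀ (by exact_mod_cast hT))
    have hβ : (params c C₀ K T).β = √((K : ℝ) / T) := rfl
    rw [hβ, e2, e3] at key
    have key' := mul_le_mul_of_nonneg_left key (by positivity : 0 ≤ 1 / (T : ℝ))
    refine key'.trans ?_
    have e : 1 / (T : ℝ) * (A / C₀ * (1 / √((K : ℝ) / T) + T * s + T * r))
        = A / C₀ * (1 / (T : ℝ) * (1 / √((K : ℝ) / T)) + s + r) := by field_simp
    rw [e, e1]
    have p1 : 0 ≤ A / C₀ * r := by positivity
    have p2 : 0 ≤ G ^ 2 * A ^ 2 * (s + r) := by positivity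
    linarith
  · have hβ : (params c C₀ K T).β = √((K : ℝ) / T) := rfl
    -- For large `β / (1 - ρ)` the claimed bound exceeds a multiple of `1`, and boundedness of the
    -- gradient is enough.
    have h4 : 1 ≤ A ^ 2 * r := by
      rw [← e3, ← mul_pow, ← hβ]
      exact one_le_pow₀ (not_le.1 hsmall).le
    have h5 : 1 / (T : ℝ) * ∑ t ∈ Finset.range T, ∫ ω, sqGrad (params c C₀ K T) W p O ξ t ω ∂P
        ≤ G ^ 2 := by
      calc _ ≤ 1 / (T : ℝ) * ∑ t ∈ Finset.range T, G ^ 2 := by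
            gcongr with t
            exact (hm t).le
        _ = G ^ 2 := by simp [hT0.ne']
    have h6 : G ^ 2 * 1 ≤ G ^ 2 * (A ^ 2 * r) := by gcongr
    have p1 : 0 ≤ 2 * (A / C₀) * (s + r) := by positivity
    have p2 : 0 ≤ G ^ 2 * A ^ 2 * s := by positivity
    linarith

/-- The number of iterations that suffices for the accuracy `ε`. -/
theorem rate_le_accuracy {C ε ρ : ℝ} (hC : 0 < C) (hε : 0 < ε) (hρ : 0 < 1 - ρ) {K T : ℕ}
    (hK : 1 ≤ K) (hT : 1 ≤ T) (h1 : (K : ℝ) ^ 2 * ε ≤ (1 - ρ) ^ 2)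
    (h2 : (4 * C ^ 2 + 2 * C) / ((K : ℝ) * ε ^ 2) ≤ T) :
    C * (1 / √((K : ℝ) * T)) + C * ((K : ℝ) / (T * (1 - ρ) ^ 2)) ≤ ε := by
  have hK0 : (0 : ℝ) < K := by exact_mod_cast hK
  have hT0 : (0 : ℝ) < T := by exact_mod_cast hT
  rw [div_le_iff₀ (by positivity)] at h2
  -- The summand `4 * C ^ 2` makes the first term at most `ε / 2`. The summand `2 * C` does so for
  -- the second one, with the help of `K² ε ≤ (1 - ρ)²`.
  have h3 : 2 * C / ε ≤ √((K : ℝ) * T) := by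
    refine Real.le_sqrt_of_sq_le ?_
    rw [div_pow, div_le_iff₀ (by positivity)]
    nlinarith
  have h4 : C * (1 / √((K : ℝ) * T)) ≤ ε / 2 := by
    rw [mul_one_div, div_le_iff₀ (by positivity)]
    rw [div_le_iff₀ hε] at h3
    linarith
  have h5 : C * ((K : ℝ) / (T * (1 - ρ) ^ 2)) ≤ ε / 2 := by
    rw [mul_div_assoc', div_le_iff₀ (by positivity)]
    have h6 : (K : ℝ) ^ 2 * ε * T ≤ (1 - ρ) ^ 2 * T := by gcongr
    have h7 : 2 * C ≤ T * (K * ε ^ 2) := by nlinarith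
    have h8 : 2 * C * K ≤ T * (K * ε ^ 2) * K := by gcongr
    have h9 : (K : ℝ) ^ 2 * ε * T * ε ≤ (1 - ρ) ^ 2 * T * ε := by gcongr
    linarith
  linarith

end DSMO

end

theorem theorem1 (M : ℕ) (hM : 1 ≤ M) (d : Fin (M + 1) → ℕ)
    (c : DSMO.Constants M) (hc : c.Valid) :
    ∃ C₀max : ℝ, 0 < C₀max ∧ ∀ C₀ : ℝ, 0 < C₀ → C₀ ≤ C₀max → ∃ C : ℝ, 0 < C ∧
      ∀ (K : ℕ), 1 ≤ K → ∀ (W : Matrix (Fin K) (Fin K) ℝ) (ρ : ℝ), DSMO.IsGossip W ρ →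
      ∀ (S : Type*) [MeasurableSpace S] (Ω : Type*) [MeasurableSpace Ω]
        (P : MeasureTheory.Measure Ω) [MeasureTheory.IsProbabilityMeasure P]
        (p : DSMO.Problem M K d) (O : DSMO.Oracle M K d S)
        (ξ : ℕ → Fin K → DSMO.Query M → Ω → S),
        O.Unbiased p → DSMO.IsSampling O P ξ →
        DSMO.OuterAssumptions c p O → DSMO.InnerAssumptions c p O → DSMO.InitialBounds c p →
        Differentiable ℝ p.F ∧
        ∀ T : ℕ, K ≤ T →
          (∀ t, MeasureTheory.Integrable
            (DSMO.sqGrad (DSMO.params c C₀ K T) W p O ξ t) P) ∧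
          DSMO.avgSqGrad (DSMO.params c C₀ K T) W p O P ξ T
            ≤ C * (1 / Real.sqrt ((K : ℝ) * T)) + C * ((K : ℝ) / (T * (1 - ρ) ^ 2)) ∧
          ∀ ε : ℝ, 0 < ε → (K : ℝ) ^ 2 * ε ≤ (1 - ρ) ^ 2 → C / ((K : ℝ) * ε ^ 2) ≤ T →
            DSMO.avgSqGrad (DSMO.params c C₀ K T) W p O P ξ T ≤ ε := by
  obtain ⟨C₀max, hpos, hmain⟩ := DSMO.exists_avgSqGrad_le d hc
  refine ⟨C₀max, hpos, fun C₀ h0 h0' => ?_⟩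
  obtain ⟨C, hC, hmain⟩ := hmain C₀ h0 h0'
  -- The same constant has to serve for the rate and for the number of iterations; the latter
  -- depends quadratically on the former.
  refine ⟨4 * C ^ 2 + 2 * C, by positivity,
    fun K hK W ρ hW S _ Ω _ P hP p O ξ hO hξ h1 h2 h3 => ?_⟩
  obtain ⟨hF, hT⟩ := hmain hK hW hP hO hξ h1 h2 h3
  refine ⟨hF, fun T hKT => ⟨(hT T hKT).1, (hT T hKT).2.trans ?_, fun ε hε hε1 hε2 =>
    (hT T hKT).2.trans (DSMO.rate_le_accuracy hC hε hW.one_sub_pos hK (hK.trans hKT) hε1 hε2)⟩⟩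
  have hle : C ≤ 4 * C ^ 2 + 2 * C := by nlinarith
  have hρ := hW.one_sub_pos
  gcongr
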